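/- **Setting.** For integers $n,m\ge 0$ let $[n;m]=\{1,2,\dots,n,n+2,n+4,\dots,n+2m\}$ and $[k]=\{1,\dots,k\}$. For $a\in\mathbb C$ put $\bar a_i=a+(i-1)^2$, $a_i=\prod_{1\le j\le i,\ j\equiv i\,(2)}\bar a_j$, and likewise $\bar b_i,b_i$ for $b\in\mathbb C$. The generalized Umemura polynomials are $$U^{(k)}_{n,m}(z,w;a,b)=\sum_{[k]\subset I\subset[n;m]}\ \prod_{i\in I\setminus[k],\,j\in[k]}\frac{i+j}{i-j}\ \prod_{i\in I,\,j\in[n;m]\setminus I}\left|\frac{i+j}{i-j}\right|\,(-1)^{\mathbf c(I)}\prod_{i\in I\setminus[k]}a_iz^i\prod_{j\in[n;m]\setminus I}b_jw^j ,$$ with $\mathbf c(I)=\sum_{i\in I,\,i>n}\frac{i-n}2$ (an empty sum is $0$), and $U_{n,m}=U^{(0)}_{n,m}$. Let $z=\sinh\frac x2$, $w=\cosh\frac x2$, so $z^2=\frac14(e^x+e^{-x}-2)$, $w^2=\frac14(e^x+e^{-x}+2)$, and let $D_x^2f\circ g=f''g-2f'g'+fg''$ with $'=d/dx$. The variables $x$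 and $t$ are related by $e^{2x}=t/(t-1)$. For $\mathbf b=(b_1,b_2,b_3,b_4)\in\mathbb C^4$ let $$H_{VI}(\mathbf b;t,q,p)=\tfrac1{t(t-1)}\Big[q(q-1)(q-t)p^2-\{(b_1+b_2)(q-1)(q-t)+(b_1-b_2)q(q-t)+(b_3+b_4)q(q-1)\}p+(b_1+b_3)(b_1+b_4)(q-t)\Big],$$ with Hamiltonian system $\frac{dq}{dt}=\frac{\partial H_{VI}}{\partial p}$, $\frac{dp}{dt}=-\frac{\partial H_{VI}}{\partial q}$. A $\tau$-function of a solution $(q,p)$ is a holomorphic function $\tau\not\equiv 0$ with $\frac d{dt}\log\tau=H_{VI}(\mathbf b;t,q(t),p(t))$. Let $E_{VI}(\mathbf b)$ be the equation $$\frac{dh}{dt}\Big[t(t-1)\frac{d^2h}{dt^2}\Big]^2+\Big[\frac{dh}{dt}\Big\{2h-(2t-1)\frac{dh}{dt}\Big\}+b_1b_2b_3b_4\Big]^2=\prod_{k=1}^4\Big(\frac{dh}{dt}+b_k^2\Big),$$ and $P_{VI}(\alpha,\beta,\gamma,\delta)$ the equation $$\frac{d^2q}{dt^2}=\frac12\Big(\frac1q+\frac1{q-1}+\frac1{q-t}\Big)\Big(\frac{dq}{dt}\Big)^2-\Big(\frac1t+\frac1{t-1}+\frac1{q-t}\Big)\frac{dq}{dt}+\frac{q(q-1)(q-t)}{t^2(t-1)^2}\Big(\alpha+\beta\frac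 t{q^2}+\gamma\frac{t-1}{(q-1)^2}+\delta\frac{t(t-1)}{(q-t)^2}\Big).$$ Write $e_2$ for the second elementary symmetric polynomial. **Corollary 1.** Let $n,m\ge0$ be integers, $a\in\mathbb C$, $b=0$. (i) The term $\frac4{(n+2m+1)^2}\,ab(a-b)\,z^2w^2\big(U^{(1)}_{n,m}\big)^2$ vanishes, and for $m\ge1$ the polynomials $U_{n,m}=U_{n,m}(z,w;a,0)$ satisfy $$U_{n,m-1}U_{n,m+1}=\big(-\bar a_{n+2m+2}z^2+\bar b_{n+2m+2}w^2\big)U_{n,m}^2+8z^2w^2D_x^2U_{n,m}\circ U_{n,m},\qquad \bar b_{n+2m+2}=(n+2m+1)^2 .$$ (ii) Suppose that $U_{n,m}(z,w;a,0)$ is not the zero polynomial. Let $b_1\in\mathbb C$ with $a=-4b_1^2$, let $\mathbf b=(b_1,0,\frac n2,\frac{n+2m+1}2)$, let $\Omega\subset\mathbb C$ be open and $x=x(t)$ holomorphic on $\Omega$ with $e^{2x(t)}=t/(t-1)$. As a function of $t$ on $\Omega$, $U_{n,m}$ vanishes only on a closed discrete subset of $\Omega$, and $$h=t(t-1)\frac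 d{dt}\log U_{n,m}-h_0,\qquad h_0=\frac{b_1^2}4\,\frac zw ,$$ satisfies $E_{VI}(\mathbf b)$ at every point of $\Omega$ where $U_{n,m}\ne0$. (iii) Suppose in addition that $a\neq-\kappa^2$, where $\kappa=n$ if $n$ is even and $\kappa=n+2m+1$ if $n$ is odd. Then $\frac{d^2h}{dt^2}$ is nonzero off a closed discrete subset of $\Omega$, and there are meromorphic functions $q,p$ on $\Omega$ which solve the Hamiltonian system with Hamiltonian $H_{VI}(\mathbf b;t,q,p)$ and satisfy $$h=t(t-1)H_{VI}(\mathbf b;t,q,p)+e_2(b_1,b_3,b_4)\,t-\tfrac12e_2(b_1,b_2,b_3,b_4).$$ Equivalently, on every open $V\subset\Omega$ and for every zero-free holomorphic $G$ on $V$ with $\frac d{dt}\log G=-\frac{h_0+e_2(b_1,b_3,b_4)t-\frac12e_2(\mathbf b)}{t(t-1)}$, the function $\tau=U_{n,m}\cdot G$ is a $\tau$-function of $(q,p)$. Moreover $q$ is not identically $0$, $1$ or $t$ near any point of $\Omega$, and it is a solution on $\Omega$ of $P_{VI}(\alpha,\beta,\gamma,\delta)$ with $$\alpha=\tfrac12(b_3-b_4)^2,\quad\beta=-\tfrac12(b_1+b_2)^2,\quad\gamma=\tfrac12(b_1-b_2)^2,\quad\delta=-\tfrac12(b_3+b_4)(b_3+b_4+2).$$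 -/

import Mathlib

namespace Umemura

/-! ### Generalized Umemura polynomials -/

/-- The index set `[n;m] = {1, 2, …, n, n+2, n+4, …, n+2m}`. -/
def idx (n m : ℕ) : Finset ℕ :=
  Finset.Icc 1 n ∪ (Finset.Icc 1 m).image (fun j => n + 2 * j)

/-- `\bar a_i = a + (i-1)^2`. -/
noncomputable def abar (a : ℂ) (i : ℕ) : ℂ := a + ((i : ℂ) - 1) ^ 2

/-- `a_i`: the product of the `\bar a_j` over `1 ≤ j ≤ i` with `j` of the same parity as `i`. -/
noncomputable def aseq (a : ℂ) (i : ℕ) : ℂ :=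
  ∏ j ∈ (Finset.Icc 1 i).filter (fun j => j % 2 = i % 2), abar a j

/-- `d_{n,m}(I) = ∏_{i ∈ I, j ∈ [n;m] \ I} |(i+j)/(i-j)|`. -/
def dcoef (n m : ℕ) (I : Finset ℕ) : ℚ :=
  ∏ i ∈ I, ∏ j ∈ idx n m \ I, |((i : ℚ) + j) / ((i : ℚ) - j)|

/-- `c(I) = ∑_{i ∈ I, i > n} (i-n)/2`. -/
def csum (n : ℕ) (I : Finset ℕ) : ℕ := ∑ i ∈ I.filter (fun i => n < i), (i - n) / 2

/-- The generalized Umemura polynomial `U_{n,m}^{(k)}(z,w;a,b)`, as a polynomial function. The sum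
is over the sets `I` with `[k] ⊆ I ⊆ [n;m]`. -/
noncomputable def U (n m k : ℕ) (a b z w : ℂ) : ℂ :=
  ∑ I ∈ (idx n m).powerset.filter (fun I => Finset.Icc 1 k ⊆ I),
    (∏ i ∈ I \ Finset.Icc 1 k, ∏ j ∈ Finset.Icc 1 k, ((i : ℂ) + j) / ((i : ℂ) - j)) *
      (dcoef n m I : ℂ) * (-1) ^ csum n I *
      ((∏ i ∈ I \ Finset.Icc 1 k, aseq a i) * (∏ j ∈ idx n m \ I, aseq b j) *
        z ^ (∑ i ∈ I \ Finset.Icc 1 k, i) * w ^ (∑ j ∈ idx n m \ I, j))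

/-! ### The variable `x` and the recurrence relation -/

/-- `z = sinh (x/2)`, a square root of `(e^x + e^{-x} - 2)/4`. -/
noncomputable def zOf (x : ℂ) : ℂ := Complex.sinh (x / 2)

/-- `w = cosh (x/2)`, a square root of `(e^x + e^{-x} + 2)/4`. -/
noncomputable def wOf (x : ℂ) : ℂ := Complex.cosh (x / 2)

/-- `U_{n,m}^{(k)}(z,w;a,b)` as a function of `x`. -/
noncomputable def Ux (n m k : ℕ) (a b : ℂ) (x : ℂ) : ℂ := U n m k a b (zOf x) (wOf x)

/-- The second Hirota derivative `D_x^2 f ∘ g = f'' g - 2 f' g' + f g''`. -/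
noncomputable def hirota (f g : ℂ → ℂ) (x : ℂ) : ℂ :=
  deriv (deriv f) x * g x - 2 * deriv f x * deriv g x + f x * deriv (deriv g) x

/-- The unwanted term `(4/(n+2m+1)^2) a b (a-b) z^2 w^2 (U_{n,m}^{(1)})^2`. -/
noncomputable def unwantedTerm (n m : ℕ) (a b : ℂ) (x : ℂ) : ℂ :=
  4 / ((n : ℂ) + 2 * m + 1) ^ 2 * (a * b * (a - b)) * zOf x ^ 2 * wOf x ^ 2 *
    Ux n m 1 a b x ^ 2

/-! ### The sixth Painlevé equation -/

open Filter

/-- `q` is a meromorphic solution on `Ω` of the sixth Painlevé equation with parameters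
`α, β, γ, δ`; the equation is required off a closed discrete subset of `Ω`, and `q` is not
identically `0`, `1` or `t` near any point of `Ω`. -/
def IsPVISolution (α β γ δ : ℂ) (Ω : Set ℂ) (q : ℂ → ℂ) : Prop :=
  MeromorphicOn q Ω ∧
  ∀ᶠ t in codiscreteWithin Ω,
    q t ≠ 0 ∧ q t ≠ 1 ∧ q t ≠ t ∧
    deriv (deriv q) t =
      1 / 2 * (1 / q t + 1 / (q t - 1) + 1 / (q t - t)) * deriv q t ^ 2
      - (1 / t + 1 / (t - 1) + 1 / (q t - t)) * deriv q t
      + q t * (q t - 1) * (q t - t) / (t ^ 2 * (t - 1) ^ 2) *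
        (α + β * (t / q t ^ 2) + γ * ((t - 1) / (q t - 1) ^ 2)
          + δ * (t * (t - 1) / (q t - t) ^ 2))

/-- The Hamiltonian `H_VI(b; t, q, p)`; the parameters `b_1, …, b_4` are `b 0, …, b 3`. -/
noncomputable def HVI (b : Fin 4 → ℂ) (t q p : ℂ) : ℂ :=
  1 / (t * (t - 1)) *
    (q * (q - 1) * (q - t) * p ^ 2
      - ((b 0 + b 1) * (q - 1) * (q - t) + (b 0 - b 1) * q * (q - t)
          + (b 2 + b 3) * q * (q - 1)) * p
      + (b 0 + b 2) * (b 0 + b 3) * (q - t))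

/-- `(q, p)` is a meromorphic solution on `Ω` of the Hamiltonian system
`dq/dt = ∂H/∂p`, `dp/dt = -∂H/∂q`. -/
def IsHamiltonianSolution (b : Fin 4 → ℂ) (Ω : Set ℂ) (q p : ℂ → ℂ) : Prop :=
  MeromorphicOn q Ω ∧ MeromorphicOn p Ω ∧
  ∀ᶠ t in codiscreteWithin Ω,
    HasDerivAt q (deriv (fun y => HVI b t (q t) y) (p t)) t ∧
    HasDerivAt p (-deriv (fun y => HVI b t y (p t)) (q t)) t

/-- `τ` is a `τ`-function of `(q, p)` on `Ω`: `d/dt log τ = H_VI(b; t, q(t), p(t))`. -/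
def IsTauFunction (b : Fin 4 → ℂ) (Ω : Set ℂ) (q p τ : ℂ → ℂ) : Prop :=
  DifferentiableOn ℂ τ Ω ∧
  ∀ᶠ t in codiscreteWithin Ω, τ t ≠ 0 ∧ logDeriv τ t = HVI b t (q t) (p t)

/-- `e_2(b_1, b_3, b_4)`. -/
noncomputable def e2three (b : Fin 4 → ℂ) : ℂ := b 0 * b 2 + b 0 * b 3 + b 2 * b 3

/-- `e_2(b_1, b_2, b_3, b_4)`. -/
noncomputable def e2four (b : Fin 4 → ℂ) : ℂ :=
  b 0 * b 1 + b 0 * b 2 + b 0 * b 3 + b 1 * b 2 + b 1 * b 3 + b 2 * b 3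

/-- The function `h` satisfies the Painlevé–Okamoto equation `E_VI(b)` at `t`. -/
def SatisfiesEVI (b : Fin 4 → ℂ) (h : ℂ → ℂ) (t : ℂ) : Prop :=
  deriv h t * (t * (t - 1) * deriv (deriv h) t) ^ 2
    + (deriv h t * (2 * h t - (2 * t - 1) * deriv h t) + b 0 * b 1 * b 2 * b 3) ^ 2
  = ∏ k, (deriv h t + b k ^ 2)

/-- The function `h_0 = (b_1^2 z/w + b_2^2 w/z)/4` of `t`, for a branch `x` of the change of
variables. -/
noncomputable def h0 (b₁ b₂ : ℂ) (x : ℂ → ℂ) (t : ℂ) : ℂ :=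
  (b₁ ^ 2 * (zOf (x t) / wOf (x t)) + b₂ ^ 2 * (wOf (x t) / zOf (x t))) / 4

/-- The auxiliary Hamiltonian `t (t-1) (log u)' - h₀` attached to a function `u` of `t`. -/
noncomputable def auxHam (u h₀ : ℂ → ℂ) (t : ℂ) : ℂ := t * (t - 1) * logDeriv u t - h₀ t

/-- The number `κ` with `κ = n` for even `n` and `κ = n + 2m + 1` for odd `n`. -/
def kappa (n m : ℕ) : ℕ := if Even n then n else n + 2 * m + 1

end Umemura

namespace Umemura

open Finset Matrix

/-! ### Condensation of determinants -/

/-! For `b = 0`, `U_{n,m}` is up to a constant a determinant with rows `a_i z^i i^j ± b_i w^i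
(-i)^j`, `i ∈ [n;m]`: splitting every row into its two terms gives Vandermonde determinants at
signed nodes, and these produce the coefficients `d_{n,m}(I)` (`Ux_mul_det_vandermonde`).
Differentiation in `x` produces the minor with a gap in the exponents. Replacing the last row by the
row of index larger by 2 is a first order differential operator as well: a sum over all shifts of
one node by `±2` is a sum of residues, and all but one of the shifted determinants vanish
(`borderedMinor_rowEntry_succ`). That `b_i = 0` for odd `i` keeps the node `-1`, a pole of the
weight, out of the sum. The Desnanot–Jacobi identity thereby becomes a Toda equation
(`rowDet_toda`), and normalising its constants gives the recurrence (`Ux_recurrence`).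

For Painlevé VI, `[n;m]` is read as `{1, 3, …, 2o-1} ∪ {2, 4, …, 2e}`. For both parities of `n` this
lies in a chain with fixed `o` and growing `e`, whose seed is a constant times `z^(o²)`. In the
variable `t` the Toda equation links consecutive auxiliary Hamiltonians. With `R` the difference of
two neighbours, the relations `BacklundPair` hold for the seed and propagate (`BacklundPair.step`);
they imply `E_VI` with `b_2 = 0`, divided by `h'` (`BacklundPair.okamoto`). If `h''` vanished
identically, the same relations would carry this down to the seed, where it means `b₁² = o²`, that
is `a = -κ²`.

Finally `q` and `X = q (q - 1) p` are the solution of a linear system with determinant `(h' +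
b_3²)(h' + b_4²)` and coefficients built from `h, h', h''`. In these coordinates `E_VI` is a
quadric, and differentiating the linear and the quadratic relation gives the Hamiltonian system
wherever `h'' ≠ 0` (`okamoto_hamiltonian`). -/

lemma det_fromBlocks_two_of_isUnit {M : ℕ} (A : Matrix (Fin M) (Fin M) ℂ)
    (B : Matrix (Fin M) (Fin 2) ℂ) (C : Matrix (Fin 2) (Fin M) ℂ) (D : Matrix (Fin 2) (Fin 2) ℂ)
    (hA : A.det ≠ 0) :
    A.det * (fromBlocks A B C D).det =
      (fromBlocks A (B.submatrix id fun _ : Fin 1 => 0) (C.submatrix (fun _ : Fin 1 => 0) id)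
        (D.submatrix (fun _ => 0) fun _ => 0)).det *
      (fromBlocks A (B.submatrix id fun _ : Fin 1 => 1) (C.submatrix (fun _ : Fin 1 => 1) id)
        (D.submatrix (fun _ => 1) fun _ => 1)).det -
      (fromBlocks A (B.submatrix id fun _ : Fin 1 => 0) (C.submatrix (fun _ : Fin 1 => 1) id)
        (D.submatrix (fun _ => 1) fun _ => 0)).det *
      (fromBlocks A (B.submatrix id fun _ : Fin 1 => 1) (C.submatrix (fun _ : Fin 1 => 0) id)
        (D.submatrix (fun _ => 0) fun _ => 1)).det := by
  have : Invertible A := A.invertibleOfIsUnitDet (isUnit_iff_ne_zero.mpr hA)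
  -- Each singly bordered determinant is `A.det` times an entry of the 2×2 Schur complement, and the
  -- full block determinant is `A.det` times the determinant of that complement.
  have key : ∀ p c : Fin 2, (fromBlocks A (B.submatrix id fun _ : Fin 1 => c)
      (C.submatrix (fun _ : Fin 1 => p) id) (D.submatrix (fun _ => p) fun _ => c)).det =
      A.det * (D - C * ⅟A * B) p c := by
    intro p c
    rw [det_fromBlocks₁₁, det_fin_one]
    simp [Matrix.mul_apply, Matrix.submatrix_apply]
  rw [key, key, key, key, det_fromBlocks₁₁, det_fin_two]
  ring

/-- Both sides are continuous in `ε` when `A` is replaced by `A + ε`, and `A + ε` is singular only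
at the finitely many roots of the characteristic polynomial of `-A`; the invertible case passes to
the limit `ε → 0`. -/
lemma det_fromBlocks_two {M : ℕ} (A : Matrix (Fin M) (Fin M) ℂ)
    (B : Matrix (Fin M) (Fin 2) ℂ) (C : Matrix (Fin 2) (Fin M) ℂ) (D : Matrix (Fin 2) (Fin 2) ℂ) :
    A.det * (fromBlocks A B C D).det =
      (fromBlocks A (B.submatrix id fun _ : Fin 1 => 0) (C.submatrix (fun _ : Fin 1 => 0) id)
        (D.submatrix (fun _ => 0) fun _ => 0)).det *
      (fromBlocks A (B.submatrix id fun _ : Fin 1 => 1) (C.submatrix (fun _ : Fin 1 => 1) id)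
        (D.submatrix (fun _ => 1) fun _ => 1)).det -
      (fromBlocks A (B.submatrix id fun _ : Fin 1 => 0) (C.submatrix (fun _ : Fin 1 => 1) id)
        (D.submatrix (fun _ => 1) fun _ => 0)).det *
      (fromBlocks A (B.submatrix id fun _ : Fin 1 => 1) (C.submatrix (fun _ : Fin 1 => 0) id)
        (D.submatrix (fun _ => 0) fun _ => 1)).det := by
  set A' : ℂ → Matrix (Fin M) (Fin M) ℂ := fun ε => A + ε • (1 : Matrix (Fin M) (Fin M) ℂ) with hA'
  have hc : Continuous A' := by fun_prop
  have hA0 : A' 0 = A := by simp [hA']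
  have hne : ∀ᶠ ε in nhdsWithin (0 : ℂ) {0}ᶜ, (A' ε).det ≠ 0 := by
    have h1 : ∀ ε, (A' ε).det = (-A).charpoly.eval ε := by
      intro ε
      rw [Matrix.eval_charpoly, hA']
      congr 1
      ext i j
      simp [Matrix.scalar_apply, Matrix.one_apply, Matrix.diagonal_apply, add_comm]
    have h2 : (-A).charpoly ≠ 0 := (Matrix.charpoly_monic _).ne_zero
    have h3 : Set.Finite {ε | (-A).charpoly.eval ε = 0} := by
      refine ((-A).charpoly.roots.toFinset.finite_toSet).subset ?_
      intro ε hε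
      simpa [h2] using hε
    have h4 := h3.subset (Set.sdiff_subset (t := {0}))
    have h5 : ({ε | (-A).charpoly.eval ε = 0} \ {0})ᶜ ∈ nhds (0 : ℂ) :=
      h4.isClosed.isOpen_compl.mem_nhds (by simp)
    filter_upwards [mem_nhdsWithin_of_mem_nhds h5, self_mem_nhdsWithin] with ε he he0
    rw [h1]
    intro h
    exact he ⟨h, he0⟩
  have hcB : ∀ {l : ℕ} (B : Matrix (Fin M) (Fin l) ℂ) (C : Matrix (Fin l) (Fin M) ℂ)
      (D : Matrix (Fin l) (Fin l) ℂ), Continuous fun ε => (fromBlocks (A' ε) B C D).det := by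
    intro l B C D
    exact (hc.matrix_fromBlocks continuous_const continuous_const continuous_const).matrix_det
  have hl := (hc.matrix_det.mul (hcB B C D)).tendsto 0
  have hr := (((hcB (B.submatrix id fun _ : Fin 1 => 0) (C.submatrix (fun _ : Fin 1 => 0) id)
        (D.submatrix (fun _ => 0) fun _ => 0)).mul
      (hcB (B.submatrix id fun _ : Fin 1 => 1) (C.submatrix (fun _ : Fin 1 => 1) id)
        (D.submatrix (fun _ => 1) fun _ => 1))).sub
      ((hcB (B.submatrix id fun _ : Fin 1 => 0) (C.submatrix (fun _ : Fin 1 => 1) id)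
        (D.submatrix (fun _ => 1) fun _ => 0)).mul
      (hcB (B.submatrix id fun _ : Fin 1 => 1) (C.submatrix (fun _ : Fin 1 => 0) id)
        (D.submatrix (fun _ => 0) fun _ => 1)))).tendsto 0
  have := tendsto_nhds_unique_of_eventuallyEq (hl.mono_left nhdsWithin_le_nhds)
    (hr.mono_left (nhdsWithin_le_nhds (s := {0}ᶜ))) (by
      filter_upwards [hne] with ε hε
      exact det_fromBlocks_two_of_isUnit (A' ε) B C D hε)
  simpa only [Pi.mul_apply, Pi.sub_apply, hA0] using this

/-- The determinant on rows `0, …, M-1, p` and columns `0, …, M-1, c` of an infinite matrix. -/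
noncomputable def borderedMinor (M : ℕ) (r : ℕ → ℕ → ℂ) (p c : ℕ) : ℂ :=
  (of fun i j : Fin (M + 1) => r (if (i : ℕ) < M then i else p) (if (j : ℕ) < M then j else c)).det

lemma borderedMinor_eq_det_fromBlocks (M : ℕ) (r : ℕ → ℕ → ℂ) (p c : ℕ) :
    borderedMinor M r p c = (fromBlocks (of fun i j : Fin M => r i j)
      (of fun (i : Fin M) (_ : Fin 1) => r i c) (of fun (_ : Fin 1) (j : Fin M) => r p j)
      (of fun _ _ => r p c)).det := by
  rw [borderedMinor, ← det_reindex_self (finSumFinEquiv (m := M) (n := 1)).symm]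
  congr 1
  ext i j
  rcases i with i | i <;> rcases j with j | j <;> simp

/-- The Desnanot–Jacobi identity for nested leading minors; it gives the Toda equation its bilinear
form. -/
lemma det_mul_det_add_two (M : ℕ) (r : ℕ → ℕ → ℂ) :
    (of fun i j : Fin M => r i j).det * (of fun i j : Fin (M + 2) => r i j).det =
      borderedMinor M r M M * borderedMinor M r (M + 1) (M + 1) -
        borderedMinor M r (M + 1) M * borderedMinor M r M (M + 1) := by
  have h := det_fromBlocks_two (of fun i j : Fin M => r i j)
    (of fun (i : Fin M) (c : Fin 2) => r i (M + c)) (of fun (p : Fin 2) (j : Fin M) => r (M + p) j)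
    (of fun (p c : Fin 2) => r (M + p) (M + c))
  have h2 : (of fun i j : Fin (M + 2) => r i j).det = (fromBlocks (of fun i j : Fin M => r i j)
    (of fun (i : Fin M) (c : Fin 2) => r i (M + c)) (of fun (p : Fin 2) (j : Fin M) => r (M + p) j)
    (of fun (p c : Fin 2) => r (M + p) (M + c))).det := by
    rw [← det_reindex_self (finSumFinEquiv (m := M) (n := 2)).symm]
    congr 1
    ext i j
    rcases i with i | i <;> rcases j with j | j <;> simp
  simp only [borderedMinor_eq_det_fromBlocks, h2]
  exact h

/-! ### Two-sided alternants -/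

/-- The nodes `± v k`, with the sign `+` for `k ∈ J`. -/
def signedNode {N : ℕ} (v : Fin N → ℂ) (J : Finset (Fin N)) (k : Fin N) : ℂ :=
  if k ∈ J then v k else -v k

/-- The determinant with rows `X_k v_k^j + Y_k (-v_k)^j`. -/
noncomputable def alternant {N : ℕ} (v X Y : Fin N → ℂ) : ℂ :=
  (of fun k j : Fin N => X k * v k ^ (j : ℕ) + Y k * (-v k) ^ (j : ℕ)).det

/-- The exponents `0, …, N-1, N+1`. -/
def gapExponent (N : ℕ) (j : Fin (N + 1)) : ℕ := if (j : ℕ) < N then j else N + 1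

/-- The variant of `alternant` with exponents `0, …, N-1, N+1`. -/
noncomputable def alternantGap {N : ℕ} (v X Y : Fin (N + 1) → ℂ) : ℂ :=
  (of fun k j : Fin (N + 1) => X k * v k ^ gapExponent N j + Y k * (-v k) ^ gapExponent N j).det

/-- The monomial `∏_{k ∈ J} X_k ∏_{k ∉ J} Y_k`. -/
def signedProd {N : ℕ} (X Y : Fin N → ℂ) (J : Finset (Fin N)) : ℂ :=
  ∏ k, if k ∈ J then X k else Y k

/-- Multilinearity in the rows: `J` records the rows that choose the node `v k` rather than `-v k`.
-/
lemma det_two_sided_eq_sum {N : ℕ} (v X Y : Fin N → ℂ) (E : Fin N → ℕ) :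
    (of fun k j : Fin N => X k * v k ^ E j + Y k * (-v k) ^ E j).det =
      ∑ J, signedProd X Y J * (of fun k j : Fin N => signedNode v J k ^ E j).det := by
  have h := (detRowAlternating (n := Fin N) (R := ℂ)).toMultilinearMap.map_add_univ
    (fun k j => X k * v k ^ E j) (fun k j => Y k * (-v k) ^ E j)
  refine h.trans (Finset.sum_congr rfl fun J _ => ?_)
  rw [signedProd, ← det_mul_column]
  change det _ = _
  congr 1
  ext k j
  by_cases hk : k ∈ J <;> simp [hk, signedNode, Finset.piecewise]

lemma alternant_eq_sum {N : ℕ} (v X Y : Fin N → ℂ) :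
    alternant v X Y = ∑ J, signedProd X Y J * (vandermonde (signedNode v J)).det :=
  det_two_sided_eq_sum v X Y fun j => j

/-- Every `κ k` is a root of `∏ (X - κ i)`, so `κ k ^ (N + 1)` is a fixed combination of lower
powers; in the determinant only the coefficient of `κ k ^ N` survives, and it is `∑ κ k`. -/
lemma det_vandermonde_gap {N : ℕ} (κ : Fin (N + 1) → ℂ) :
    (of fun k j : Fin (N + 1) => κ k ^ gapExponent N j).det = (∑ k, κ k) * (vandermonde κ).det := by
  have hp : ∀ k, κ k ^ (N + 1) = ∑ i : Fin (N + 1),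
      (-(∏ i, (Polynomial.X - Polynomial.C (κ i))).coeff i) • vandermonde κ k i := by
    intro k
    set p := ∏ i, (Polynomial.X - Polynomial.C (κ i)) with hp
    have hm : p.Monic := Polynomial.monic_prod_of_monic _ _ fun i _ => Polynomial.monic_X_sub_C _
    have hd : p.natDegree = N + 1 := by
      rw [hp, Polynomial.natDegree_prod_of_monic _ _ fun i _ => Polynomial.monic_X_sub_C _]
      simp
    have h0 : p.eval (κ k) = 0 := by
      rw [hp, Polynomial.eval_prod]
      exact Finset.prod_eq_zero (Finset.mem_univ k) (by simp)
    rw [Polynomial.eval_eq_sum_range, hd, Finset.sum_range_succ] at h0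
    have h1 : p.coeff (N + 1) = 1 := by rw [← hd]; exact hm
    rw [h1, one_mul, Finset.sum_range] at h0
    simp only [smul_eq_mul, neg_mul, Finset.sum_neg_distrib, vandermonde_apply]
    linear_combination h0
  have h := det_updateCol_sum (vandermonde κ) (Fin.last N)
    fun i => -(∏ i, (Polynomial.X - Polynomial.C (κ i))).coeff i
  have hc := Polynomial.prod_X_sub_C_coeff_card_pred (Finset.univ : Finset (Fin (N + 1))) κ
    (by simp)
  simp only [Finset.card_univ, Fintype.card_fin, Nat.add_sub_cancel] at hc
  simp only [Fin.val_last, hc, neg_neg, smul_eq_mul] at h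
  simp only [smul_eq_mul] at hp
  rw [← h]
  congr 1
  ext k j
  rw [updateCol_apply, of_apply]
  split_ifs with hj
  · subst hj
    rw [← hp]
    simp [gapExponent]
  · have : (j : ℕ) < N := lt_of_le_of_ne (Nat.lt_succ_iff.mp j.2) fun hh => hj (Fin.ext hh)
    simp [gapExponent, this]

lemma alternantGap_eq_sum {N : ℕ} (v X Y : Fin (N + 1) → ℂ) :
    alternantGap v X Y = ∑ J, signedProd X Y J *
      ((∑ k, signedNode v J k) * (vandermonde (signedNode v J)).det) := by
  rw [alternantGap, det_two_sided_eq_sum]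
  simp only [det_vandermonde_gap]

end Umemura

namespace Umemura

open Finset Matrix

/-! ### Partial fractions of `∏ (1 + ε / (x - κ j))` -/

section PartialFractions

variable {ι : Type*} [DecidableEq ι]

/-- The residue of `∏_{j ∈ s} (1 + ε / (x - κ j))` at `κ k`. -/
noncomputable def shiftResidue (ε : ℂ) (κ : ι → ℂ) (s : Finset ι) (k : ι) : ℂ :=
  ε * ∏ j ∈ s.erase k, (1 + ε / (κ k - κ j))

/-- The hypothesis `h` is the partial fraction identity at the single point `κ ν`. It is kept as a
hypothesis so that this formula can serve in the induction proving that very identity. -/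
lemma sum_shiftResidue_insert_of_eq (ε : ℂ) (κ : ι → ℂ) (s : Finset ι) (ν : ι) (hν : ν ∉ s)
    (hs : ∀ k ∈ s, κ k ≠ κ ν)
    (h : 1 + ∑ k ∈ s, shiftResidue ε κ s k / (κ ν - κ k) = ∏ j ∈ s, (1 + ε / (κ ν - κ j)))
    (F : ι → ℂ) :
    ∑ k ∈ insert ν s, shiftResidue ε κ (insert ν s) k * F k =
      ∑ k ∈ s, shiftResidue ε κ s k * F k + ε * F ν +
        ε * ∑ k ∈ s, shiftResidue ε κ s k * ((F k - F ν) / (κ k - κ ν)) := by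
  rw [Finset.sum_insert hν]
  have h1 : shiftResidue ε κ (insert ν s) ν =
      ε * (1 + ∑ k ∈ s, shiftResidue ε κ s k / (κ ν - κ k)) := by
    rw [h, shiftResidue, Finset.erase_insert hν]
  have h2 : ∀ k ∈ s, shiftResidue ε κ (insert ν s) k =
      shiftResidue ε κ s k * (1 + ε / (κ k - κ ν)) := by
    intro k hk
    have hne : k ≠ ν := fun hh => hν (hh ▸ hk)
    rw [shiftResidue, shiftResidue, Finset.erase_insert_of_ne hne.symm,
      Finset.prod_insert (fun hh => hν (Finset.mem_of_mem_erase hh))]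
    ring
  have h5 : ∀ k ∈ s, shiftResidue ε κ (insert ν s) k * F k = shiftResidue ε κ s k * F k +
      ε * (shiftResidue ε κ s k * ((F k - F ν) / (κ k - κ ν))) -
        ε * F ν * (shiftResidue ε κ s k / (κ ν - κ k)) := by
    intro k hk
    have h3 : κ k - κ ν ≠ 0 := sub_ne_zero.mpr (hs k hk)
    rw [h2 k hk, ← neg_sub (κ k) (κ ν)]
    field_simp
    ring
  rw [h1, Finset.sum_congr rfl h5, Finset.sum_sub_distrib, Finset.sum_add_distrib,
    ← Finset.mul_sum, ← Finset.mul_sum]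
  ring

lemma one_add_sum_shiftResidue_div (ε : ℂ) (κ : ι → ℂ) (s : Finset ι) :
    Set.InjOn κ s → ∀ x, (∀ k ∈ s, x ≠ κ k) →
    1 + ∑ k ∈ s, shiftResidue ε κ s k / (x - κ k) = ∏ j ∈ s, (1 + ε / (x - κ j)) := by
  induction s using Finset.induction_on with
  | empty => simp
  | insert ν s hν ih =>
    intro hinj x hx
    have hinj' : Set.InjOn κ s := hinj.mono (by simp)
    have hne : ∀ k ∈ s, κ k ≠ κ ν := fun k hk hh =>
      hν ((hinj (by simp [hk]) (by simp) hh) ▸ hk)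
    have h := sum_shiftResidue_insert_of_eq ε κ s ν hν hne
      (ih hinj' _ fun k hk => (hne k hk).symm) fun k => 1 / (x - κ k)
    simp only [mul_one_div] at h
    rw [h, Finset.prod_insert hν, ← ih hinj' x fun k hk => hx k (by simp [hk])]
    have hxν : x - κ ν ≠ 0 := sub_ne_zero.mpr (hx ν (by simp))
    have : ∀ k ∈ s, shiftResidue ε κ s k * ((1 / (x - κ k) - 1 / (x - κ ν)) / (κ k - κ ν)) =
        shiftResidue ε κ s k / (x - κ k) * (1 / (x - κ ν)) := by
      intro k hk
      have h1 : x - κ k ≠ 0 := sub_ne_zero.mpr (hx k (by simp [hk]))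
      have h2 : κ k - κ ν ≠ 0 := sub_ne_zero.mpr (hne k hk)
      field_simp
      ring
    rw [Finset.sum_congr rfl this, ← Finset.sum_mul]
    ring

lemma sum_shiftResidue_insert (ε : ℂ) (κ : ι → ℂ) (s : Finset ι) (ν : ι) (hν : ν ∉ s)
    (hinj : Set.InjOn κ (insert ν s : Finset ι)) (F : ι → ℂ) :
    ∑ k ∈ insert ν s, shiftResidue ε κ (insert ν s) k * F k =
      ∑ k ∈ s, shiftResidue ε κ s k * F k + ε * F ν +
        ε * ∑ k ∈ s, shiftResidue ε κ s k * ((F k - F ν) / (κ k - κ ν)) := by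
  have hne : ∀ k ∈ s, κ k ≠ κ ν := fun k hk hh =>
    hν ((hinj (by simp [hk]) (by simp) hh) ▸ hk)
  exact sum_shiftResidue_insert_of_eq ε κ s ν hν hne
    (one_add_sum_shiftResidue_div ε κ s (hinj.mono (by simp)) _ fun k hk => (hne k hk).symm) F

/-- These are the coefficients of `x⁻¹, x⁻², x⁻³` of `∏ (1 + ε / (x - κ j))` at infinity. In the
induction the divided differences of `1, κ, κ²` are `0, 1, κ k + κ ν`. -/
lemma sum_shiftResidue_moments (ε : ℂ) (κ : ι → ℂ) (s : Finset ι) : Set.InjOn κ s →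
    ∑ k ∈ s, shiftResidue ε κ s k = ε * #s ∧
    ∑ k ∈ s, shiftResidue ε κ s k * κ k = ε * ∑ k ∈ s, κ k + ε ^ 2 * (#s * (#s - 1) / 2) ∧
    ∑ k ∈ s, shiftResidue ε κ s k * κ k ^ 2 = ε * ∑ k ∈ s, κ k ^ 2 +
      ε ^ 2 * (#s - 1) * ∑ k ∈ s, κ k + ε ^ 3 * (#s * (#s - 1) * (#s - 2) / 6) := by
  induction s using Finset.induction_on with
  | empty => simp
  | insert ν s hν ih =>
    intro hinj
    have hne : ∀ k ∈ s, κ k - κ ν ≠ 0 := fun k hk hh =>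
      hν ((hinj (by simp [hk]) (by simp) (sub_eq_zero.mp hh)) ▸ hk)
    obtain ⟨h0, h1, h2⟩ := ih (hinj.mono (by simp))
    have e0 := sum_shiftResidue_insert ε κ s ν hν hinj fun _ => 1
    have e1 := sum_shiftResidue_insert ε κ s ν hν hinj κ
    have e2 := sum_shiftResidue_insert ε κ s ν hν hinj fun k => κ k ^ 2
    simp only [mul_one, sub_self, zero_div, mul_zero, Finset.sum_const_zero, add_zero] at e0
    have h4 : ∀ k ∈ s, shiftResidue ε κ s k * ((κ k - κ ν) / (κ k - κ ν)) =
        shiftResidue ε κ s k := fun k hk => by rw [div_self (hne k hk), mul_one]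
    rw [Finset.sum_congr rfl h4] at e1
    have h3 : ∀ k ∈ s, shiftResidue ε κ s k * ((κ k ^ 2 - κ ν ^ 2) / (κ k - κ ν)) =
        shiftResidue ε κ s k * κ k + shiftResidue ε κ s k * κ ν := by
      intro k hk
      have := hne k hk
      field_simp
      ring
    rw [Finset.sum_congr rfl h3, Finset.sum_add_distrib, ← Finset.sum_mul] at e2
    rw [e0, e1, e2, Finset.card_insert_of_notMem hν, Finset.sum_insert hν, Finset.sum_insert hν,
      h0, h1, h2]
    push_cast
    refine ⟨by ring, by ring, by ring⟩

end PartialFractions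

/-- Each difference `κ k - κ j` acquires the factor `1 + ε / (κ k - κ j)`. Sums over nodes of
shifted Vandermonde determinants thus become sums of residues. -/
lemma det_vandermonde_update {N : ℕ} (κ : Fin N → ℂ) (hκ : Function.Injective κ) (k : Fin N)
    (ε : ℂ) :
    ε * (vandermonde (Function.update κ k (κ k + ε))).det =
      shiftResidue ε κ univ k * (vandermonde κ).det := by
  set f : Fin N → Fin N → ℂ := fun a b => if a = k then 1 + ε / (κ k - κ b) else 1 with hf
  have h1 : ∀ i j : Fin N, i < j →
      Function.update κ k (κ k + ε) j - Function.update κ k (κ k + ε) i =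
        (f j i * f i j) * (κ j - κ i) := by
    intro i j hij
    have hne : κ j - κ i ≠ 0 := sub_ne_zero.mpr fun h => hij.ne (hκ h).symm
    have hne' : κ i - κ j ≠ 0 := sub_ne_zero.mpr fun h => hij.ne (hκ h)
    by_cases hi : i = k
    · subst hi
      simp only [hf, hij.ne', Function.update_self, Function.update_of_ne, ne_eq,
        not_false_eq_true, if_true, if_false, one_mul]
      field_simp
      ring
    · by_cases hj : j = k
      · subst hj
        simp only [hf, hij.ne, Function.update_self, Function.update_of_ne, ne_eq,
          not_false_eq_true, if_true, if_false, mul_one]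
        field_simp
        ring
      · simp [hf, hi, hj]
  rw [det_vandermonde, det_vandermonde, shiftResidue,
    Finset.prod_congr rfl fun i _ => Finset.prod_congr rfl fun j hj => h1 i j (by simpa using hj)]
  rw [Finset.prod_congr rfl fun i _ => Finset.prod_mul_distrib, Finset.prod_mul_distrib,
    Finset.prod_prod_Ioi_mul_eq_prod_prod_off_diag]
  have h2 : ∏ i, ∏ j ∈ ({i}ᶜ : Finset (Fin N)), f j i =
      ∏ j ∈ univ.erase k, (1 + ε / (κ k - κ j)) := by
    rw [← Finset.mul_prod_erase univ _ (Finset.mem_univ k)]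
    have h3 : ∏ j ∈ ({k}ᶜ : Finset (Fin N)), f j k = 1 :=
      Finset.prod_eq_one fun j hj => by simp only [hf]; rw [if_neg (by simpa using hj)]
    rw [h3, one_mul]
    refine Finset.prod_congr rfl fun i hi => ?_
    rw [Finset.prod_eq_single k]
    · simp [hf]
    · intro j _ hjk
      simp [hf, hjk]
    · intro h
      exact absurd (by simpa using (Finset.ne_of_mem_erase hi).symm) h
  rw [h2]
  ring

/-! ### Shifting one node of an alternant -/

lemma signedNode_update {N : ℕ} (v : Fin N → ℂ) (J : Finset (Fin N)) (k : Fin N) (y : ℂ) :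
    signedNode (Function.update v k y) J =
      Function.update (signedNode v J) k (if k ∈ J then y else -y) := by
  ext i
  by_cases hi : i = k
  · subst hi; simp [signedNode]
  · simp [signedNode, hi]

lemma signedProd_update {N : ℕ} (X Y : Fin N → ℂ) (J : Finset (Fin N)) (k : Fin N) (c d : ℂ) :
    signedProd (Function.update X k (c * X k)) (Function.update Y k (d * Y k)) J =
      (if k ∈ J then c else d) * signedProd X Y J := by
  rw [signedProd, signedProd, ← Finset.mul_prod_erase univ _ (Finset.mem_univ k),
    ← Finset.mul_prod_erase univ _ (Finset.mem_univ k), ← mul_assoc]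
  congr 1
  · by_cases hk : k ∈ J <;> simp [hk]
  · refine Finset.prod_congr rfl fun i hi => ?_
    simp [Finset.ne_of_mem_erase hi]

/-- For `k ∉ J` the signed node is `-v k`, which moves by `-2` when `v k` moves by `+2`. The weights
are placed so that in both cases `P` goes with `κ + 2` and `Q` with `κ - 2`. -/
lemma alternant_shift_add_alternant_shift {N : ℕ} (v X Y : Fin N → ℂ) (P Q : ℂ → ℂ) (k : Fin N) :
    alternant (Function.update v k (v k + 2)) (Function.update X k (P (v k) * X k))
        (Function.update Y k (Q (-v k) * Y k)) +
      alternant (Function.update v k (v k - 2)) (Function.update X k (Q (v k) * X k))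
        (Function.update Y k (P (-v k) * Y k)) =
      ∑ J, signedProd X Y J *
        (P (signedNode v J k) * (vandermonde (Function.update (signedNode v J) k
            (signedNode v J k + 2))).det +
          Q (signedNode v J k) * (vandermonde (Function.update (signedNode v J) k
            (signedNode v J k + -2))).det) := by
  rw [alternant_eq_sum, alternant_eq_sum, ← Finset.sum_add_distrib]
  refine Finset.sum_congr rfl fun J _ => ?_
  rw [signedProd_update, signedProd_update, signedNode_update, signedNode_update]
  by_cases hk : k ∈ J
  · have : signedNode v J k = v k := by simp [signedNode, hk]
    simp only [hk, if_true, this, ← sub_eq_add_neg]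
    ring
  · have : signedNode v J k = -v k := by simp [signedNode, hk]
    simp only [hk, if_false, this, show -(v k + 2) = -v k + -2 by ring,
      show -(v k - 2) = -v k + 2 by ring]
    ring

lemma signedNode_sq {N : ℕ} (v : Fin N → ℂ) (J : Finset (Fin N)) (k : Fin N) :
    signedNode v J k ^ 2 = v k ^ 2 := by
  unfold signedNode
  split_ifs <;> ring

lemma signedNode_injective {N : ℕ} (v : Fin N → ℕ) (hv : Function.Injective v)
    (J : Finset (Fin N)) : Function.Injective (signedNode (fun k => (v k : ℂ)) J) := by
  intro i j h
  have h2 : ((v i : ℂ)) ^ 2 = (v j : ℂ) ^ 2 := by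
    rw [← signedNode_sq (fun k => (v k : ℂ)) J i, h, signedNode_sq]
  have h3 : v i ^ 2 = v j ^ 2 := by exact_mod_cast h2
  exact hv (Nat.pow_left_injective (n := 2) (by norm_num) h3)

/-- The sum over all rows of the shifted alternants, with the weight `1 - lam / (x + 1)`. -/
lemma sum_alternant_shift {N : ℕ} (v : Fin (N + 1) → ℕ) (hv : Function.Injective v)
    (X Y : Fin (N + 1) → ℂ) (hY : ∀ k, v k = 1 → Y k = 0) (a lam Z W : ℂ)
    (hlam : lam = 0 ∨ ∃ k, v k = 1) (P Q : ℂ → ℂ)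
    (hP : P = fun x => Z * ((a + (x + 1) ^ 2) * (1 - lam / (x + 1))))
    (hQ : Q = fun x => W * ((x - 1) ^ 2 + lam * (x - 1))) :
    ∑ k, (alternant (Function.update (fun i => (v i : ℂ)) k (v k + 2))
        (Function.update X k (P (v k) * X k)) (Function.update Y k (Q (-v k) * Y k)) +
      alternant (Function.update (fun i => (v i : ℂ)) k (v k - 2))
        (Function.update X k (Q (v k) * X k)) (Function.update Y k (P (-v k) * Y k))) =
    ((Z + W) * (∑ k, (v k : ℂ) ^ 2 + 2 / 3 * ((N + 1) * N * (N - 1)) + 2 * ((N + 1) * N) + (N + 1)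
        - lam * (N + 1) ^ 2) + a * Z * (N + 1 - lam / 2)) * alternant (fun i => (v i : ℂ)) X Y +
      (2 * (N + 1) - lam) * (Z - W) * alternantGap (fun i => (v i : ℂ)) X Y := by
  rw [Finset.sum_congr rfl fun k _ =>
    alternant_shift_add_alternant_shift (fun i => (v i : ℂ)) X Y P Q k, Finset.sum_comm,
    alternant_eq_sum, alternantGap_eq_sum, Finset.mul_sum, Finset.mul_sum, ← Finset.sum_add_distrib]
  refine Finset.sum_congr rfl fun J _ => ?_
  rw [← Finset.mul_sum]
  by_cases h0 : signedProd X Y J = 0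
  · simp [h0]
  have hinj := signedNode_injective v hv J
  set κ := signedNode (fun k => (v k : ℂ)) J with hκ
  -- In a nonzero term the node `1` must carry the sign `+`, since its `Y` vanishes; hence `-1` is
  -- never a node and the weight has no pole.
  have hYJ : ∀ k, v k = 1 → κ k = 1 := by
    intro k hk
    have : k ∈ J := by
      by_contra hkJ
      exact h0 (Finset.prod_eq_zero (Finset.mem_univ k) (by simp [hkJ, hY k hk]))
    simp [hκ, signedNode, this, hk]
  have hneg : ∀ k, κ k + 1 ≠ 0 := by
    intro k hk
    have h1 : κ k = -1 := by linear_combination hk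
    have h2 : ((v k : ℂ)) ^ 2 = 1 := by
      rw [← signedNode_sq (fun k => (v k : ℂ)) J k, ← hκ, h1]; ring
    have h3 : v k ^ 2 = 1 := by exact_mod_cast h2
    have h4 : v k = 1 := by nlinarith
    rw [hYJ k h4] at h1
    norm_num at h1
  have hup : ∀ k, (vandermonde (Function.update κ k (κ k + 2))).det =
      shiftResidue 2 κ univ k * (vandermonde κ).det / 2 := by
    intro k
    linear_combination (1 / 2 : ℂ) * det_vandermonde_update κ hinj k 2
  have hdn : ∀ k, (vandermonde (Function.update κ k (κ k + -2))).det =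
      -(shiftResidue (-2) κ univ k * (vandermonde κ).det / 2) := by
    intro k
    linear_combination (-1 / 2 : ℂ) * det_vandermonde_update κ hinj k (-2)
  obtain ⟨p0, p1, p2⟩ := sum_shiftResidue_moments 2 κ univ hinj.injOn
  obtain ⟨m0, m1, m2⟩ := sum_shiftResidue_moments (-2) κ univ hinj.injOn
  -- If `1` is a node, the product at `x = -1` contains `1 + 2 / (-1 - 1) = 0`, which evaluates the
  -- sum of residues over `κ + 1` to `1`.
  have hpole : lam * ∑ k, shiftResidue 2 κ univ k / (κ k + 1) = lam := by
    rcases hlam with hl | ⟨k, hk⟩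
    · simp [hl]
    · have h := one_add_sum_shiftResidue_div 2 κ univ hinj.injOn (-1) fun k _ hh =>
        hneg k (by rw [← hh]; ring)
      rw [Finset.prod_eq_zero (Finset.mem_univ k) (by rw [hYJ k hk]; norm_num)] at h
      have h2 : ∑ k, shiftResidue 2 κ univ k / (-1 - κ k) =
          -∑ k, shiftResidue 2 κ univ k / (κ k + 1) := by
        rw [← Finset.sum_neg_distrib]
        refine Finset.sum_congr rfl fun k _ => ?_
        rw [show (-1 - κ k) = -(κ k + 1) by ring, div_neg]
      rw [h2] at h
      linear_combination (-lam) * h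
  -- The weight `P` is split into a polynomial of degree two and the pole `-a lam / (κ + 1)`, so
  -- that only the three moments and `hpole` are needed.
  have hterm : ∀ k, P (κ k) * (vandermonde (Function.update κ k (κ k + 2))).det +
      Q (κ k) * (vandermonde (Function.update κ k (κ k + -2))).det =
      (vandermonde κ).det / 2 * (Z * ((a + 1 - lam) * shiftResidue 2 κ univ k +
          (2 - lam) * (shiftResidue 2 κ univ k * κ k) + shiftResidue 2 κ univ k * κ k ^ 2
          - a * (lam * (shiftResidue 2 κ univ k / (κ k + 1)))) -
        W * ((1 - lam) * shiftResidue (-2) κ univ k +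
          (lam - 2) * (shiftResidue (-2) κ univ k * κ k) +
          shiftResidue (-2) κ univ k * κ k ^ 2)) := by
    intro k
    rw [hup, hdn, hP, hQ]
    have := hneg k
    field_simp
    ring
  rw [Finset.sum_congr rfl fun k _ => hterm k, ← Finset.mul_sum, Finset.sum_sub_distrib,
    ← Finset.mul_sum, ← Finset.mul_sum, Finset.sum_sub_distrib, Finset.sum_add_distrib,
    Finset.sum_add_distrib, Finset.sum_add_distrib, Finset.sum_add_distrib, ← Finset.mul_sum,
    ← Finset.mul_sum, ← Finset.mul_sum, ← Finset.mul_sum, ← Finset.mul_sum, ← Finset.mul_sum,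
    hpole, p0, p1, p2, m0, m1, m2]
  have hsq : ∑ k, κ k ^ 2 = ∑ k, (v k : ℂ) ^ 2 :=
    Finset.sum_congr rfl fun k _ => signedNode_sq _ _ _
  rw [hsq]
  simp only [Finset.card_univ, Fintype.card_fin]
  push_cast
  ring

end Umemura

namespace Umemura

open Finset Matrix

/-! ### Determinants with rows `a_i z^i i^j ± b_i w^i (-i)^j` for `b = 0` -/

/-- The coefficient `a_i z^i`. -/
noncomputable def rowPos (a x : ℂ) (i : ℕ) : ℂ := aseq a i * zOf x ^ i

/-- The coefficient `(-1)^(i+1) b_i w^i` for `b = 0`. -/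
noncomputable def rowNeg (x : ℂ) (i : ℕ) : ℂ := (-1) ^ (i + 1) * aseq 0 i * wOf x ^ i

lemma aseq_zero (a : ℂ) : aseq a 0 = 1 := by simp [aseq]

lemma aseq_add_two (a : ℂ) (i : ℕ) : aseq a (i + 2) = (a + ((i : ℂ) + 1) ^ 2) * aseq a i := by
  have h : (Finset.Icc 1 (i + 2)).filter (fun j => j % 2 = (i + 2) % 2) =
      insert (i + 2) ((Finset.Icc 1 i).filter fun j => j % 2 = i % 2) := by
    ext j
    simp only [Finset.mem_filter, Finset.mem_Icc, Finset.mem_insert]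
    omega
  rw [aseq, h, Finset.prod_insert (by simp), aseq, abar]
  push_cast
  ring

lemma aseq_zero_of_odd (i : ℕ) (hi : i % 2 = 1) : aseq 0 i = 0 := by
  rw [aseq]
  refine Finset.prod_eq_zero (i := 1) ?_ (by simp [abar])
  simp only [Finset.mem_filter, Finset.mem_Icc]
  omega

lemma wOf_sq (x : ℂ) : wOf x ^ 2 = zOf x ^ 2 + 1 := by
  have := Complex.cosh_sq_sub_sinh_sq (x / 2)
  rw [wOf, zOf]
  linear_combination this

lemma rowPos_add_two (a x : ℂ) (i : ℕ) :
    rowPos a x (i + 2) = zOf x ^ 2 * (a + ((i : ℂ) + 1) ^ 2) * rowPos a x i := by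
  rw [rowPos, rowPos, aseq_add_two]; ring

lemma rowNeg_add_two (x : ℂ) (i : ℕ) :
    rowNeg x (i + 2) = wOf x ^ 2 * ((i : ℂ) + 1) ^ 2 * rowNeg x i := by
  rw [rowNeg, rowNeg, aseq_add_two]; ring

lemma rowNeg_of_odd (x : ℂ) (i : ℕ) (hi : i % 2 = 1) : rowNeg x i = 0 := by
  rw [rowNeg, aseq_zero_of_odd i hi]; ring

/-- The entries `a_i z^i i^j ± b_i w^i (-i)^j`, where `i = v k`. -/
noncomputable def rowEntry (a : ℂ) (v : ℕ → ℕ) (x : ℂ) (k j : ℕ) : ℂ :=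
  rowPos a x (v k) * (v k : ℂ) ^ j + rowNeg x (v k) * (-(v k : ℂ)) ^ j

/-- The determinant on the rows `v 0, …, v (N-1)`. -/
noncomputable def rowDet (a : ℂ) (v : ℕ → ℕ) (N : ℕ) (x : ℂ) : ℂ :=
  (of fun k j : Fin N => rowEntry a v x k j).det

lemma det_eq_zero_of_row_eq_smul {N : ℕ} (M : Matrix (Fin N) (Fin N) ℂ) (k l : Fin N) (hkl : l ≠ k)
    (c : ℂ) (h : ∀ j, M k j = c * M l j) : M.det = 0 := by
  have h1 : M = M.updateRow k (c • M l) := by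
    ext i j
    by_cases hi : i = k
    · subst hi; simp [h]
    · simp [hi]
  rw [h1, det_updateRow_smul, det_updateRow_eq_zero hkl, mul_zero]

/-- Replacing the last row `v N` by `v N + 2` amounts to a first order differential operator. -/
lemma borderedMinor_rowEntry_succ (a : ℂ) (v : ℕ → ℕ) (x : ℂ) (N : ℕ) (lam : ℂ)
    (hinj : ∀ k ≤ N, ∀ l ≤ N, v k = v l → k = l) (hpos : ∀ k ≤ N, 0 < v k)
    (hup : ∀ k < N, (v k : ℂ) + 1 = lam ∨ ∃ l ≤ N, v l = v k + 2)
    (hdn : ∀ k ≤ N, v k ≤ 2 ∨ ∃ l ≤ N, v l + 2 = v k)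
    (hlam : lam = 0 ∨ ∃ k ≤ N, v k = 1) (hlast : v (N + 1) = v N + 2) :
    (1 - lam / (v N + 1)) * borderedMinor N (rowEntry a v x) (N + 1) N =
      ((zOf x ^ 2 + wOf x ^ 2) * (∑ k ∈ range (N + 1), (v k : ℂ) ^ 2 +
          2 / 3 * ((N + 1) * N * (N - 1)) + 2 * ((N + 1) * N) + (N + 1)
          - lam * (N + 1) ^ 2) + a * zOf x ^ 2 * (N + 1 - lam / 2)) *
          borderedMinor N (rowEntry a v x) N N +
      (2 * (N + 1) - lam) * (zOf x ^ 2 - wOf x ^ 2) *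
        borderedMinor N (rowEntry a v x) N (N + 1) := by
  have hval : ∀ i : Fin (N + 1), (if (i : ℕ) < N then (i : ℕ) else N) = i := by
    intro i
    have := i.2
    split_ifs <;> omega
  have h := sum_alternant_shift (fun k : Fin (N + 1) => v k)
    (fun k l hkl => Fin.ext (hinj k (Nat.lt_succ_iff.mp k.2) l (Nat.lt_succ_iff.mp l.2) hkl))
    (fun k => rowPos a x (v k)) (fun k => rowNeg x (v k))
    (fun k hk => rowNeg_of_odd x _ (by rw [hk])) a lam (zOf x ^ 2) (wOf x ^ 2)
    (hlam.imp id fun ⟨k, hk, hk1⟩ => ⟨⟨k, Nat.lt_succ_of_le hk⟩, hk1⟩) _ _ rfl rfl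
  have hD : alternant (fun i : Fin (N + 1) => (v i : ℂ)) (fun k => rowPos a x (v k))
      (fun k => rowNeg x (v k)) = borderedMinor N (rowEntry a v x) N N := by
    simp only [alternant, borderedMinor, hval, rowEntry]
  have hG : alternantGap (fun i : Fin (N + 1) => (v i : ℂ)) (fun k => rowPos a x (v k))
      (fun k => rowNeg x (v k)) = borderedMinor N (rowEntry a v x) N (N + 1) := by
    simp only [alternantGap, borderedMinor, hval, rowEntry, gapExponent]
  -- Only the upward shift of the last row survives. Any other nonzero shifted row is proportional
  -- to a row already present.
  rw [hD, hG, Finset.sum_add_distrib, Finset.sum_eq_single (Fin.last N),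
    Finset.sum_eq_zero, add_zero] at h
  · rw [Finset.sum_range]
    rw [← h, alternant, borderedMinor]
    set M : Matrix (Fin (N + 1)) (Fin (N + 1)) ℂ := of fun i j : Fin (N + 1) =>
      rowEntry a v x (if (i : ℕ) < N then i else N + 1) (if (j : ℕ) < N then j else N) with hM
    have : M = M.updateRow (Fin.last N) (M (Fin.last N)) := by simp
    nth_rw 1 [this]
    rw [← det_updateRow_smul]
    congr 1
    ext i j
    have hv1 : (v N : ℂ) + 1 ≠ 0 := Nat.cast_add_one_ne_zero _
    by_cases hi : i = Fin.last N
    · subst hi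
      simp only [updateRow_self, Pi.smul_apply, smul_eq_mul, hM, of_apply, hval, Fin.val_last,
        lt_irrefl, if_false, Function.update_self, rowEntry, hlast, rowPos_add_two, rowNeg_add_two]
      push_cast
      field_simp
      ring
    · have hi' : (i : ℕ) < N :=
        lt_of_le_of_ne (Nat.lt_succ_iff.mp i.2) fun hh => hi (Fin.ext hh)
      simp [hi, hM, hi', hval, rowEntry]
  · intro k _
    have hkN : (k : ℕ) ≤ N := Nat.lt_succ_iff.mp k.2
    rcases Nat.lt_or_ge 2 (v k) with h3 | h3
    · obtain ⟨l, hl, hlk⟩ := (hdn k hkN).resolve_left (by omega)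
      have hk0 : ((v k : ℂ)) = v l + 2 := by rw [← hlk]; push_cast; ring
      have hlk' : (⟨l, Nat.lt_succ_of_le hl⟩ : Fin (N + 1)) ≠ k := by
        intro hh
        have : l = k := congrArg Fin.val hh
        rw [this] at hlk
        omega
      refine det_eq_zero_of_row_eq_smul _ k ⟨l, Nat.lt_succ_of_le hl⟩ hlk'
        (zOf x ^ 2 * wOf x ^ 2 * (a + ((v l : ℂ) + 1) ^ 2) *
          (((v l : ℂ) + 1) ^ 2 + lam * (v l + 1))) fun j => ?_
      have hne : ((v l : ℂ)) + 1 ≠ 0 := Nat.cast_add_one_ne_zero _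
      have hne2 : -((v l : ℂ) + 2) + 1 ≠ 0 := by
        intro hh
        apply hne
        linear_combination -hh
      simp only [of_apply, Function.update_self, Function.update_of_ne hlk']
      rw [← hlk, rowPos_add_two, rowNeg_add_two]
      push_cast
      rw [show (v l : ℂ) + 2 - 2 = v l by ring]
      have h1 : 1 - lam / (-((v l : ℂ) + 2) + 1) = 1 + lam / (v l + 1) := by
        rw [show -((v l : ℂ) + 2) + 1 = -(v l + 1) by ring, div_neg]; ring
      rw [h1]
      field_simp
      ring
    · refine det_eq_zero_of_row_eq_zero k fun j => ?_
      have hp := hpos k hkN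
      simp only [of_apply, Function.update_self]
      have h12 : v k = 1 ∨ v k = 2 := by omega
      rcases h12 with h1 | h2
      · rw [h1, rowNeg_of_odd x 1 rfl]
        push_cast
        ring
      -- For `v k = 2` the node moves to `0` and its two terms cancel: `w² (1 + lam) · z² (a + 1)`
      -- against `z² (a + 1)(1 + lam) · w²`.
      · have hA : rowPos a x 2 = zOf x ^ 2 * (a + 1) := by
          have := rowPos_add_two a x 0
          rw [zero_add] at this
          rw [this, rowPos, aseq_zero]
          push_cast
          ring
        have hB : rowNeg x 2 = - wOf x ^ 2 := by
          have := rowNeg_add_two x 0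
          rw [zero_add] at this
          rw [this, rowNeg, aseq_zero]
          push_cast
          ring
        rw [h2, hA, hB]
        push_cast
        have : ((2 : ℂ) - 2) = 0 := by norm_num
        rw [this, neg_zero]
        norm_num
        ring
  · intro k _ hk
    have hkN : (k : ℕ) < N :=
      lt_of_le_of_ne (Nat.lt_succ_iff.mp k.2) fun hh => hk (Fin.ext hh)
    have hne : ((v k : ℂ)) + 1 ≠ 0 := Nat.cast_add_one_ne_zero _
    -- `lam` is chosen so that the weight `1 - lam / (v k + 1)` kills the one row that would leave
    -- the index set without being the last.
    rcases hup k hkN with h0 | ⟨l, hl, hlk⟩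
    · refine det_eq_zero_of_row_eq_zero k fun j => ?_
      simp only [of_apply, Function.update_self]
      rw [← h0, div_self hne]
      ring
    · have hlk' : (⟨l, Nat.lt_succ_of_le hl⟩ : Fin (N + 1)) ≠ k := by
        intro hh
        have : l = k := congrArg Fin.val hh
        rw [this] at hlk
        omega
      refine det_eq_zero_of_row_eq_smul _ k ⟨l, Nat.lt_succ_of_le hl⟩ hlk'
        (1 - lam / (v k + 1)) fun j => ?_
      simp only [of_apply, Function.update_self, Function.update_of_ne hlk']
      rw [hlk, rowPos_add_two, rowNeg_add_two]
      push_cast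
      field_simp
      ring
  · intro hh
    exact absurd (Finset.mem_univ _) hh

end Umemura

namespace Umemura

open Finset Matrix

/-! ### Derivatives and the Toda equation -/

lemma hasDerivAt_zOf (x : ℂ) : HasDerivAt zOf (wOf x / 2) x := by
  have h := (Complex.hasDerivAt_sinh (x / 2)).comp x ((hasDerivAt_id x).div_const 2)
  exact h.congr_deriv (by rw [wOf]; ring)

lemma hasDerivAt_wOf (x : ℂ) : HasDerivAt wOf (zOf x / 2) x := by
  have h := (Complex.hasDerivAt_cosh (x / 2)).comp x ((hasDerivAt_id x).div_const 2)
  exact h.congr_deriv (by rw [zOf]; ring)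

lemma hasDerivAt_zOf_pow_mul_wOf_pow (C : ℂ) (p q : ℕ) (x : ℂ) :
    ∃ d, HasDerivAt (fun x => C * zOf x ^ p * wOf x ^ q) d x ∧
      2 * (zOf x * wOf x) * d =
        (p * wOf x ^ 2 + q * zOf x ^ 2) * (C * zOf x ^ p * wOf x ^ q) := by
  refine ⟨_, (((hasDerivAt_zOf x).fun_pow p).const_mul C).fun_mul
    ((hasDerivAt_wOf x).fun_pow q), ?_⟩
  rcases p with _ | p <;> rcases q with _ | q <;> simp [pow_succ] <;> ring

lemma signedProd_pow {N : ℕ} (v : Fin N → ℕ) (α β : Fin N → ℂ) (J : Finset (Fin N)) (z w : ℂ) :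
    signedProd (fun k => α k * z ^ v k) (fun k => β k * w ^ v k) J =
      signedProd α β J * z ^ (∑ k, if k ∈ J then v k else 0) *
        w ^ (∑ k, if k ∈ J then 0 else v k) := by
  rw [signedProd, signedProd, ← Finset.prod_pow_eq_pow_sum, ← Finset.prod_pow_eq_pow_sum,
    ← Finset.prod_mul_distrib, ← Finset.prod_mul_distrib]
  refine Finset.prod_congr rfl fun k _ => ?_
  split_ifs <;> simp

/-- On `z^p w^q` the operator `4zw d/dx` multiplies by `2(p w² + q z²) = (z² + w²)(p + q) + (p -
q)`, because `w² - z² = 1`. Here `p + q` is the sum of all `v k` and `p - q` the sum of the signed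
nodes, which turns the Vandermonde determinant into the one with a gap. -/
lemma exists_hasDerivAt_alternant {N : ℕ} (v : Fin (N + 1) → ℕ) (α β : Fin (N + 1) → ℂ) (x : ℂ) :
    ∃ d, HasDerivAt (fun x => alternant (fun i => (v i : ℂ)) (fun k => α k * zOf x ^ v k)
        (fun k => β k * wOf x ^ v k)) d x ∧
      4 * (zOf x * wOf x) * d = (zOf x ^ 2 + wOf x ^ 2) * (∑ k, (v k : ℂ)) *
        alternant (fun i => (v i : ℂ)) (fun k => α k * zOf x ^ v k) (fun k => β k * wOf x ^ v k) +
        alternantGap (fun i => (v i : ℂ)) (fun k => α k * zOf x ^ v k)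
          (fun k => β k * wOf x ^ v k) := by
  have h : ∀ J : Finset (Fin (N + 1)), ∃ d, HasDerivAt (fun x =>
      signedProd (fun k => α k * zOf x ^ v k) (fun k => β k * wOf x ^ v k) J *
        (vandermonde (signedNode (fun i => (v i : ℂ)) J)).det) d x ∧
      4 * (zOf x * wOf x) * d = ((zOf x ^ 2 + wOf x ^ 2) * (∑ k, (v k : ℂ)) +
        ∑ k, signedNode (fun i => (v i : ℂ)) J k) *
        (signedProd (fun k => α k * zOf x ^ v k) (fun k => β k * wOf x ^ v k) J *
        (vandermonde (signedNode (fun i => (v i : ℂ)) J)).det) := by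
    intro J
    obtain ⟨d, hd, hd'⟩ := hasDerivAt_zOf_pow_mul_wOf_pow (signedProd α β J)
      (∑ k, if k ∈ J then v k else 0) (∑ k, if k ∈ J then 0 else v k) x
    simp only [signedProd_pow]
    refine ⟨_, hd.mul_const _, ?_⟩
    have e1 : (∑ k, (v k : ℂ)) = ((∑ k, if k ∈ J then v k else 0 : ℕ) : ℂ) +
        ((∑ k, if k ∈ J then 0 else v k : ℕ) : ℂ) := by
      push_cast
      rw [← Finset.sum_add_distrib]
      exact Finset.sum_congr rfl fun k _ => by split_ifs <;> simp
    have e2 : ∑ k, signedNode (fun i => (v i : ℂ)) J k =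
        ((∑ k, if k ∈ J then v k else 0 : ℕ) : ℂ) -
        ((∑ k, if k ∈ J then 0 else v k : ℕ) : ℂ) := by
      push_cast
      rw [← Finset.sum_sub_distrib]
      exact Finset.sum_congr rfl fun k _ => by unfold signedNode; split_ifs <;> simp
    rw [e1, e2]
    generalize ((∑ k, if k ∈ J then v k else 0 : ℕ)) = p at *
    generalize ((∑ k, if k ∈ J then 0 else v k : ℕ)) = q at *
    have hw := wOf_sq x
    linear_combination 2 * (vandermonde (signedNode (fun i => (v i : ℂ)) J)).det * hd' +
      ((p : ℂ) - q) * (signedProd α β J * zOf x ^ p * wOf x ^ q) *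
        (vandermonde (signedNode (fun i => (v i : ℂ)) J)).det * hw
  choose d hd hd' using h
  refine ⟨∑ J, d J, ?_, ?_⟩
  · simp only [alternant_eq_sum]
    exact HasDerivAt.fun_sum fun J _ => hd J
  · rw [Finset.mul_sum, Finset.sum_congr rfl fun J _ => hd' J, alternant_eq_sum,
      alternantGap_eq_sum]
    generalize (∑ k, (v k : ℂ)) = c
    rw [Finset.mul_sum, ← Finset.sum_add_distrib]
    refine Finset.sum_congr rfl fun J _ => ?_
    ring

lemma exists_hasDerivAt_borderedMinor (a : ℂ) (v : ℕ → ℕ) (N p : ℕ) (x : ℂ) :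
    ∃ d, HasDerivAt (fun x => borderedMinor N (rowEntry a v x) p N) d x ∧
      4 * (zOf x * wOf x) * d = (zOf x ^ 2 + wOf x ^ 2) *
        (∑ k ∈ range N, (v k : ℂ) + v p) * borderedMinor N (rowEntry a v x) p N +
        borderedMinor N (rowEntry a v x) p (N + 1) := by
  have hval : ∀ i : Fin (N + 1), (if (i : ℕ) < N then (i : ℕ) else N) = i := by
    intro i
    have := i.2
    split_ifs <;> omega
  obtain ⟨d, hd, hd'⟩ := exists_hasDerivAt_alternant
    (fun k : Fin (N + 1) => v (if (k : ℕ) < N then k else p))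
    (fun k => aseq a (v (if (k : ℕ) < N then k else p)))
    (fun k => (-1) ^ (v (if (k : ℕ) < N then k else p) + 1) *
      aseq 0 (v (if (k : ℕ) < N then k else p))) x
  have h1 : ∀ x, borderedMinor N (rowEntry a v x) p N = alternant
      (fun k : Fin (N + 1) => (v (if (k : ℕ) < N then k else p) : ℂ))
      (fun k => aseq a (v (if (k : ℕ) < N then k else p)) *
        zOf x ^ v (if (k : ℕ) < N then k else p))
      (fun k => (-1) ^ (v (if (k : ℕ) < N then k else p) + 1) *
        aseq 0 (v (if (k : ℕ) < N then k else p)) * wOf x ^ v (if (k : ℕ) < N then k else p)) := by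
    intro x
    simp only [alternant, borderedMinor, hval, rowEntry, rowPos, rowNeg]
  have h2 : borderedMinor N (rowEntry a v x) p (N + 1) = alternantGap
      (fun k : Fin (N + 1) => (v (if (k : ℕ) < N then k else p) : ℂ))
      (fun k => aseq a (v (if (k : ℕ) < N then k else p)) *
        zOf x ^ v (if (k : ℕ) < N then k else p))
      (fun k => (-1) ^ (v (if (k : ℕ) < N then k else p) + 1) *
        aseq 0 (v (if (k : ℕ) < N then k else p)) * wOf x ^ v (if (k : ℕ) < N then k else p)) := by
    simp only [alternantGap, gapExponent, borderedMinor, rowEntry, rowPos, rowNeg]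
  have h3 : ∑ k : Fin (N + 1), (v (if (k : ℕ) < N then k else p) : ℂ) =
      ∑ k ∈ range N, (v k : ℂ) + v p := by
    rw [Fin.sum_univ_castSucc, Finset.sum_range]
    simp
  refine ⟨d, ?_, ?_⟩
  · simp only [h1]; exact hd
  · rw [h1, h2, ← h3]; exact hd'

lemma borderedMinor_self (a : ℂ) (v : ℕ → ℕ) (N : ℕ) (x : ℂ) :
    borderedMinor N (rowEntry a v x) N N = rowDet a v (N + 1) x := by
  have hval : ∀ i : Fin (N + 1), (if (i : ℕ) < N then (i : ℕ) else N) = i := by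
    intro i
    have := i.2
    split_ifs <;> omega
  simp only [borderedMinor, rowDet, hval]

lemma differentiable_rowDet (a : ℂ) (v : ℕ → ℕ) (N : ℕ) : Differentiable ℂ (rowDet a v N) := by
  rcases N with _ | N
  · have : rowDet a v 0 = fun _ => 1 := by
      ext x
      simp [rowDet]
    rw [this]
    exact differentiable_const _
  · intro x
    obtain ⟨d, hd, -⟩ := exists_hasDerivAt_borderedMinor a v N N x
    simp only [borderedMinor_self] at hd
    exact hd.differentiableAt

/-- The Toda equation for the determinants `rowDet`. -/
lemma rowDet_toda (a : ℂ) (v : ℕ → ℕ) (x : ℂ) (N : ℕ) (lam : ℂ)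
    (hinj : ∀ k ≤ N, ∀ l ≤ N, v k = v l → k = l) (hpos : ∀ k ≤ N, 0 < v k)
    (hup : ∀ k < N, (v k : ℂ) + 1 = lam ∨ ∃ l ≤ N, v l = v k + 2)
    (hdn : ∀ k ≤ N, v k ≤ 2 ∨ ∃ l ≤ N, v l + 2 = v k)
    (hlam : lam = 0 ∨ ∃ k ≤ N, v k = 1) (hlast : v (N + 1) = v N + 2)
    (hsum : ∑ k ∈ range (N + 1), (v k : ℂ) ^ 2 + 2 / 3 * ((N + 1) * N * (N - 1)) +
      2 * ((N + 1) * N) + (N + 1) - lam * (N + 1) ^ 2 +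
      (2 * (N + 1) - lam) * ∑ k ∈ range (N + 1), (v k : ℂ) =
      (N + 1 - lam / 2) * (v N + 1) ^ 2) :
    (1 - lam / (v N + 1)) * (rowDet a v N x * rowDet a v (N + 2) x) =
      -(2 * (N + 1) - lam) * (((v N + 1) ^ 2 - a * zOf x ^ 2) * rowDet a v (N + 1) x ^ 2 +
        8 * zOf x ^ 2 * wOf x ^ 2 * hirota (rowDet a v (N + 1)) (rowDet a v (N + 1)) x) := by
  set F := rowDet a v (N + 1) with hF
  have hFd : Differentiable ℂ F := differentiable_rowDet a v (N + 1)
  have hF2 : Differentiable ℂ (deriv F) := by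
    intro y
    exact (hFd.analyticAt y).deriv.differentiableAt
  set φ : ℂ := 1 - lam / (v N + 1) with hφ
  have hF' : ∀ y, borderedMinor N (rowEntry a v y) N (N + 1) = 4 * (zOf y * wOf y) * deriv F y -
      (zOf y ^ 2 + wOf y ^ 2) * (∑ k ∈ range (N + 1), (v k : ℂ)) * F y := by
    intro y
    obtain ⟨d, hd, hd'⟩ := exists_hasDerivAt_borderedMinor a v N N y
    simp only [borderedMinor_self, ← hF] at hd hd'
    rw [← Finset.sum_range_succ] at hd'
    rw [hd.deriv, hd']
    ring
  set g : ℂ → ℂ := fun y => borderedMinor N (rowEntry a v y) (N + 1) N with hg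
  -- The gap minor is eliminated by `hF'`; `hsum` is exactly the identity that then collapses the
  -- coefficient of `(z² + w²) F` to a multiple of `(v N + 1)²`.
  have hlin : ∀ y, φ * g y = (N + 1 - lam / 2) * (((zOf y ^ 2 + wOf y ^ 2) * (v N + 1) ^ 2 +
      a * zOf y ^ 2) * F y - 8 * (zOf y * wOf y) * deriv F y) := by
    intro y
    have h := borderedMinor_rowEntry_succ a v y N lam hinj hpos hup hdn hlam hlast
    rw [hF' y, borderedMinor_self] at h
    rw [hφ, hg, h]
    have hw := wOf_sq y
    rw [mul_sub, mul_add, ← mul_assoc]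
    linear_combination (zOf y ^ 2 + wOf y ^ 2) * F y * hsum +
      (2 * (N + 1) - lam) * (-1) * (4 * (zOf y * wOf y) * deriv F y -
      (zOf y ^ 2 + wOf y ^ 2) * (∑ k ∈ range (N + 1), (v k : ℂ)) * F y) * hw
  obtain ⟨dg, hdg, hdg'⟩ := exists_hasDerivAt_borderedMinor a v N (N + 1) x
  have hz := hasDerivAt_zOf x
  have hw' := hasDerivAt_wOf x
  have hder : φ * dg = (N + 1 - lam / 2) * ((2 * (zOf x * wOf x) * (v N + 1) ^ 2 +
      a * (zOf x * wOf x)) * F x + ((zOf x ^ 2 + wOf x ^ 2) * (v N + 1) ^ 2 +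
      a * zOf x ^ 2) * deriv F x - 4 * (zOf x ^ 2 + wOf x ^ 2) * deriv F x -
      8 * (zOf x * wOf x) * deriv (deriv F) x) := by
    have h1 : HasDerivAt (fun y => φ * g y) (φ * dg) x := hdg.const_mul φ
    have h2 := ((((((hz.fun_pow 2).fun_add (hw'.fun_pow 2)).mul_const (((v N : ℂ) + 1) ^ 2)).fun_add
      ((hz.fun_pow 2).const_mul a)).fun_mul (hFd x).hasDerivAt).fun_sub
      (((hz.fun_mul hw').const_mul 8).fun_mul (hF2 x).hasDerivAt)).const_mul ((N : ℂ) + 1 - lam / 2)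
    simp only [hlin] at h1
    rw [h1.unique h2]
    push_cast
    ring
  -- The minors of the condensation identity are expressed by `F`, `F'`, `g` and `g'`. Keeping the
  -- factor `φ` lets `hlin` and `hder` replace `g` and `g'` without a division.
  have hjac := det_mul_det_add_two N (rowEntry a v x)
  rw [borderedMinor_self, hF' x] at hjac
  have hgx : borderedMinor N (rowEntry a v x) (N + 1) N = g x := rfl
  rw [hgx] at hjac hdg'
  have hdg2 : borderedMinor N (rowEntry a v x) (N + 1) (N + 1) = 4 * (zOf x * wOf x) * dg -
      (zOf x ^ 2 + wOf x ^ 2) * (∑ k ∈ range (N + 1), (v k : ℂ) + 2) * g x := by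
    rw [hdg', Finset.sum_range_succ, hlast]
    push_cast
    ring
  rw [hdg2, ← hF] at hjac
  have hl := hlin x
  have e : φ * (rowDet a v N x * rowDet a v (N + 2) x) =
      F x * (4 * (zOf x * wOf x) * (φ * dg)) - 4 * (zOf x * wOf x) * deriv F x * (φ * g x)
      - 2 * (zOf x ^ 2 + wOf x ^ 2) * F x * (φ * g x) := by
    rw [rowDet, rowDet, hjac]
    ring
  rw [e, hder, hl, hirota, show wOf x ^ 2 = zOf x ^ 2 + 1 from wOf_sq x]
  ring_nf
  rw [show wOf x ^ 2 = zOf x ^ 2 + 1 from wOf_sq x]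
  ring

end Umemura

namespace Umemura

open Finset Matrix

/-! ### The Umemura polynomials as determinants -/

/-- The increasing enumeration of `[n;m]`. -/
def enumIdx (n k : ℕ) : ℕ := if k < n then k + 1 else 2 * k + 2 - n

/-- The sign `(-1)^{(i-n)/2}` of the elements `i > n` of `[n;m]`. -/
def idxSign (n k : ℕ) : ℂ := (-1) ^ (if k < n then 0 else k + 1 - n)

lemma enumIdx_strictMono (n : ℕ) : StrictMono (enumIdx n) := by
  intro i j hij
  unfold enumIdx
  split_ifs <;> omega

lemma enumIdx_pos (n k : ℕ) : 0 < enumIdx n k := by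
  unfold enumIdx
  split_ifs <;> omega

lemma idx_eq_image (n m : ℕ) :
    idx n m = univ.image fun k : Fin (n + m) => enumIdx n k := by
  ext i
  simp only [idx, mem_union, mem_Icc, mem_image, mem_univ, true_and, enumIdx]
  constructor
  · rintro (⟨h1, h2⟩ | ⟨j, ⟨h1, h2⟩, rfl⟩)
    · exact ⟨⟨i - 1, by omega⟩, by simp only; split_ifs <;> omega⟩
    · exact ⟨⟨n + j - 1, by omega⟩, by simp only; split_ifs <;> omega⟩
  · rintro ⟨k, hk⟩
    have := k.2
    split_ifs at hk with h
    · left; omega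
    · right
      exact ⟨k + 1 - n, by omega, by omega⟩

lemma prod_Ioi_const_snd {N : ℕ} (s : Fin N → ℂ) : ∏ i, ∏ j ∈ Ioi i, s j = ∏ j, s j ^ (j : ℕ) := by
  rw [Finset.prod_comm' (t' := univ) (s' := fun j => Iio j) (by simp)]
  exact Finset.prod_congr rfl fun j _ => by simp

/-- For `i < j` the difference of signed nodes has the sign of the node `j`, and its absolute value
is `v j - v i` or `v i + v j` according as the two signs agree or not. A node `k ∉ J` has `k`
predecessors, which gives `(-1)^k`; pairs of opposite sign give the coefficient `d`. -/
lemma det_vandermonde_signedNode {N : ℕ} (v : Fin N → ℕ) (hv : StrictMono v)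
    (J : Finset (Fin N)) :
    (vandermonde (signedNode (fun k => (v k : ℂ)) J)).det =
      (vandermonde fun k => (v k : ℂ)).det * (∏ k, if k ∈ J then 1 else (-1) ^ (k : ℕ)) *
        ∏ p ∈ J, ∏ q ∈ Jᶜ, ((|((v p : ℚ) + v q) / ((v p : ℚ) - v q)| : ℚ) : ℂ) := by
  set F : Fin N → Fin N → ℂ := fun p q => if p ∈ J ∧ q ∉ J then
    ((|((v p : ℚ) + v q) / ((v p : ℚ) - v q)| : ℚ) : ℂ) else 1 with hF
  have h1 : ∀ i j : Fin N, i < j → signedNode (fun k => (v k : ℂ)) J j -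
      signedNode (fun k => (v k : ℂ)) J i =
      ((v j : ℂ) - v i) * (if j ∈ J then 1 else -1) * (F j i * F i j) := by
    intro i j hij
    have hlt : (v i : ℚ) < v j := by exact_mod_cast hv hij
    have hs : (0 : ℚ) ≤ (v i : ℚ) + v j := by positivity
    have a1 : |((v i : ℚ) + v j) / ((v i : ℚ) - v j)| = ((v i : ℚ) + v j) / ((v j : ℚ) - v i) := by
      rw [abs_div, abs_of_nonneg hs, abs_of_neg (by linarith), neg_sub]
    have a2 : |((v j : ℚ) + v i) / ((v j : ℚ) - v i)| = ((v i : ℚ) + v j) / ((v j : ℚ) - v i) := by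
      rw [abs_div, add_comm, abs_of_nonneg hs, abs_of_pos (by linarith)]
    have hne : ((v j : ℂ)) - v i ≠ 0 := by
      rw [sub_ne_zero]
      exact_mod_cast (hv hij).ne'
    by_cases hi : i ∈ J <;> by_cases hj : j ∈ J <;>
      simp only [hF, signedNode, hi, hj, a1, a2, not_true_eq_false, not_false_eq_true, and_true,
        and_false, if_true, if_false] <;> push_cast <;> field_simp <;> ring
  rw [det_vandermonde, det_vandermonde,
    Finset.prod_congr rfl fun i _ => Finset.prod_congr rfl fun j hj => h1 i j (by simpa using hj)]
  rw [Finset.prod_congr rfl fun i _ => (Finset.prod_mul_distrib ..), Finset.prod_mul_distrib,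
    Finset.prod_congr rfl fun i _ => (Finset.prod_mul_distrib ..), Finset.prod_mul_distrib,
    Finset.prod_prod_Ioi_mul_eq_prod_prod_off_diag, prod_Ioi_const_snd]
  congr 1
  · congr 1
    exact Finset.prod_congr rfl fun j _ => by split_ifs <;> simp
  · have h2 : ∀ i, ∏ j ∈ ({i}ᶜ : Finset (Fin N)), F j i = ∏ j, F j i := by
      intro i
      refine Finset.prod_subset (Finset.subset_univ _) fun j _ hj => ?_
      have : j = i := by simpa using hj
      subst this
      simp [hF]
    rw [Finset.prod_congr rfl fun i _ => h2 i, Finset.prod_comm, ← Finset.prod_subset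
      (Finset.subset_univ J) (fun p _ hp => Finset.prod_eq_one fun q _ => by simp [hF, hp])]
    refine Finset.prod_congr rfl fun p hp => ?_
    rw [← Finset.prod_subset (Finset.subset_univ Jᶜ)
      (fun q _ hq => by simp only [mem_compl, not_not] at hq; simp [hF, hq])]
    refine Finset.prod_congr rfl fun q hq => ?_
    have : q ∉ J := by simpa using hq
    simp [hF, hp, this]

lemma prod_mem_eq_ite {N : ℕ} (J : Finset (Fin N)) (f : Fin N → ℂ) :
    ∏ k ∈ J, f k = ∏ k, if k ∈ J then f k else 1 := by
  rw [Finset.prod_ite_mem, Finset.univ_inter]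

lemma prod_compl_eq_ite {N : ℕ} (J : Finset (Fin N)) (f : Fin N → ℂ) :
    ∏ k ∈ Jᶜ, f k = ∏ k, if k ∈ J then 1 else f k := by
  rw [prod_mem_eq_ite]
  exact Finset.prod_congr rfl fun k _ => by by_cases h : k ∈ J <;> simp [h]

/-- The term of `J` in the expansion of the determinant corresponds to `I = J.image v`. The sign
`(-1)^c(I)` is the product of `idxSign` over `J`; outside `J` the signs of `rowNeg` and of the
reflected nodes multiply to `idxSign` again, so the product over all `k` is a global constant. -/
lemma Ux_mul_det_vandermonde (n m : ℕ) (a x : ℂ) :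
    Ux n m 0 a 0 x * (vandermonde fun k : Fin (n + m) => (enumIdx n k : ℂ)).det =
      (∏ k ∈ range (n + m), idxSign n k) * rowDet a (enumIdx n) (n + m) x := by
  set v : Fin (n + m) → ℕ := fun k => enumIdx n k with hv
  have hmono : StrictMono v := fun i j hij => enumIdx_strictMono n hij
  have hdet : rowDet a (enumIdx n) (n + m) x = ∑ J, signedProd (fun k => rowPos a x (v k))
      (fun k => rowNeg x (v k)) J * (vandermonde (signedNode (fun k => (v k : ℂ)) J)).det := by
    rw [← alternant_eq_sum]
    rfl
  rw [hdet, Ux, U, Finset.sum_mul, Finset.mul_sum]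
  symm
  refine Finset.sum_bij (fun J _ => J.image v) ?_ ?_ ?_ ?_
  · intro J _
    simp only [mem_filter, mem_powerset, idx_eq_image]
    exact ⟨Finset.image_subset_image (Finset.subset_univ _), by simp⟩
  · intro J _ K _ h
    exact Finset.image_injective hmono.injective h
  · intro I hI
    simp only [mem_filter, mem_powerset, idx_eq_image] at hI
    obtain ⟨J, -, hJ⟩ := Finset.subset_image_iff.mp hI.1
    exact ⟨J, mem_univ _, hJ⟩
  · intro J _
    have hcompl : idx n m \ J.image v = Jᶜ.image v := by
      rw [idx_eq_image, ← Finset.image_sdiff _ _ hmono.injective, Finset.compl_eq_univ_sdiff]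
    have hinj : ∀ s : Finset (Fin (n + m)), Set.InjOn v s := fun s => hmono.injective.injOn
    have hcs : ((-1 : ℂ)) ^ csum n (J.image v) = ∏ k ∈ J, idxSign n k := by
      rw [csum, Finset.sum_filter, Finset.sum_image (hinj J)]
      simp only [idxSign]
      rw [Finset.prod_pow_eq_pow_sum]
      congr 1
      refine Finset.sum_congr rfl fun k _ => ?_
      simp only [hv, enumIdx]
      split_ifs <;> omega
    have hd : ((dcoef n m (J.image v) : ℚ) : ℂ) =
        ∏ p ∈ J, ∏ q ∈ Jᶜ, ((|((v p : ℚ) + v q) / ((v p : ℚ) - v q)| : ℚ) : ℂ) := by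
      rw [dcoef, hcompl, Finset.prod_image (hinj J), Rat.cast_prod]
      refine Finset.prod_congr rfl fun p _ => ?_
      rw [Finset.prod_image (hinj _), Rat.cast_prod]
    have hsd : J.image v \ Finset.Icc 1 0 = J.image v := by simp
    rw [hsd, hcompl, hcs, hd, det_vandermonde_signedNode v hmono, 
      Finset.prod_image (f := aseq a) (hinj J), Finset.prod_image (f := aseq 0) (hinj Jᶜ),
      Finset.sum_image (hinj J), Finset.sum_image (hinj _),
      ← Finset.prod_pow_eq_pow_sum, ← Finset.prod_pow_eq_pow_sum]
    simp only [Finset.Icc_eq_empty_of_lt (zero_lt_one' ℕ), Finset.prod_empty, Finset.prod_const_one,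
      one_mul]
    generalize (∏ p ∈ J, ∏ q ∈ Jᶜ, ((|((v p : ℚ) + v q) / ((v p : ℚ) - v q)| : ℚ) : ℂ)) = C
    generalize (vandermonde fun k => ((v k : ℕ) : ℂ)).det = V
    have key : (∏ k ∈ range (n + m), idxSign n k) * (signedProd (fun k => rowPos a x (v k))
        (fun k => rowNeg x (v k)) J * ∏ k, if k ∈ J then 1 else (-1) ^ (k : ℕ)) =
        (∏ k ∈ J, idxSign n k) * ((∏ k ∈ J, aseq a (v k)) * (∏ k ∈ Jᶜ, aseq 0 (v k)) *
          (∏ k ∈ J, zOf x ^ v k) * ∏ k ∈ Jᶜ, wOf x ^ v k) := by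
      rw [Finset.prod_range, signedProd, prod_mem_eq_ite J, prod_mem_eq_ite J, prod_mem_eq_ite J,
        prod_compl_eq_ite, prod_compl_eq_ite]
      simp only [← Finset.prod_mul_distrib]
      refine Finset.prod_congr rfl fun k _ => ?_
      by_cases hk : k ∈ J
      · simp only [hk, if_true, rowPos]
        ring
      · simp only [hk, if_false, rowNeg, one_mul, mul_one]
        have hs : idxSign n k * ((-1) ^ (v k + 1) * (-1) ^ (k : ℕ)) = 1 := by
          rw [idxSign, ← pow_add, ← pow_add]
          refine Even.neg_one_pow ?_
          simp only [hv, enumIdx]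
          split_ifs
          · exact ⟨k + 1, by omega⟩
          · exact ⟨2 * k + 2 - n, by omega⟩
        linear_combination (aseq 0 (v k) * wOf x ^ v k) * hs
    linear_combination (C * V) * key

end Umemura

namespace Umemura

open Finset Matrix

/-! ### The recurrence relation for `b = 0` -/

lemma enumIdx_of_lt {n k : ℕ} (h : k < n) : enumIdx n k = k + 1 := if_pos h

lemma enumIdx_add (n j : ℕ) : enumIdx n (n + j) = n + 2 * j + 2 := by
  rw [enumIdx, if_neg (by omega)]
  omega

lemma sum_enumIdx (n m : ℕ) :
    ∑ k ∈ range (n + m), (enumIdx n k : ℂ) = n * (n + 1) / 2 + m * n + m * (m + 1) := by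
  induction m with
  | zero =>
    have h : ∀ l : ℕ, ∑ k ∈ range l, ((k : ℂ) + 1) = l * (l + 1) / 2 := by
      intro l
      induction l with
      | zero => simp
      | succ l ih => rw [Finset.sum_range_succ, ih]; push_cast; ring
    rw [add_zero, Finset.sum_congr rfl (g := fun k : ℕ => (k : ℂ) + 1)
      (fun k hk => by rw [enumIdx_of_lt (Finset.mem_range.mp hk)]; push_cast; ring), h]
    simp
  | succ m ih =>
    rw [← add_assoc, Finset.sum_range_succ, ih, enumIdx_add]
    push_cast
    ring

lemma sum_enumIdx_sq (n m : ℕ) :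
    ∑ k ∈ range (n + m), (enumIdx n k : ℂ) ^ 2 = n * (n + 1) * (2 * n + 1) / 6 + m * n ^ 2 +
      2 * n * (m * (m + 1)) + 2 / 3 * (m * (m + 1) * (2 * m + 1)) := by
  induction m with
  | zero =>
    have h : ∀ l : ℕ, ∑ k ∈ range l, ((k : ℂ) + 1) ^ 2 = (l : ℂ) * (l + 1) * (2 * l + 1) / 6 := by
      intro l
      induction l with
      | zero => simp
      | succ l ih => rw [Finset.sum_range_succ, ih]; push_cast; ring
    rw [add_zero, Finset.sum_congr rfl (g := fun k : ℕ => ((k : ℂ) + 1) ^ 2)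
      (fun k hk => by rw [enumIdx_of_lt (Finset.mem_range.mp hk)]; push_cast; ring), h]
    simp
  | succ m ih =>
    rw [← add_assoc, Finset.sum_range_succ, ih, enumIdx_add]
    push_cast
    ring

lemma rowDet_enumIdx_toda (a : ℂ) (n m : ℕ) (x : ℂ) :
    (2 * m + 3) / (n + 2 * m + 3) *
        (rowDet a (enumIdx n) (n + m) x * rowDet a (enumIdx n) (n + m + 2) x) =
      -(n + 2 * m + 2) * (((n + 2 * m + 3) ^ 2 - a * zOf x ^ 2) *
          rowDet a (enumIdx n) (n + m + 1) x ^ 2 + 8 * zOf x ^ 2 * wOf x ^ 2 *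
            hirota (rowDet a (enumIdx n) (n + m + 1)) (rowDet a (enumIdx n) (n + m + 1)) x) := by
  have hlast : enumIdx n (n + m) = n + 2 * m + 2 := enumIdx_add n m
  -- Here `lam = n`: since `n + 1` is missing, `n - 1` is the only index below the last that leaves
  -- the set when raised by 2, if it occurs at all.
  have h := rowDet_toda a (enumIdx n) x (n + m) n
    (fun k _ l _ h => (enumIdx_strictMono n).injective h) (fun k _ => enumIdx_pos n k)
    ?_ ?_ ?_ ?_ ?_
  · rw [hlast] at h
    push_cast at h
    have hne : (n : ℂ) + 2 * m + 3 ≠ 0 := by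
      have := Nat.cast_add_one_ne_zero (R := ℂ) (n + 2 * m + 2)
      push_cast at this
      intro hh
      apply this
      linear_combination hh
    have e : 1 - (n : ℂ) / (n + 2 * m + 2 + 1) = (2 * m + 3) / (n + 2 * m + 3) := by
      rw [show (n : ℂ) + 2 * m + 2 + 1 = n + 2 * m + 3 by ring]
      field_simp
      ring
    rw [e] at h
    rw [h]
    ring
  · intro k hk
    rcases Nat.lt_or_ge k n with h1 | h1
    · rcases Nat.lt_or_ge (k + 2) n with h2 | h2
      · exact Or.inr ⟨k + 2, by omega, by rw [enumIdx_of_lt h2, enumIdx_of_lt h1]⟩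
      · rcases Nat.lt_or_ge (k + 1) n with h3 | h3
        · left
          rw [enumIdx_of_lt h1, show n = k + 2 by omega]
          push_cast
          ring
        · have h4 := enumIdx_add n 0
          refine Or.inr ⟨n + 0, by omega, ?_⟩
          rw [h4, enumIdx_of_lt h1]
          omega
    · refine Or.inr ⟨k + 1, by omega, ?_⟩
      obtain ⟨j, rfl⟩ := Nat.exists_eq_add_of_le h1
      rw [add_assoc, enumIdx_add, enumIdx_add]
      omega
  · intro k hk
    rcases Nat.lt_or_ge k n with h1 | h1
    · rcases Nat.lt_or_ge k 2 with h2 | h2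
      · left
        rw [enumIdx_of_lt h1]
        omega
      · right
        refine ⟨k - 2, by omega, ?_⟩
        rw [enumIdx_of_lt h1, enumIdx_of_lt (by omega)]
        omega
    · obtain ⟨j, rfl⟩ := Nat.exists_eq_add_of_le h1
      rw [enumIdx_add]
      rcases j with _ | j
      · rcases n with _ | n
        · left; omega
        · right
          refine ⟨n, by omega, ?_⟩
          rw [enumIdx_of_lt (by omega)]
      · right
        refine ⟨n + j, by omega, ?_⟩
        rw [enumIdx_add]
        omega
  · rcases n with _ | n
    · left; simp
    · right
      exact ⟨0, by omega, by rw [enumIdx_of_lt (by omega)]⟩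
  · rw [add_assoc, enumIdx_add, enumIdx_add]
    omega
  · rw [hlast, add_assoc n m 1, sum_enumIdx, sum_enumIdx_sq]
    push_cast
    ring

lemma det_vandermonde_eq_prod_range (f : ℕ → ℂ) (N : ℕ) :
    (vandermonde fun k : Fin N => f k).det = ∏ j ∈ range N, ∏ i ∈ range j, (f j - f i) := by
  rw [det_vandermonde, Finset.prod_comm' (t' := univ) (s' := fun j => Iio j) (by simp),
    Finset.prod_range]
  refine Finset.prod_congr rfl fun j _ => ?_
  rw [← Nat.Iio_eq_range, ← Fin.map_valEmbedding_Iio, Finset.prod_map]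
  rfl

lemma prod_range_shift (c : ℂ) (n : ℕ) :
    (∏ i ∈ range n, (c + 1 - i)) * ((c - n + 1) * (c - n)) =
      (c + 1) * c * ∏ i ∈ range n, (c - 1 - i) := by
  induction n with
  | zero => simp
  | succ n ih =>
    rw [Finset.prod_range_succ, Finset.prod_range_succ]
    push_cast
    linear_combination (c - 1 - n) * ih

lemma prod_sub_enumIdx (n m : ℕ) (c : ℂ) :
    ∏ i ∈ range (n + m), (c - enumIdx n i) =
      (∏ i ∈ range n, (c - 1 - i)) * ∏ j ∈ range m, (c - (n + 2 * j + 2)) := by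
  rw [Finset.prod_range_add]
  congr 1
  · refine Finset.prod_congr rfl fun i hi => ?_
    rw [enumIdx_of_lt (Finset.mem_range.mp hi)]
    push_cast
    ring
  · refine Finset.prod_congr rfl fun i hi => ?_
    rw [enumIdx_add]
    push_cast
    ring

lemma prod_sub_enumIdx_succ (n m : ℕ) :
    (2 * m + 3) * ∏ i ∈ range (n + m + 1), ((enumIdx n (n + m + 1) : ℂ) - enumIdx n i) =
      (n + 2 * m + 3) * (n + 2 * m + 2) *
        ∏ i ∈ range (n + m), ((enumIdx n (n + m) : ℂ) - enumIdx n i) := by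
  rw [add_assoc n m 1, prod_sub_enumIdx, prod_sub_enumIdx, enumIdx_add, enumIdx_add,
    Finset.prod_range_succ' _ m]
  push_cast
  have h := prod_range_shift ((n : ℂ) + 2 * m + 2) n
  have e1 : ∏ i ∈ range n, ((n : ℂ) + 2 * (m + 1) + 2 - 1 - i) =
      ∏ i ∈ range n, ((n : ℂ) + 2 * m + 2 + 1 - i) :=
    Finset.prod_congr rfl fun i _ => by ring
  have e2 : ∏ j ∈ range m, ((n : ℂ) + 2 * (m + 1) + 2 - (n + 2 * (j + 1) + 2)) =
      ∏ j ∈ range m, ((n : ℂ) + 2 * m + 2 - (n + 2 * j + 2)) :=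
    Finset.prod_congr rfl fun i _ => by ring
  rw [e1, e2]
  linear_combination (∏ j ∈ range m, ((n : ℂ) + 2 * m + 2 - (n + 2 * j + 2))) * h

lemma idxSign_sq (n k : ℕ) : idxSign n k * idxSign n k = 1 := by
  rw [idxSign, ← pow_add]
  exact Even.neg_one_pow ⟨_, rfl⟩

lemma prod_idxSign_sq (n N : ℕ) :
    (∏ k ∈ range N, idxSign n k) * (∏ k ∈ range N, idxSign n k) = 1 := by
  rw [← Finset.prod_mul_distrib]
  exact Finset.prod_eq_one fun k _ => idxSign_sq n k

lemma det_vandermonde_enumIdx_ne_zero (n N : ℕ) :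
    (vandermonde fun k : Fin N => (enumIdx n k : ℂ)).det ≠ 0 := by
  rw [det_vandermonde_ne_zero_iff]
  intro i j h
  exact Fin.ext ((enumIdx_strictMono n).injective (by simpa using h))

/-- The constant of proportionality between `U_{n,m}` and its determinant. -/
noncomputable def detScale (n m : ℕ) : ℂ :=
  (∏ k ∈ range (n + m), idxSign n k) / (vandermonde fun k : Fin (n + m) => (enumIdx n k : ℂ)).det

lemma detScale_ne_zero (n m : ℕ) : detScale n m ≠ 0 :=
  div_ne_zero (left_ne_zero_of_mul_eq_one (prod_idxSign_sq n (n + m)))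
    (det_vandermonde_enumIdx_ne_zero n (n + m))

lemma Ux_eq_detScale_mul (n m : ℕ) (a : ℂ) :
    Ux n m 0 a 0 = fun x => detScale n m * rowDet a (enumIdx n) (n + m) x := by
  ext x
  rw [detScale, div_mul_eq_mul_div, ← Ux_mul_det_vandermonde,
    mul_div_cancel_right₀ _ (det_vandermonde_enumIdx_ne_zero n (n + m))]

/-- Consecutive Vandermonde determinants differ by the product over the last row, so only the ratio
of two such products is needed, and `prod_sub_enumIdx_succ` supplies it. The minus sign comes from
the alternation of `idxSign` beyond `n`. -/
lemma detScale_mul_detScale (n m : ℕ) :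
    detScale n m * detScale n (m + 2) * (n + 2 * m + 2) =
      -((2 * m + 3) / (n + 2 * m + 3)) * detScale n (m + 1) ^ 2 := by
  have hne : (n : ℂ) + 2 * m + 3 ≠ 0 := by
    have := Nat.cast_add_one_ne_zero (R := ℂ) (n + 2 * m + 2)
    push_cast at this
    intro hh
    apply this
    linear_combination hh
  have hv0 := det_vandermonde_enumIdx_ne_zero n (n + m)
  have hv1 := det_vandermonde_enumIdx_ne_zero n (n + m + 1)
  have hv2 := det_vandermonde_enumIdx_ne_zero n (n + m + 2)
  have hp := prod_sub_enumIdx_succ n m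
  have hs0 := prod_idxSign_sq n (n + m)
  have hs1 := idxSign_sq n (n + m)
  have hs2 : idxSign n (n + m) * idxSign n (n + m + 1) = -1 := by
    rw [idxSign, idxSign, ← pow_add]
    exact Odd.neg_one_pow ⟨m + 1, by rw [if_neg (by omega), if_neg (by omega)]; omega⟩
  have e1 : (vandermonde fun k : Fin (n + m + 1) => (enumIdx n k : ℂ)).det =
      (vandermonde fun k : Fin (n + m) => (enumIdx n k : ℂ)).det *
        ∏ i ∈ range (n + m), ((enumIdx n (n + m) : ℂ) - enumIdx n i) := by
    rw [det_vandermonde_eq_prod_range (fun k => (enumIdx n k : ℂ)),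
      det_vandermonde_eq_prod_range (fun k => (enumIdx n k : ℂ)), Finset.prod_range_succ]
  have e2 : (vandermonde fun k : Fin (n + m + 2) => (enumIdx n k : ℂ)).det =
      (vandermonde fun k : Fin (n + m + 1) => (enumIdx n k : ℂ)).det *
        ∏ i ∈ range (n + m + 1), ((enumIdx n (n + m + 1) : ℂ) - enumIdx n i) := by
    rw [det_vandermonde_eq_prod_range (fun k => (enumIdx n k : ℂ)),
      det_vandermonde_eq_prod_range (fun k => (enumIdx n k : ℂ)), Finset.prod_range_succ]
  have g1 : detScale n (m + 1) = (∏ k ∈ range (n + m + 1), idxSign n k) /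
      (vandermonde fun k : Fin (n + m + 1) => (enumIdx n k : ℂ)).det := rfl
  have g2 : detScale n (m + 2) = (∏ k ∈ range (n + m + 2), idxSign n k) /
      (vandermonde fun k : Fin (n + m + 2) => (enumIdx n k : ℂ)).det := rfl
  rw [g1, g2, detScale]
  rw [show ∏ k ∈ range (n + m + 2), idxSign n k = (∏ k ∈ range (n + m), idxSign n k) *
    idxSign n (n + m) * idxSign n (n + m + 1) by
      rw [Finset.prod_range_succ, Finset.prod_range_succ], Finset.prod_range_succ _ (n + m)]
  rw [e2, e1] at hv2
  rw [e1] at hv1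
  rw [e2, e1]
  generalize (vandermonde fun k : Fin (n + m) => (enumIdx n k : ℂ)).det = V at *
  generalize (∏ k ∈ range (n + m), idxSign n k) = s at *
  generalize (∏ i ∈ range (n + m), ((enumIdx n (n + m) : ℂ) - enumIdx n i)) = A at *
  generalize (∏ i ∈ range (n + m + 1), ((enumIdx n (n + m + 1) : ℂ) - enumIdx n i)) = B at *
  have hV : V ≠ 0 := hv0
  have hA : A ≠ 0 := right_ne_zero_of_mul hv1
  have hB : B ≠ 0 := right_ne_zero_of_mul hv2
  generalize idxSign n (n + m) = s1 at *
  generalize idxSign n (n + m + 1) = s2 at *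
  field_simp
  have e3 : s ^ 2 = 1 := by rw [← hs0]; ring
  have e4 : s1 ^ 2 = 1 := by rw [← hs1]; ring
  simp only [e3, e4, one_mul, mul_one]
  linear_combination (n + 2 * m + 3) * (n + 2 * m + 2) * A * hs2 + hp

lemma hirota_const_mul (c : ℂ) (f : ℂ → ℂ) (x : ℂ) :
    hirota (fun y => c * f y) (fun y => c * f y) x = c ^ 2 * hirota f f x := by
  have h : deriv (fun y => c * f y) = fun y => c * deriv f y := by
    ext y
    exact deriv_const_mul_field c
  simp only [hirota, h, deriv_const_mul_field]
  ring

lemma Ux_recurrence (n m : ℕ) (a x : ℂ) :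
    Ux n m 0 a 0 x * Ux n (m + 2) 0 a 0 x =
      ((n + 2 * m + 3) ^ 2 - a * zOf x ^ 2) * Ux n (m + 1) 0 a 0 x ^ 2 +
        8 * zOf x ^ 2 * wOf x ^ 2 * hirota (Ux n (m + 1) 0 a 0) (Ux n (m + 1) 0 a 0) x := by
  have h := rowDet_enumIdx_toda a n m x
  have hc := detScale_mul_detScale n m
  rw [Ux_eq_detScale_mul n (m + 1), hirota_const_mul, Ux_eq_detScale_mul, Ux_eq_detScale_mul]
  simp only [← add_assoc]
  have h3 : (2 : ℂ) * m + 3 ≠ 0 := by exact_mod_cast (by omega : 2 * m + 3 ≠ 0)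
  have h4 : (n : ℂ) + 2 * m + 3 ≠ 0 := by exact_mod_cast (by omega : n + 2 * m + 3 ≠ 0)
  have hφ : ((2 : ℂ) * m + 3) / (n + 2 * m + 3) ≠ 0 := div_ne_zero h3 h4
  apply mul_left_cancel₀ hφ
  linear_combination (detScale n m * detScale n (m + 2)) * h -
    (((n + 2 * m + 3) ^ 2 - a * zOf x ^ 2) *
          rowDet a (enumIdx n) (n + m + 1) x ^ 2 + 8 * zOf x ^ 2 * wOf x ^ 2 *
            hirota (rowDet a (enumIdx n) (n + m + 1)) (rowDet a (enumIdx n) (n + m + 1)) x) * hc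

end Umemura

namespace Umemura

open Finset Matrix

/-! ### The chain of determinants on the rows `1, 3, …, 2o-1, 2, 4, …, 2e` -/

/-- The enumeration `1, 3, …, 2o-1, 2, 4, 6, …`. -/
def oddEvenRow (o k : ℕ) : ℕ := if k < o then 2 * k + 1 else 2 * (k - o) + 2

lemma oddEvenRow_of_lt {o k : ℕ} (h : k < o) : oddEvenRow o k = 2 * k + 1 := if_pos h

lemma oddEvenRow_add (o j : ℕ) : oddEvenRow o (o + j) = 2 * j + 2 := by
  rw [oddEvenRow, if_neg (by omega)]
  omega

lemma oddEvenRow_injective (o : ℕ) : Function.Injective (oddEvenRow o) := by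
  intro i j h
  unfold oddEvenRow at h
  split_ifs at h <;> omega

lemma oddEvenRow_pos (o k : ℕ) : 0 < oddEvenRow o k := by
  unfold oddEvenRow
  split_ifs <;> omega

lemma sum_oddEvenRow (o e : ℕ) :
    ∑ k ∈ range (o + e), (oddEvenRow o k : ℂ) = o ^ 2 + e * (e + 1) := by
  induction e with
  | zero =>
    have h : ∀ l : ℕ, ∑ k ∈ range l, (2 * (k : ℂ) + 1) = (l : ℂ) ^ 2 := by
      intro l
      induction l with
      | zero => simp
      | succ l ih => rw [Finset.sum_range_succ, ih]; push_cast; ring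
    rw [add_zero, Finset.sum_congr rfl (g := fun k : ℕ => 2 * (k : ℂ) + 1)
      (fun k hk => by rw [oddEvenRow_of_lt (Finset.mem_range.mp hk)]; push_cast; ring), h]
    simp
  | succ e ih =>
    rw [← add_assoc, Finset.sum_range_succ, ih, oddEvenRow_add]
    push_cast
    ring

lemma sum_oddEvenRow_sq (o e : ℕ) :
    ∑ k ∈ range (o + e), (oddEvenRow o k : ℂ) ^ 2 =
      o * (4 * o ^ 2 - 1) / 3 + 2 / 3 * (e * (e + 1) * (2 * e + 1)) := by
  induction e with
  | zero =>
    have h : ∀ l : ℕ, ∑ k ∈ range l, (2 * (k : ℂ) + 1) ^ 2 = (l : ℂ) * (4 * l ^ 2 - 1) / 3 := by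
      intro l
      induction l with
      | zero => simp
      | succ l ih => rw [Finset.sum_range_succ, ih]; push_cast; ring
    rw [add_zero, Finset.sum_congr rfl (g := fun k : ℕ => (2 * (k : ℂ) + 1) ^ 2)
      (fun k hk => by rw [oddEvenRow_of_lt (Finset.mem_range.mp hk)]; push_cast; ring), h]
    simp
  | succ e ih =>
    rw [← add_assoc, Finset.sum_range_succ, ih, oddEvenRow_add]
    push_cast
    ring

lemma rowDet_oddEvenRow_toda (a : ℂ) (o e : ℕ) (x : ℂ) :
    (1 - 2 * o / (2 * e + 3)) *
        (rowDet a (oddEvenRow o) (o + e) x * rowDet a (oddEvenRow o) (o + e + 2) x) =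
      -(2 * e + 2) * (((2 * e + 3) ^ 2 - a * zOf x ^ 2) *
          rowDet a (oddEvenRow o) (o + e + 1) x ^ 2 + 8 * zOf x ^ 2 * wOf x ^ 2 *
            hirota (rowDet a (oddEvenRow o) (o + e + 1))
              (rowDet a (oddEvenRow o) (o + e + 1)) x) := by
  have hlast : oddEvenRow o (o + e) = 2 * e + 2 := oddEvenRow_add o e
  -- Here `lam = 2 o`: the largest odd index `2 o - 1` is the only one below the last that leaves
  -- the set when raised by 2.
  have h := rowDet_toda a (oddEvenRow o) x (o + e) (2 * o)
    (fun k _ l _ h => oddEvenRow_injective o h) (fun k _ => oddEvenRow_pos o k) ?_ ?_ ?_ ?_ ?_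
  · rw [hlast] at h
    push_cast at h
    rw [show (2 : ℂ) * e + 2 + 1 = 2 * e + 3 by ring] at h
    rw [h]
    ring
  · intro k hk
    rcases Nat.lt_or_ge k o with h1 | h1
    · rcases Nat.lt_or_ge (k + 1) o with h2 | h2
      · refine Or.inr ⟨k + 1, by omega, ?_⟩
        rw [oddEvenRow_of_lt h2, oddEvenRow_of_lt h1]
        omega
      · left
        rw [oddEvenRow_of_lt h1, show o = k + 1 by omega]
        push_cast
        ring
    · refine Or.inr ⟨k + 1, by omega, ?_⟩
      obtain ⟨j, rfl⟩ := Nat.exists_eq_add_of_le h1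
      rw [add_assoc, oddEvenRow_add, oddEvenRow_add]
      omega
  · intro k hk
    rcases Nat.lt_or_ge k o with h1 | h1
    · rcases k with _ | k
      · left
        rw [oddEvenRow_of_lt h1]
        omega
      · right
        refine ⟨k, by omega, ?_⟩
        rw [oddEvenRow_of_lt h1, oddEvenRow_of_lt (by omega)]
        omega
    · obtain ⟨j, rfl⟩ := Nat.exists_eq_add_of_le h1
      rw [oddEvenRow_add]
      rcases j with _ | j
      · left; omega
      · right
        refine ⟨o + j, by omega, ?_⟩
        rw [oddEvenRow_add]
        omega
  · rcases o with _ | o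
    · left; simp
    · right
      exact ⟨0, by omega, by rw [oddEvenRow_of_lt (by omega)]⟩
  · rw [add_assoc, oddEvenRow_add, oddEvenRow_add]
    omega
  · rw [hlast, add_assoc o e 1, sum_oddEvenRow, sum_oddEvenRow_sq]
    push_cast
    ring

/-- The determinant with the common factors of the odd rows removed. -/
noncomputable def reducedDet (a : ℂ) (o N : ℕ) (x : ℂ) : ℂ :=
  (of fun k j : Fin N => if (k : ℕ) < o then (oddEvenRow o k : ℂ) ^ (j : ℕ)
    else rowEntry a (oddEvenRow o) x k j).det

/-- For odd `i` the coefficient `b_i` contains `\bar b_1 = 0`, so the row is `a_i z^i` times pure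
powers of `i`; the exponents `1 + 3 + … + (2o - 1)` add up to `o²`. -/
lemma rowDet_eq_reducedDet (a : ℂ) (o e : ℕ) (x : ℂ) :
    rowDet a (oddEvenRow o) (o + e) x =
      (∏ k ∈ range o, aseq a (2 * k + 1)) * zOf x ^ (o ^ 2) * reducedDet a o (o + e) x := by
  have h1 : (∏ k : Fin (o + e), if (k : ℕ) < o then aseq a (2 * k + 1) * zOf x ^ (2 * (k : ℕ) + 1)
      else 1) = (∏ k ∈ range o, aseq a (2 * k + 1)) * zOf x ^ (o ^ 2) := by
    rw [← Finset.prod_range fun k => if k < o then aseq a (2 * k + 1) * zOf x ^ (2 * k + 1) else 1,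
      Finset.prod_range_add, Finset.prod_congr rfl fun k hk => if_pos (Finset.mem_range.mp hk),
      Finset.prod_mul_distrib, Finset.prod_pow_eq_pow_sum]
    have h2 : ∀ l : ℕ, ∑ k ∈ range l, (2 * k + 1) = l ^ 2 := by
      intro l
      induction l with
      | zero => simp
      | succ l ih => rw [Finset.sum_range_succ, ih]; ring
    rw [h2, Finset.prod_eq_one (s := range e) (fun k _ => if_neg (by omega)), mul_one]
  rw [← h1, reducedDet, ← det_mul_column, rowDet]
  congr 1
  ext k j
  simp only [of_apply]
  by_cases hk : (k : ℕ) < o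
  · simp only [hk, if_true, rowEntry, rowPos, oddEvenRow_of_lt hk, rowNeg_of_odd x (2 * k + 1)
      (by omega)]
    ring
  · simp [hk]

lemma continuous_reducedDet (a : ℂ) (o N : ℕ) : Continuous (reducedDet a o N) := by
  have hz : Continuous zOf := by unfold zOf; fun_prop
  have hw : Continuous wOf := by unfold wOf; fun_prop
  refine Continuous.matrix_det (continuous_matrix fun k j => ?_)
  by_cases hk : (k : ℕ) < o
  · simp only [of_apply, hk, if_true]
    exact continuous_const
  · simp only [of_apply, hk, if_false, rowEntry, rowPos, rowNeg]
    fun_prop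

lemma aseq_zero_ne_zero_of_even (l : ℕ) : aseq 0 (2 * l) ≠ 0 := by
  induction l with
  | zero => simp [aseq_zero]
  | succ l ih =>
    rw [mul_add, mul_one, aseq_add_two]
    refine mul_ne_zero ?_ ih
    rw [zero_add]
    exact pow_ne_zero _ (Nat.cast_add_one_ne_zero _)

/-- At `x = 0` one has `z = 0` and `w = 1`. The even rows become nonzero multiples of powers of
`-i`, leaving a Vandermonde determinant at the distinct nodes `1, 3, …, -2, -4, …`. -/
lemma reducedDet_zero_ne_zero (a : ℂ) (o N : ℕ) : reducedDet a o N 0 ≠ 0 := by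
  have hz : zOf 0 = 0 := by simp [zOf]
  have hw : wOf 0 = 1 := by simp [wOf]
  have h : reducedDet a o N 0 = (∏ k : Fin N, if (k : ℕ) < o then 1 else
      (-1) ^ (oddEvenRow o k + 1) * aseq 0 (oddEvenRow o k)) *
      (vandermonde fun k : Fin N => if (k : ℕ) < o then (oddEvenRow o k : ℂ)
        else -(oddEvenRow o k : ℂ)).det := by
    rw [reducedDet, ← det_mul_column]
    congr 1
    ext k j
    by_cases hk : (k : ℕ) < o
    · simp [hk, vandermonde_apply]
    · simp [hk, vandermonde_apply, rowEntry, rowPos, rowNeg, hz, hw,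
        (oddEvenRow_pos o k).ne']
  rw [h]
  refine mul_ne_zero (Finset.prod_ne_zero_iff.mpr fun k _ => ?_) ?_
  · split_ifs with hk
    · exact one_ne_zero
    · refine mul_ne_zero (pow_ne_zero _ (by norm_num)) ?_
      rw [oddEvenRow, if_neg hk, ← Nat.mul_succ]
      exact aseq_zero_ne_zero_of_even _
  · rw [det_vandermonde_ne_zero_iff]
    intro i j hij
    have h2 : (oddEvenRow o i : ℂ) ^ 2 = (oddEvenRow o j : ℂ) ^ 2 := by
      have := congrArg (fun y => y ^ 2) hij
      simp only at this
      split_ifs at this <;> simpa using this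
    have h3 : oddEvenRow o i ^ 2 = oddEvenRow o j ^ 2 := by exact_mod_cast h2
    exact Fin.ext (oddEvenRow_injective o (Nat.pow_left_injective (n := 2) (by norm_num) h3))

lemma exists_rowDet_ne_zero (a : ℂ) (o e : ℕ) (ha : ∀ k < o, aseq a (2 * k + 1) ≠ 0) :
    ∃ x, rowDet a (oddEvenRow o) (o + e) x ≠ 0 := by
  have h1 : ∀ᶠ x in nhdsWithin (0 : ℂ) {0}ᶜ, reducedDet a o (o + e) x ≠ 0 :=
    ((continuous_reducedDet a o (o + e)).continuousAt.eventually_ne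
      (reducedDet_zero_ne_zero a o (o + e))).filter_mono nhdsWithin_le_nhds
  have h2 : ∀ᶠ x in nhdsWithin (0 : ℂ) {0}ᶜ, zOf x ≠ 0 := by
    have hd := hasDerivAt_zOf 0
    have h0 : zOf 0 = 0 := by simp [zOf]
    have := hd.eventually_ne (c := 0) (by simp [wOf])
    exact this
  obtain ⟨x, hx1, hx2⟩ := (h1.and h2).exists
  refine ⟨x, ?_⟩
  rw [rowDet_eq_reducedDet]
  exact mul_ne_zero (mul_ne_zero (Finset.prod_ne_zero_iff.mpr fun k hk =>
    ha k (Finset.mem_range.mp hk)) (pow_ne_zero _ hx2)) hx1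

lemma reducedDet_self (a : ℂ) (o : ℕ) (x : ℂ) :
    reducedDet a o o x = (vandermonde fun k : Fin o => (2 * (k : ℂ) + 1)).det := by
  rw [reducedDet]
  congr 1
  ext k j
  simp [vandermonde_apply, oddEvenRow_of_lt k.2]

lemma prod_odd_shift (o : ℕ) : ∏ i ∈ range o, (-2 - (2 * (i : ℂ) + 1)) =
    (1 - 4 * o ^ 2) * ∏ i ∈ range o, (2 - (2 * (i : ℂ) + 1)) := by
  induction o with
  | zero => simp
  | succ o ih =>
    rw [Finset.prod_range_succ, Finset.prod_range_succ, ih]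
    push_cast
    ring

/-- The single even row mixes the powers of `2` and of `-2`, hence two Vandermonde determinants with
ratio `1 - 4 o²`. This supplies the first link of the chain, which `rowDet_oddEvenRow_toda` does not
reach. -/
lemma reducedDet_succ_self (a : ℂ) (o : ℕ) (x : ℂ) :
    reducedDet a o (o + 1) x = -(∏ i ∈ range o, (2 - (2 * (i : ℂ) + 1))) *
      ((1 - 4 * o ^ 2) * wOf x ^ 2 - (a + 1) * zOf x ^ 2) * reducedDet a o o x := by
  have hv : ∀ c : ℂ, (vandermonde fun k : Fin (o + 1) =>
      (fun i : ℕ => if i < o then 2 * (i : ℂ) + 1 else c) k).det =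
      reducedDet a o o x * ∏ i ∈ range o, (c - (2 * (i : ℂ) + 1)) := by
    intro c
    rw [det_vandermonde_eq_prod_range (fun i : ℕ => if i < o then 2 * (i : ℂ) + 1 else c),
      Finset.prod_range_succ, ← det_vandermonde_eq_prod_range, reducedDet_self]
    congr 1
    · congr 2
      ext k
      simp
    · exact Finset.prod_congr rfl fun i hi => by simp [Finset.mem_range.mp hi]
  have hA : rowPos a x 2 = zOf x ^ 2 * (a + 1) := by
    have := rowPos_add_two a x 0
    rw [zero_add] at this
    rw [this, rowPos, aseq_zero]
    push_cast
    ring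
  have hB : rowNeg x 2 = - wOf x ^ 2 := by
    have := rowNeg_add_two x 0
    rw [zero_add] at this
    rw [this, rowNeg, aseq_zero]
    push_cast
    ring
  set V : ℂ → Matrix (Fin (o + 1)) (Fin (o + 1)) ℂ := fun c => vandermonde fun k =>
      (fun i : ℕ => if i < o then 2 * (i : ℂ) + 1 else c) k with hV
  have hrow : ∀ c j, V c (Fin.last o) j = c ^ (j : ℕ) := by
    intro c j
    simp [hV, vandermonde_apply]
  have h : reducedDet a o (o + 1) x = ((V 2).updateRow (Fin.last o)
      (rowPos a x 2 • V 2 (Fin.last o) + rowNeg x 2 • V (-2) (Fin.last o))).det := by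
    rw [reducedDet]
    congr 1
    ext k j
    by_cases hk : k = Fin.last o
    · subst hk
      have h2 := oddEvenRow_add o 0
      rw [add_zero, mul_zero, zero_add] at h2
      simp [hrow, rowEntry, h2]
    · have hk' : (k : ℕ) < o :=
        lt_of_le_of_ne (Nat.lt_succ_iff.mp k.2) fun hh => hk (Fin.ext hh)
      simp [hk, hk', hV, vandermonde_apply, oddEvenRow_of_lt hk']
  have hupd : ∀ c, (V 2).updateRow (Fin.last o) (V c (Fin.last o)) = V c := by
    intro c
    ext k j
    by_cases hk : k = Fin.last o
    · subst hk
      simp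
    · have hk' : (k : ℕ) < o :=
        lt_of_le_of_ne (Nat.lt_succ_iff.mp k.2) fun hh => hk (Fin.ext hh)
      simp [hk, hk', hV, vandermonde_apply]
  rw [h, det_updateRow_add, det_updateRow_smul, det_updateRow_smul, hupd, hupd, hv, hv, hA, hB,
    prod_odd_shift]
  ring

lemma exists_rowDet_eq_mul (a : ℂ) (v v' : ℕ → ℕ) (N : ℕ) (hv : Function.Injective v)
    (h : ∀ k < N, ∃ l < N, v k = v' l) :
    ∃ s : ℂ, s ≠ 0 ∧ ∀ x, rowDet a v N x = s * rowDet a v' N x := by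
  have h' : ∀ k : Fin N, ∃ l : Fin N, v k = v' l := fun k =>
    let ⟨l, hl, hkl⟩ := h k k.2
    ⟨⟨l, hl⟩, hkl⟩
  choose σ hσ using h'
  have hinj : Function.Injective σ := by
    intro i j hij
    have := hσ i
    rw [hij, ← hσ j] at this
    exact Fin.ext (hv this)
  set τ : Equiv.Perm (Fin N) := Equiv.ofBijective σ (Finite.injective_iff_bijective.mp hinj)
  refine ⟨((Equiv.Perm.sign τ : ℤ) : ℂ), ?_, fun x => ?_⟩
  · exact_mod_cast (Equiv.Perm.sign τ).ne_zero
  · rw [rowDet, rowDet, ← det_permute]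
    congr 1
    ext k j
    simp only [of_apply, submatrix_apply, rowEntry, id]
    rw [hσ k]
    rfl

/-- `[n;m]` consists of the first `o` odd and the first `e` even numbers. Enlarging `m` appends even
rows when `n` is even but odd rows when `n` is odd; after reordering, both cases belong to chains in
which only `e` grows. -/
lemma exists_Ux_eq_mul_rowDet (n m o e : ℕ) (a : ℂ)
    (hoe : (n = 2 * o ∧ e = o + m) ∨ (n = 2 * e + 1 ∧ o = e + 1 + m)) :
    ∃ s : ℂ, s ≠ 0 ∧ ∀ x, Ux n m 0 a 0 x = s * rowDet a (oddEvenRow o) (o + e) x := by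
  have hN : n + m = o + e := by omega
  obtain ⟨s, hs, h⟩ := exists_rowDet_eq_mul a (enumIdx n) (oddEvenRow o) (n + m)
    (enumIdx_strictMono n).injective (by
      intro k hk
      refine ⟨if enumIdx n k % 2 = 1 then enumIdx n k / 2 else o + enumIdx n k / 2 - 1, ?_, ?_⟩
      · unfold enumIdx
        split_ifs <;> omega
      · unfold enumIdx oddEvenRow
        split_ifs <;> omega)
  refine ⟨detScale n m * s, mul_ne_zero (detScale_ne_zero n m) hs, fun x => ?_⟩
  rw [Ux_eq_detScale_mul, ← hN, mul_assoc, ← h]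

end Umemura

namespace Umemura

open Filter Topology

/-! ### A Bäcklund transformation of the Painlevé–Okamoto equation with a vanishing parameter -/

/-- The combination `2 h - (2 t - 1) h'`. -/
noncomputable def okamotoN (h : ℂ → ℂ) (t : ℂ) : ℂ := 2 * h t - (2 * t - 1) * deriv h t

/-- `h` and `h + R` are neighbours in a chain of solutions of `E_VI` whose parameters
`b_1, b_2` have squares `p, s` and whose last parameter moves from `β` to `β + 1`. -/
structure BacklundPair (p s β : ℂ) (h R : ℂ → ℂ) (t : ℂ) : Prop where
  second_deriv : t * (t - 1) * deriv (deriv h) t =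
    2 * (deriv h t + β ^ 2) * R t - β * okamotoN h t
  quadric : 4 * (deriv h t + β ^ 2) * R t ^ 2 - 4 * β * R t * okamotoN h t + okamotoN h t ^ 2 =
    (deriv h t + p) * (deriv h t + s)
  riccati : t * (t - 1) * deriv R t = (2 * t - 1) / 2 * okamotoN h t +
    (2 * deriv h t + p + s) / 4 - R t ^ 2 - β * (2 * t - 1) * R t

/-- Expanding the square of `second_deriv` and adding `h' N²` gives `h' + β²` times the left side of
`quadric`. -/
lemma BacklundPair.okamoto {p s β : ℂ} {h R : ℂ → ℂ} {t : ℂ} (H : BacklundPair p s β h R t) :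
    (t * (t - 1) * deriv (deriv h) t) ^ 2 + deriv h t * okamotoN h t ^ 2 =
      (deriv h t + p) * (deriv h t + s) * (deriv h t + β ^ 2) := by
  rw [H.second_deriv, ← H.quadric]
  ring

lemma hasDerivAt_of_mem {G : Set ℂ} (hG : IsOpen G)
    {f : ℂ → ℂ} (hf : DifferentiableOn ℂ f G) {t : ℂ} (ht : t ∈ G) :
    HasDerivAt f (deriv f t) t := (hf.differentiableAt (hG.mem_nhds ht)).hasDerivAt

lemma hasDerivAt_okamotoN {G : Set ℂ} (hG : IsOpen G)
    {h : ℂ → ℂ} (hh : DifferentiableOn ℂ h G) {t : ℂ} (ht : t ∈ G) :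
    HasDerivAt (okamotoN h) (-(2 * t - 1) * deriv (deriv h) t) t := by
  have h1 := hasDerivAt_of_mem hG hh ht
  have h2 := hasDerivAt_of_mem hG (hh.deriv hG) ht
  have := (h1.const_mul 2).fun_sub ((((hasDerivAt_id t).const_mul 2).sub_const 1).fun_mul h2)
  refine this.congr_deriv ?_
  simp only [id]
  ring

lemma deriv_add_of_mem {G : Set ℂ} (hG : IsOpen G)
    {f g : ℂ → ℂ} (hf : DifferentiableOn ℂ f G) (hg : DifferentiableOn ℂ g G)
    {t : ℂ} (ht : t ∈ G) : deriv (fun y => f y + g y) t = deriv f t + deriv g t :=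
  ((hasDerivAt_of_mem hG hf ht).fun_add (hasDerivAt_of_mem hG hg ht)).deriv

lemma deriv_deriv_add_of_mem {G : Set ℂ} (hG : IsOpen G)
    {f g : ℂ → ℂ} (hf : DifferentiableOn ℂ f G)
    (hg : DifferentiableOn ℂ g G) {t : ℂ} (ht : t ∈ G) :
    deriv (deriv fun y => f y + g y) t = deriv (deriv f) t + deriv (deriv g) t := by
  have h1 : deriv (fun y => f y + g y) =ᶠ[𝓝 t] fun y => deriv f y + deriv g y := by
    filter_upwards [hG.mem_nhds ht] with y hy using deriv_add_of_mem hG hf hg hy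
  rw [h1.deriv_eq, deriv_add_of_mem hG (hf.deriv hG) (hg.deriv hG) ht]

/-- Differentiating `riccati` and subtracting `second_deriv` gives the mirror image of
`second_deriv`: seen from `h + R`, it holds with `-R` and `-(β + 1)`. -/
lemma BacklundPair.second_deriv_add {G : Set ℂ} (hG : IsOpen G)
    {p s β : ℂ} {h R : ℂ → ℂ} (hh : DifferentiableOn ℂ h G)
    (hR : DifferentiableOn ℂ R G)
    (H : ∀ t ∈ G, BacklundPair p s β h R t) {t : ℂ} (ht : t ∈ G) :
    t * (t - 1) * deriv (deriv fun y => h y + R y) t =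
      (β + 1) * okamotoN (fun y => h y + R y) t -
        2 * (deriv (fun y => h y + R y) t + (β + 1) ^ 2) * R t := by
  rw [deriv_deriv_add_of_mem hG hh hR ht, okamotoN, deriv_add_of_mem hG hh hR ht]
  have hr2 : (2 * t - 1) * deriv R t + t * (t - 1) * deriv (deriv R) t =
      okamotoN h t - (2 * t - 1) / 2 * ((2 * t - 1) * deriv (deriv h) t) +
        deriv (deriv h) t / 2 - 2 * R t * deriv R t - 2 * β * R t -
          β * (2 * t - 1) * deriv R t := by
    have h1 := hasDerivAt_of_mem hG (hR.deriv hG) ht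
    have h2 := hasDerivAt_of_mem hG hR ht
    have h3 := hasDerivAt_of_mem hG (hh.deriv hG) ht
    have hid := hasDerivAt_id t
    have hl := (hid.fun_mul (hid.sub_const 1)).fun_mul h1
    have hr := ((((((hid.const_mul 2).sub_const 1).div_const 2).fun_mul
      (hasDerivAt_okamotoN hG hh ht)).fun_add
      ((((h3.const_mul 2).add_const p).add_const s).div_const 4)).fun_sub (h2.fun_pow 2)).fun_sub
      ((((hid.const_mul 2).sub_const 1).const_mul β).fun_mul h2)
    have heq := hl.unique (hr.congr_of_eventuallyEq (by
      filter_upwards [hG.mem_nhds ht] with y hy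
      simpa using (H y hy).riccati))
    simp only [id] at heq
    linear_combination heq
  have hA := (H t ht).second_deriv
  rw [okamotoN] at hA hr2
  linear_combination hr2 - hA

/-- The mirror image of `quadric`; the two differ by `4 R'` times the Riccati relation. -/
lemma BacklundPair.quadric_add {G : Set ℂ} (hG : IsOpen G)
    {p s β : ℂ} {h R : ℂ → ℂ} (hh : DifferentiableOn ℂ h G)
    (hR : DifferentiableOn ℂ R G) {t : ℂ} (ht : t ∈ G) (H : BacklundPair p s β h R t) :
    4 * (deriv (fun y => h y + R y) t + (β + 1) ^ 2) * R t ^ 2 -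
        4 * (β + 1) * R t * okamotoN (fun y => h y + R y) t +
        okamotoN (fun y => h y + R y) t ^ 2 =
      (deriv (fun y => h y + R y) t + p) * (deriv (fun y => h y + R y) t + s) := by
  have hB := H.quadric
  have hC := H.riccati
  rw [okamotoN] at hB hC ⊢
  rw [deriv_add_of_mem hG hh hR ht]
  linear_combination hB + 4 * deriv R t * hC

/-- Comparing the Toda equation with `second_deriv_add` shows that `R'` and `R` are the two roots of
the quadric attached to `h + R`: their sum is `(β + 1) N / (h' + (β + 1)²)`, with `N` and `h'` taken
for `h + R`. Differentiating this sum relation gives the Riccati relation for `R'`. -/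
lemma BacklundPair.step {G : Set ℂ} (hG : IsOpen G)
    {p s β : ℂ} {h R R' : ℂ → ℂ} (hh : DifferentiableOn ℂ h G)
    (hR : DifferentiableOn ℂ R G) (hR' : DifferentiableOn ℂ R' G)
    (H : ∀ t ∈ G, BacklundPair p s β h R t)
    (hQ : ∀ t ∈ G, deriv (fun y => h y + R y) t + (β + 1) ^ 2 ≠ 0)
    (htoda : ∀ t ∈ G, t * (t - 1) * deriv (deriv fun y => h y + R y) t =
      (deriv (fun y => h y + R y) t + (β + 1) ^ 2) * (R' t - R t)) {t : ℂ} (ht : t ∈ G) :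
    BacklundPair p s (β + 1) (fun y => h y + R y) R' t := by
  have hsec : ∀ t ∈ G, _ := fun t ht => BacklundPair.second_deriv_add hG hh hR H ht
  have hquad := BacklundPair.quadric_add hG hh hR ht (H t ht)
  have hC := (H t ht).riccati
  have hp : DifferentiableOn ℂ (fun y => h y + R y) G := hh.fun_add hR
  have hprod : ∀ t ∈ G, (deriv (fun y => h y + R y) t + (β + 1) ^ 2) * R' t =
      (β + 1) * okamotoN (fun y => h y + R y) t -
        (deriv (fun y => h y + R y) t + (β + 1) ^ 2) * R t := by
    intro t ht
    linear_combination hsec t ht - htoda t ht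
  have hder : (deriv (deriv fun y => h y + R y) t) * R' t +
      (deriv (fun y => h y + R y) t + (β + 1) ^ 2) * deriv R' t =
      -(β + 1) * ((2 * t - 1) * (deriv (deriv fun y => h y + R y) t)) -
        ((deriv (deriv fun y => h y + R y) t) * R t +
          (deriv (fun y => h y + R y) t + (β + 1) ^ 2) * deriv R t) := by
    have h1 := (hasDerivAt_of_mem hG (hp.deriv hG) ht).add_const ((β + 1) ^ 2)
    have hl := h1.fun_mul (hasDerivAt_of_mem hG hR' ht)
    have hr := ((hasDerivAt_okamotoN hG hp ht).const_mul (β + 1)).fun_sub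
      (h1.fun_mul (hasDerivAt_of_mem hG hR ht))
    have heq := hl.unique (hr.congr_of_eventuallyEq (by
      filter_upwards [hG.mem_nhds ht] with y hy using hprod y hy))
    linear_combination heq
  have hpr := hprod t ht
  have hto := htoda t ht
  have hse := hsec t ht
  have hQt := hQ t ht
  have hN : okamotoN (fun y => h y + R y) t =
      okamotoN h t + 2 * R t - (2 * t - 1) * deriv R t := by
    rw [okamotoN, okamotoN, deriv_add_of_mem hG hh hR ht]
    ring
  refine ⟨?_, ?_, ?_⟩
  · linear_combination hse - 2 * hpr
  · rw [← hquad]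
    linear_combination 4 * (R' t - R t) * hpr
  · apply mul_left_cancel₀ hQt
    have hd1 := deriv_add_of_mem hG hh hR ht
    rw [hN]
    generalize deriv (deriv fun y => h y + R y) t = d2 at *
    generalize hq : deriv (fun y => h y + R y) t = d1 at *
    have e1 : d1 - deriv h t - deriv R t = 0 := by rw [hd1]; ring
    linear_combination t * (t - 1) * hder - (R' t + R t + (β + 1) * (2 * t - 1)) * hto +
      (d1 + (β + 1) ^ 2) * hC - (d1 + (β + 1) ^ 2) / 2 * e1

/-- If the next solution has vanishing second derivative, so has the present one. -/
lemma BacklundPair.second_deriv_eq_zero {G : Set ℂ} (hG : IsOpen G)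
    {p s β : ℂ} {h R : ℂ → ℂ} (hh : DifferentiableOn ℂ h G)
    (hR : DifferentiableOn ℂ R G)
    (H : ∀ t ∈ G, BacklundPair p s β h R t)
    (hQ : ∀ t ∈ G, deriv (fun y => h y + R y) t + (β + 1) ^ 2 ≠ 0)
    (hzero : ∀ t ∈ G, deriv (deriv fun y => h y + R y) t = 0) :
    ∀ t ∈ G, deriv (deriv h) t = 0 := by
  have hp : DifferentiableOn ℂ (fun y => h y + R y) G := hh.fun_add hR
  -- If `h + R` has zero second derivative, `second_deriv_add` equates `R` times the locally
  -- constant `2(h' + (β + 1)²)` with a locally constant function.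
  have hR1 : ∀ t ∈ G, deriv R t = 0 := by
    intro t ht
    have h1 := (hasDerivAt_of_mem hG (hp.deriv hG) ht).add_const ((β + 1) ^ 2)
    have hl := (h1.fun_mul (hasDerivAt_of_mem hG hR ht)).const_mul 2
    have hr := (hasDerivAt_okamotoN hG hp ht).const_mul (β + 1)
    have heq := hl.unique (hr.congr_of_eventuallyEq (by
      filter_upwards [hG.mem_nhds ht] with y hy
      have := BacklundPair.second_deriv_add hG hh hR H hy
      rw [hzero y hy] at this
      linear_combination this))
    rw [hzero t ht] at heq
    have h2 : (deriv (fun y => h y + R y) t + (β + 1) ^ 2) * deriv R t = 0 := by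
      linear_combination heq / 2
    exact (mul_eq_zero.mp h2).resolve_left (hQ t ht)
  intro t ht
  have h1 := deriv_deriv_add_of_mem hG hh hR ht
  have h2 : deriv (deriv R) t = 0 := by
    have : deriv R =ᶠ[𝓝 t] fun _ => 0 := by
      filter_upwards [hG.mem_nhds ht] with y hy using hR1 y hy
    rw [this.deriv_eq]
    simp
  rw [hzero t ht, h2, add_zero] at h1
  exact h1.symm

end Umemura

namespace Umemura

open Filter Topology

/-! ### The change of variables `e^{2x} = t / (t - 1)` -/

lemma ne_zero_and_ne_one_of_exp {X t : ℂ} (h : Complex.exp (2 * X) = t / (t - 1)) :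
    t ≠ 0 ∧ t ≠ 1 := by
  constructor
  · rintro rfl
    exact Complex.exp_ne_zero _ (h.trans (by simp))
  · rintro rfl
    exact Complex.exp_ne_zero _ (h.trans (by simp))

/-- These are `2t - 1 = coth X` and its square, with `sinh X = 2zw` and `cosh X = z² + w²`. -/
lemma zOf_wOf_of_exp {X t : ℂ} (h : Complex.exp (2 * X) = t / (t - 1)) :
    16 * (t * (t - 1)) * (zOf X ^ 2 * wOf X ^ 2) = 1 ∧
      (2 * t - 1) * (2 * (zOf X * wOf X)) = zOf X ^ 2 + wOf X ^ 2 := by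
  obtain ⟨h0, h1⟩ := ne_zero_and_ne_one_of_exp h
  have h1' : t - 1 ≠ 0 := sub_ne_zero.mpr h1
  have e1 : Complex.exp (2 * X) = Complex.exp (X / 2) ^ 4 := by
    rw [← Complex.exp_nat_mul]
    congr 1
    push_cast
    ring
  have hE : Complex.exp (X / 2) ≠ 0 := Complex.exp_ne_zero _
  rw [e1, eq_div_iff h1'] at h
  rw [zOf, wOf, Complex.sinh, Complex.cosh, Complex.exp_neg]
  generalize Complex.exp (X / 2) = E at *
  constructor
  · field_simp
    have e2 : (E ^ 2 - 1) ^ 2 * (E ^ 2 + 1) ^ 2 = (E ^ 4 - 1) ^ 2 := by ring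
    have e3 : (E ^ 4 - 1) * (t - 1) = 1 := by linear_combination h
    have e4 : (t - 1) * (16 * (t * (t - 1)) * ((E ^ 2 - 1) ^ 2 * (E ^ 2 + 1) ^ 2) -
        16 * E ^ 4) = 0 := by
      rw [e2]
      linear_combination 16 * t * ((E ^ 4 - 1) * (t - 1) + 1) * e3 - 16 * h
    have e5 := (mul_eq_zero.mp e4).resolve_left h1'
    linear_combination e5
  · field_simp
    linear_combination 4 * h

section Branch

variable {Ω : Set ℂ} {x : ℂ → ℂ}

lemma hasDerivAt_branch (hΩ : IsOpen Ω) (hx : DifferentiableOn ℂ x Ω)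
    (hexp : ∀ t ∈ Ω, Complex.exp (2 * x t) = t / (t - 1)) {t : ℂ} (ht : t ∈ Ω) :
    HasDerivAt x (-8 * (zOf (x t) ^ 2 * wOf (x t) ^ 2)) t := by
  have h1 := hasDerivAt_of_mem hΩ hx ht
  obtain ⟨h0, hone⟩ := ne_zero_and_ne_one_of_exp (hexp t ht)
  have h1' : t - 1 ≠ 0 := sub_ne_zero.mpr hone
  have hl := (h1.const_mul 2).cexp
  have hr := (hasDerivAt_id t).fun_div ((hasDerivAt_id t).sub_const 1) h1'
  have heq := hl.unique (hr.congr_of_eventuallyEq (by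
    filter_upwards [hΩ.mem_nhds ht] with y hy using hexp y hy))
  rw [hexp t ht] at heq
  simp only [id] at heq
  have hz := (zOf_wOf_of_exp (hexp t ht)).1
  refine h1.congr_deriv ?_
  have h3 : deriv x t * (2 * (t * (t - 1))) = -1 := by
    field_simp at heq
    have h4 : deriv x t * (2 * (t * (t - 1))) = t - 1 - t := by linear_combination heq
    rw [h4]
    ring
  have h4 : 2 * (t * (t - 1)) ≠ 0 := by simp [h0, h1']
  apply mul_right_cancel₀ h4
  rw [h3]
  linear_combination hz

/-- As `dx/dt ≠ 0`, `x` is locally open: zeros of `F ∘ x` filling a neighbourhood would make `F`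
vanish on an open set, hence everywhere. -/
lemma eventually_comp_ne_zero (hΩ : IsOpen Ω) (hx : DifferentiableOn ℂ x Ω)
    (hexp : ∀ t ∈ Ω, Complex.exp (2 * x t) = t / (t - 1)) {F : ℂ → ℂ} (hF : Differentiable ℂ F)
    (hne : ∃ y, F y ≠ 0) {t : ℂ} (ht : t ∈ Ω) : ∀ᶠ y in 𝓝[≠] t, F (x y) ≠ 0 := by
  have hxa : AnalyticAt ℂ x t := hx.analyticAt (hΩ.mem_nhds ht)
  have ha : AnalyticAt ℂ (fun y => F (x y)) t := (hF.analyticAt (x t)).comp hxa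
  rcases ha.eventually_eq_zero_or_eventually_ne_zero with h | h
  · exfalso
    have hd := hasDerivAt_branch hΩ hx hexp ht
    have hz := (zOf_wOf_of_exp (hexp t ht)).1
    have hd0 : deriv x t ≠ 0 := by
      rw [hd.deriv]
      intro h0
      have : zOf (x t) ^ 2 * wOf (x t) ^ 2 = 0 := by linear_combination (-1 / 8 : ℂ) * h0
      rw [this] at hz
      simp at hz
    have hmap := hxa.hasStrictDerivAt.map_nhds_eq hd0
    have h2 : ∀ᶠ y in 𝓝 (x t), F y = 0 := by
      rw [← hmap]
      exact h
    obtain ⟨y, hy⟩ := hne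
    have h3 : F = fun _ => 0 := AnalyticOnNhd.eq_of_eventuallyEq
      (fun z _ => hF.analyticAt z) (fun z _ => analyticAt_const) h2
    exact hy (congrFun h3 y)
  · exact h

lemma zOf_wOf_ne_zero (hexp : ∀ t ∈ Ω, Complex.exp (2 * x t) = t / (t - 1)) {t : ℂ}
    (ht : t ∈ Ω) : zOf (x t) ≠ 0 ∧ wOf (x t) ≠ 0 := by
  have hz := (zOf_wOf_of_exp (hexp t ht)).1
  constructor <;> intro h0 <;> simp [h0] at hz

/-- In the variable `x` the operator `t (t - 1) d/dt` is `-(1/2) d/dx`. -/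
lemma auxHam_eq (hΩ : IsOpen Ω) (hx : DifferentiableOn ℂ x Ω)
    (hexp : ∀ t ∈ Ω, Complex.exp (2 * x t) = t / (t - 1)) {F : ℂ → ℂ} (hF : Differentiable ℂ F)
    (b₁ : ℂ) {t : ℂ} (ht : t ∈ Ω) :
    auxHam (fun y => F (x y)) (h0 b₁ 0 x) t =
      -(deriv F (x t) / F (x t)) / 2 - b₁ ^ 2 * (zOf (x t) / wOf (x t)) / 4 := by
  have hd := (hF (x t)).hasDerivAt.comp t (hasDerivAt_branch hΩ hx hexp ht)
  have hz := (zOf_wOf_of_exp (hexp t ht)).1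
  have hl : deriv (fun y => F (x y)) t =
      deriv F (x t) * (-8 * (zOf (x t) ^ 2 * wOf (x t) ^ 2)) := hd.deriv
  rw [auxHam, h0, logDeriv_apply, hl]
  linear_combination (-(deriv F (x t) / F (x t)) / 2) * hz

lemma hasDerivAt_auxHam (hΩ : IsOpen Ω) (hx : DifferentiableOn ℂ x Ω)
    (hexp : ∀ t ∈ Ω, Complex.exp (2 * x t) = t / (t - 1)) {F : ℂ → ℂ} (hF : Differentiable ℂ F)
    (b₁ : ℂ) {t : ℂ} (ht : t ∈ Ω) (hFt : F (x t) ≠ 0) :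
    HasDerivAt (auxHam (fun y => F (x y)) (h0 b₁ 0 x))
      (4 * (zOf (x t) ^ 2 * wOf (x t) ^ 2) *
        (deriv (deriv F) (x t) * F (x t) - deriv F (x t) ^ 2) / F (x t) ^ 2 +
        b₁ ^ 2 * zOf (x t) ^ 2) t := by
  have hF2 : DifferentiableAt ℂ (deriv F) (x t) := (hF.analyticAt (x t)).deriv.differentiableAt
  obtain ⟨hz, hw⟩ := zOf_wOf_ne_zero hexp ht
  have h1 := ((((hF2.hasDerivAt.fun_div (hF (x t)).hasDerivAt hFt).fun_neg).div_const 2).fun_sub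
    ((((hasDerivAt_zOf (x t)).fun_div (hasDerivAt_wOf (x t)) hw).const_mul (b₁ ^ 2)).div_const 4))
  have h2 := h1.comp t (hasDerivAt_branch hΩ hx hexp ht)
  refine (h2.congr_of_eventuallyEq ?_).congr_deriv ?_
  · filter_upwards [hΩ.mem_nhds ht] with y hy
    exact auxHam_eq hΩ hx hexp hF b₁ hy
  · have hw2 := wOf_sq (x t)
    field_simp
    linear_combination 8 * b₁ ^ 2 * F (x t) ^ 2 * hw2

/-! ### The chain of solutions -/

/-- The functions `u_{-1} = u_0, u_0, u_1, …` of `t`. -/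
noncomputable def chainU (a : ℂ) (o : ℕ) (x : ℂ → ℂ) (j : ℕ) (t : ℂ) : ℂ :=
  rowDet a (oddEvenRow o) (o + (j - 1)) (x t)

/-- The auxiliary Hamiltonians of the functions `chainU`. -/
noncomputable def chainH (b₁ : ℂ) (o : ℕ) (x : ℂ → ℂ) (j : ℕ) : ℂ → ℂ :=
  auxHam (chainU (-4 * b₁ ^ 2) o x j) (h0 b₁ 0 x)

lemma hasDerivAt_chainH (hΩ : IsOpen Ω) (hx : DifferentiableOn ℂ x Ω)
    (hexp : ∀ t ∈ Ω, Complex.exp (2 * x t) = t / (t - 1)) (b₁ : ℂ) (o j : ℕ) {t : ℂ}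
    (ht : t ∈ Ω) (hu : chainU (-4 * b₁ ^ 2) o x j t ≠ 0) :
    HasDerivAt (chainH b₁ o x j) (4 * (zOf (x t) ^ 2 * wOf (x t) ^ 2) *
        (deriv (deriv (rowDet (-4 * b₁ ^ 2) (oddEvenRow o) (o + (j - 1)))) (x t) *
          rowDet (-4 * b₁ ^ 2) (oddEvenRow o) (o + (j - 1)) (x t) -
          deriv (rowDet (-4 * b₁ ^ 2) (oddEvenRow o) (o + (j - 1))) (x t) ^ 2) /
          rowDet (-4 * b₁ ^ 2) (oddEvenRow o) (o + (j - 1)) (x t) ^ 2 +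
        b₁ ^ 2 * zOf (x t) ^ 2) t :=
  hasDerivAt_auxHam hΩ hx hexp (differentiable_rowDet _ _ _) b₁ ht hu

/-- The seed is a constant times `z^(o²)`, whose logarithmic derivative in `x` is `o² w / (2z)`. -/
lemma chainH_zero_eq (hΩ : IsOpen Ω) (hx : DifferentiableOn ℂ x Ω)
    (hexp : ∀ t ∈ Ω, Complex.exp (2 * x t) = t / (t - 1)) (b₁ : ℂ) (o : ℕ) {t : ℂ}
    (ht : t ∈ Ω) (hu : chainU (-4 * b₁ ^ 2) o x 0 t ≠ 0) :
    chainH b₁ o x 0 t = -((o : ℂ) ^ 2 * (wOf (x t) / zOf (x t)) +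
      b₁ ^ 2 * (zOf (x t) / wOf (x t))) / 4 := by
  obtain ⟨hz, hw⟩ := zOf_wOf_ne_zero hexp ht
  set F := rowDet (-4 * b₁ ^ 2) (oddEvenRow o) o with hF
  have hFz : ∀ y, F y = (F (x t) / zOf (x t) ^ (o ^ 2)) * zOf y ^ (o ^ 2) := by
    intro y
    have h1 : ∀ y, F y = _ := fun y => rowDet_eq_reducedDet (-4 * b₁ ^ 2) o 0 y
    simp only [add_zero, reducedDet_self] at h1
    have hzp : zOf (x t) ^ (o ^ 2) ≠ 0 := pow_ne_zero _ hz
    rw [h1 (x t), h1 y]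
    field_simp
  have hFt : F (x t) ≠ 0 := hu
  have hd : deriv F (x t) = F (x t) * ((o : ℂ) ^ 2 * (wOf (x t) / zOf (x t)) / 2) := by
    have h1 : F = fun y => (F (x t) / zOf (x t) ^ (o ^ 2)) * zOf y ^ (o ^ 2) := funext hFz
    have h2 := (((hasDerivAt_zOf (x t)).fun_pow (o ^ 2)).const_mul (F (x t) / zOf (x t) ^ (o ^ 2)))
    rw [← h1] at h2
    rw [h2.deriv]
    rcases Nat.eq_zero_or_pos (o ^ 2) with h0 | h0
    · have : (o : ℂ) ^ 2 = 0 := by exact_mod_cast h0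
      rw [h0, this]
      simp
    · obtain ⟨q, hq⟩ := Nat.exists_eq_succ_of_ne_zero h0.ne'
      have : (o : ℂ) ^ 2 = q + 1 := by exact_mod_cast hq
      rw [hq, this]
      simp only [Nat.succ_eq_add_one, Nat.add_sub_cancel]
      push_cast
      field_simp
      ring
  have h := auxHam_eq hΩ hx hexp (differentiable_rowDet (-4 * b₁ ^ 2) (oddEvenRow o) o) b₁ ht
  rw [← hF, hd] at h
  have h' : chainH b₁ o x 0 t = auxHam (fun y => F (x y)) (h0 b₁ 0 x) t := rfl
  rw [h', h, mul_div_cancel_left₀ _ hFt]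
  ring

end Branch

end Umemura

/-! ### The Toda equation in `t` and the Bäcklund relations along the chain -/

namespace Umemura

open Filter Topology

section Chain

variable {Ω : Set ℂ} {x : ℂ → ℂ}

/-- The points of `Ω` at which the first members of the chain do not vanish. -/
def goodSet (Ω : Set ℂ) (x : ℂ → ℂ) (a : ℂ) (o J : ℕ) : Set ℂ :=
  {t | t ∈ Ω ∧ ∀ j ≤ J + 1, chainU a o x j t ≠ 0}

lemma differentiableOn_chainU (hx : DifferentiableOn ℂ x Ω) (a : ℂ) (o j : ℕ) :
    DifferentiableOn ℂ (chainU a o x j) Ω :=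
  (differentiable_rowDet a (oddEvenRow o) (o + (j - 1))).comp_differentiableOn hx

lemma isOpen_goodSet (hΩ : IsOpen Ω) (hx : DifferentiableOn ℂ x Ω) (a : ℂ) (o J : ℕ) :
    IsOpen (goodSet Ω x a o J) := by
  rw [isOpen_iff_mem_nhds]
  rintro t ⟨ht, hj⟩
  have h1 : ∀ᶠ y in 𝓝 t, ∀ j ∈ Set.Iic (J + 1), chainU a o x j y ≠ 0 :=
    (eventually_all_finite (Set.finite_Iic (J + 1))).mpr fun j hjJ =>
      ((differentiableOn_chainU hx a o j).differentiableAt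
        (hΩ.mem_nhds ht)).continuousAt.eventually_ne (hj j hjJ)
  filter_upwards [hΩ.mem_nhds ht, h1] with y hy hy1 using ⟨hy, fun j hjJ => hy1 j hjJ⟩

lemma eventually_mem_goodSet (hΩ : IsOpen Ω) (hx : DifferentiableOn ℂ x Ω)
    (hexp : ∀ t ∈ Ω, Complex.exp (2 * x t) = t / (t - 1)) (a : ℂ) (o J : ℕ)
    (ha : ∀ k < o, aseq a (2 * k + 1) ≠ 0) {t : ℂ} (ht : t ∈ Ω) :
    ∀ᶠ y in 𝓝[≠] t, y ∈ goodSet Ω x a o J := by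
  have h1 : ∀ᶠ y in 𝓝[≠] t, ∀ j ∈ Set.Iic (J + 1), chainU a o x j y ≠ 0 :=
    (eventually_all_finite (Set.finite_Iic (J + 1))).mpr fun j _ =>
      eventually_comp_ne_zero hΩ hx hexp (differentiable_rowDet a (oddEvenRow o) (o + (j - 1)))
        (exists_rowDet_ne_zero a o (j - 1) ha) ht
  filter_upwards [mem_nhdsWithin_of_mem_nhds (hΩ.mem_nhds ht), h1] with y hy hy1
    using ⟨hy, fun j hjJ => hy1 j hjJ⟩

lemma hasDerivAt_chainH_zero (hΩ : IsOpen Ω) (hx : DifferentiableOn ℂ x Ω)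
    (hexp : ∀ t ∈ Ω, Complex.exp (2 * x t) = t / (t - 1)) (b₁ : ℂ) (o : ℕ) {t : ℂ}
    (ht : t ∈ Ω) (hu : chainU (-4 * b₁ ^ 2) o x 0 t ≠ 0) :
    HasDerivAt (chainH b₁ o x 0) (b₁ ^ 2 * zOf (x t) ^ 2 - (o : ℂ) ^ 2 * wOf (x t) ^ 2) t := by
  obtain ⟨hz, hw⟩ := zOf_wOf_ne_zero hexp ht
  have h1 := ((((((hasDerivAt_wOf (x t)).fun_div (hasDerivAt_zOf (x t)) hz).const_mul
    ((o : ℂ) ^ 2)).fun_add (((hasDerivAt_zOf (x t)).fun_div (hasDerivAt_wOf (x t)) hw).const_mul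
    (b₁ ^ 2))).fun_neg).div_const 4).comp t (hasDerivAt_branch hΩ hx hexp ht)
  refine (h1.congr_of_eventuallyEq ?_).congr_deriv ?_
  · have h2 := ((differentiableOn_chainU hx (-4 * b₁ ^ 2) o 0).differentiableAt
      (hΩ.mem_nhds ht)).continuousAt.eventually_ne hu
    filter_upwards [hΩ.mem_nhds ht, h2] with y hy hy2
    exact chainH_zero_eq hΩ hx hexp b₁ o hy hy2
  · have hw2 := wOf_sq (x t)
    field_simp
    ring_nf
    have hw4 : wOf (x t) ^ 4 = (zOf (x t) ^ 2 + 1) ^ 2 := by rw [← hw2]; ring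
    rw [hw4, hw2]
    ring

/-- The truncated subtraction `0 - 1 = 0` in `chainU` duplicates the seed, so the first difference
`R` is zero. -/
lemma chainH_zero_eq_one (b₁ : ℂ) (o : ℕ) (x : ℂ → ℂ) : chainH b₁ o x 1 = chainH b₁ o x 0 := rfl

lemma deriv_deriv_chainH_zero (hΩ : IsOpen Ω) (hx : DifferentiableOn ℂ x Ω)
    (hexp : ∀ t ∈ Ω, Complex.exp (2 * x t) = t / (t - 1)) (b₁ : ℂ) (o : ℕ) {t : ℂ}
    (ht : t ∈ Ω) (hu : chainU (-4 * b₁ ^ 2) o x 0 t ≠ 0) :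
    t * (t - 1) * deriv (deriv (chainH b₁ o x 0)) t =
      -(b₁ ^ 2 - (o : ℂ) ^ 2) * (zOf (x t) * wOf (x t)) / 2 := by
  have h1 := ((((hasDerivAt_zOf (x t)).fun_pow 2).const_mul (b₁ ^ 2)).fun_sub
    (((hasDerivAt_wOf (x t)).fun_pow 2).const_mul ((o : ℂ) ^ 2))).comp t
    (hasDerivAt_branch hΩ hx hexp ht)
  have h2 := ((differentiableOn_chainU hx (-4 * b₁ ^ 2) o 0).differentiableAt
    (hΩ.mem_nhds ht)).continuousAt.eventually_ne hu
  have h3 := h1.congr_of_eventuallyEq (f₁ := deriv (chainH b₁ o x 0)) (by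
    filter_upwards [hΩ.mem_nhds ht, h2] with y hy hy2
    exact (hasDerivAt_chainH_zero hΩ hx hexp b₁ o hy hy2).deriv)
  rw [h3.deriv]
  have hz := (zOf_wOf_of_exp (hexp t ht)).1
  push_cast
  linear_combination (-(b₁ ^ 2 - (o : ℂ) ^ 2) * (zOf (x t) * wOf (x t)) / 2) * hz

/-- For the seed `N = -(b₁² - o²) z w`, `h' + b₁² = (b₁² - o²) w²` and `h' + o² = (b₁² - o²) z²`, so
the relations with `R = 0` are explicit identities. -/
lemma backlundPair_zero (hΩ : IsOpen Ω) (hx : DifferentiableOn ℂ x Ω)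
    (hexp : ∀ t ∈ Ω, Complex.exp (2 * x t) = t / (t - 1)) (b₁ : ℂ) (o : ℕ) {t : ℂ}
    (ht : t ∈ Ω) (hu : chainU (-4 * b₁ ^ 2) o x 0 t ≠ 0) :
    BacklundPair (b₁ ^ 2) ((o : ℂ) ^ 2) (-1 / 2) (chainH b₁ o x 0) (fun _ => 0) t := by
  obtain ⟨hz, hw⟩ := zOf_wOf_ne_zero hexp ht
  have h1 := (hasDerivAt_chainH_zero hΩ hx hexp b₁ o ht hu).deriv
  have h2 := deriv_deriv_chainH_zero hΩ hx hexp b₁ o ht hu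
  have hτ := (zOf_wOf_of_exp (hexp t ht)).2
  have hw2 := wOf_sq (x t)
  have hτ' : 2 * t - 1 = (zOf (x t) ^ 2 + wOf (x t) ^ 2) / (2 * (zOf (x t) * wOf (x t))) := by
    rw [eq_div_iff (by simp [hz, hw])]
    exact hτ
  have hN : okamotoN (chainH b₁ o x 0) t = -(b₁ ^ 2 - (o : ℂ) ^ 2) * (zOf (x t) * wOf (x t)) := by
    rw [okamotoN, h1, chainH_zero_eq hΩ hx hexp b₁ o ht hu, hτ']
    field_simp
    ring_nf
    have hw4 : wOf (x t) ^ 4 = (zOf (x t) ^ 2 + 1) ^ 2 := by rw [← hw2]; ring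
    rw [hw4, hw2]
    ring
  refine ⟨?_, ?_, ?_⟩
  · rw [h2, hN]
    ring
  · rw [hN, h1, show wOf (x t) ^ 2 = zOf (x t) ^ 2 + 1 from hw2]
    linear_combination (b₁ ^ 2 - (o : ℂ) ^ 2) ^ 2 * zOf (x t) ^ 2 * hw2
  · rw [hN, h1]
    simp only [deriv_const]
    linear_combination ((b₁ ^ 2 - (o : ℂ) ^ 2) / 4) * hτ + ((b₁ ^ 2 + (o : ℂ) ^ 2) / 4) * hw2

/-- Writing `1/4 = (w² - z²)/4` makes `h' + 1/4` a quarter of the middle factor in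
`reducedDet_succ_self`. -/
lemma chainU_toda_one (hΩ : IsOpen Ω) (hx : DifferentiableOn ℂ x Ω)
    (hexp : ∀ t ∈ Ω, Complex.exp (2 * x t) = t / (t - 1)) (b₁ : ℂ) (o : ℕ) :
    ∃ c : ℂ, c ≠ 0 ∧ ∀ t ∈ Ω, chainU (-4 * b₁ ^ 2) o x 1 t ≠ 0 →
      c * (chainU (-4 * b₁ ^ 2) o x 0 t * chainU (-4 * b₁ ^ 2) o x 2 t) =
        chainU (-4 * b₁ ^ 2) o x 1 t ^ 2 * (deriv (chainH b₁ o x 1) t + (1 / 2) ^ 2) := by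
  set C : ℂ := ∏ i ∈ Finset.range o, (2 - (2 * (i : ℂ) + 1)) with hC
  have hC0 : C ≠ 0 := by
    refine Finset.prod_ne_zero_iff.mpr fun i _ => ?_
    have : (2 : ℂ) - (2 * i + 1) = ((1 - 2 * i : ℤ) : ℂ) := by push_cast; ring
    rw [this]
    exact_mod_cast (by omega : (1 - 2 * i : ℤ) ≠ 0)
  refine ⟨-1 / (4 * C), by simp [hC0], fun t ht hu => ?_⟩
  have h1 := (hasDerivAt_chainH_zero hΩ hx hexp b₁ o ht hu).deriv
  have e0 : chainU (-4 * b₁ ^ 2) o x 0 t = chainU (-4 * b₁ ^ 2) o x 1 t := rfl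
  have e1 : chainU (-4 * b₁ ^ 2) o x 1 t = rowDet (-4 * b₁ ^ 2) (oddEvenRow o) (o + 0) (x t) := rfl
  have e2 : chainU (-4 * b₁ ^ 2) o x 2 t = rowDet (-4 * b₁ ^ 2) (oddEvenRow o) (o + 1) (x t) := rfl
  have hrec : chainU (-4 * b₁ ^ 2) o x 2 t = -C * ((1 - 4 * (o : ℂ) ^ 2) * wOf (x t) ^ 2 -
      (-4 * b₁ ^ 2 + 1) * zOf (x t) ^ 2) * chainU (-4 * b₁ ^ 2) o x 1 t := by
    rw [e1, e2, rowDet_eq_reducedDet, rowDet_eq_reducedDet, reducedDet_succ_self, add_zero]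
    ring
  rw [chainH_zero_eq_one, h1, hrec, e0]
  have hw2 := wOf_sq (x t)
  generalize chainU (-4 * b₁ ^ 2) o x 1 t = u
  field_simp
  linear_combination (4 * u ^ 2) * hw2

/-- For `a = -4 b₁²` the right side of the Toda equation in `x` is, up to a constant, `4 u² (h' + (e
+ 3/2)²)`: the Hirota term and `-a z²` combine to `4 h'`. -/
lemma chainU_toda (hΩ : IsOpen Ω) (hx : DifferentiableOn ℂ x Ω)
    (hexp : ∀ t ∈ Ω, Complex.exp (2 * x t) = t / (t - 1)) (b₁ : ℂ) (o j : ℕ) :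
    ∃ c : ℂ, c ≠ 0 ∧ ∀ t ∈ Ω, chainU (-4 * b₁ ^ 2) o x (j + 1) t ≠ 0 →
      c * (chainU (-4 * b₁ ^ 2) o x j t * chainU (-4 * b₁ ^ 2) o x (j + 2) t) =
        chainU (-4 * b₁ ^ 2) o x (j + 1) t ^ 2 *
          (deriv (chainH b₁ o x (j + 1)) t + ((j : ℂ) + 1 / 2) ^ 2) := by
  rcases j with _ | e
  · obtain ⟨c, hc, h⟩ := chainU_toda_one hΩ hx hexp b₁ o
    refine ⟨c, hc, fun t ht hu => ?_⟩
    rw [h t ht hu]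
    push_cast
    ring
  · have h2 : ((2 : ℂ) * e + 2) ≠ 0 := by exact_mod_cast (by omega : 2 * e + 2 ≠ 0)
    have h3 : ((2 : ℂ) * e + 3) ≠ 0 := by exact_mod_cast (by omega : 2 * e + 3 ≠ 0)
    -- Nonzero by parity: `2 o` is even and `2 e + 3` odd.
    have h4 : (1 - 2 * (o : ℂ) / (2 * e + 3)) ≠ 0 := by
      rw [sub_ne_zero, ne_eq, eq_comm, div_eq_one_iff_eq h3]
      exact_mod_cast (by omega : 2 * o ≠ 2 * e + 3)
    refine ⟨-(1 - 2 * (o : ℂ) / (2 * e + 3)) / (4 * (2 * e + 2)),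
      div_ne_zero (neg_ne_zero.mpr h4) (mul_ne_zero (by norm_num) h2), fun t ht hu => ?_⟩
    have htoda := rowDet_oddEvenRow_toda (-4 * b₁ ^ 2) o e (x t)
    have hd := (hasDerivAt_chainH hΩ hx hexp b₁ o (e + 2) ht hu).deriv
    have e0 : chainU (-4 * b₁ ^ 2) o x (e + 1) t =
      rowDet (-4 * b₁ ^ 2) (oddEvenRow o) (o + e) (x t) := rfl
    have e1 : chainU (-4 * b₁ ^ 2) o x (e + 1 + 1) t =
      rowDet (-4 * b₁ ^ 2) (oddEvenRow o) (o + e + 1) (x t) := rfl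
    have e2 : chainU (-4 * b₁ ^ 2) o x (e + 1 + 2) t =
      rowDet (-4 * b₁ ^ 2) (oddEvenRow o) (o + e + 2) (x t) := rfl
    rw [e1] at hu
    rw [show o + (e + 2 - 1) = o + e + 1 from rfl] at hd
    rw [show e + 1 + 1 = e + 2 from rfl] at *
    rw [hd, e0, e1, e2]
    rw [hirota] at htoda
    set F := rowDet (-4 * b₁ ^ 2) (oddEvenRow o) (o + e + 1)
    have h5 : -(1 - 2 * (o : ℂ) / (2 * e + 3)) / (4 * (2 * e + 2)) *
        (rowDet (-4 * b₁ ^ 2) (oddEvenRow o) (o + e) (x t) *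
          rowDet (-4 * b₁ ^ 2) (oddEvenRow o) (o + e + 2) (x t)) =
        -((1 - 2 * (o : ℂ) / (2 * e + 3)) *
        (rowDet (-4 * b₁ ^ 2) (oddEvenRow o) (o + e) (x t) *
          rowDet (-4 * b₁ ^ 2) (oddEvenRow o) (o + e + 2) (x t))) / (4 * (2 * e + 2)) := by ring
    rw [h5, htoda]
    push_cast
    field_simp
    ring

lemma differentiableOn_chainH (hΩ : IsOpen Ω) (hx : DifferentiableOn ℂ x Ω)
    (hexp : ∀ t ∈ Ω, Complex.exp (2 * x t) = t / (t - 1)) (b₁ : ℂ) (o J j : ℕ) (hj : j ≤ J + 1) :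
    DifferentiableOn ℂ (chainH b₁ o x j) (goodSet Ω x (-4 * b₁ ^ 2) o J) := fun _ ht =>
  (hasDerivAt_chainH hΩ hx hexp b₁ o j ht.1 (ht.2 j hj)).differentiableAt.differentiableWithinAt

/-- The logarithmic derivative of `chainU_toda`; the terms `h0` cancel in the second difference. -/
lemma chainH_toda (hΩ : IsOpen Ω) (hx : DifferentiableOn ℂ x Ω)
    (hexp : ∀ t ∈ Ω, Complex.exp (2 * x t) = t / (t - 1)) (b₁ : ℂ) (o J j : ℕ) (hj : j + 1 ≤ J)
    {t : ℂ} (ht : t ∈ goodSet Ω x (-4 * b₁ ^ 2) o J) :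
    deriv (chainH b₁ o x (j + 1)) t + ((j : ℂ) + 1 / 2) ^ 2 ≠ 0 ∧
    t * (t - 1) * deriv (deriv (chainH b₁ o x (j + 1))) t =
      (deriv (chainH b₁ o x (j + 1)) t + ((j : ℂ) + 1 / 2) ^ 2) *
        (chainH b₁ o x (j + 2) t + chainH b₁ o x j t - 2 * chainH b₁ o x (j + 1) t) := by
  obtain ⟨c, hc, h⟩ := chainU_toda hΩ hx hexp b₁ o j
  have hG := isOpen_goodSet hΩ hx (-4 * b₁ ^ 2) o J
  have hsub : goodSet Ω x (-4 * b₁ ^ 2) o J ⊆ Ω := fun _ h => h.1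
  have hf := ht.2 j (by omega)
  have hg := ht.2 (j + 1) (by omega)
  have hk := ht.2 (j + 2) (by omega)
  have hE := h t ht.1 hg
  refine ⟨fun h0 => ?_, ?_⟩
  · rw [h0, mul_zero] at hE
    exact mul_ne_zero hc (mul_ne_zero hf hk) hE
  have hdU : ∀ i, HasDerivAt (chainU (-4 * b₁ ^ 2) o x i)
      (deriv (chainU (-4 * b₁ ^ 2) o x i) t) t := fun i =>
    hasDerivAt_of_mem hΩ (differentiableOn_chainU hx _ o i) ht.1
  have hdQ := (hasDerivAt_of_mem hG ((differentiableOn_chainH hΩ hx hexp b₁ o J (j + 1)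
    (by omega)).deriv hG) ht).add_const (((j : ℂ) + 1 / 2) ^ 2)
  have hl := ((hdU j).fun_mul (hdU (j + 2))).const_mul c
  have hr := ((hdU (j + 1)).fun_pow 2).fun_mul hdQ
  have hD := hl.unique (hr.congr_of_eventuallyEq (by
    filter_upwards [hG.mem_nhds ht] with y hy
    exact h y hy.1 (hy.2 (j + 1) (by omega))))
  generalize deriv (deriv (chainH b₁ o x (j + 1))) t = Q' at *
  generalize deriv (chainH b₁ o x (j + 1)) t + ((j : ℂ) + 1 / 2) ^ 2 = Q at *
  simp only [chainH, auxHam, logDeriv_apply]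
  generalize deriv (chainU (-4 * b₁ ^ 2) o x j) t = f' at *
  generalize deriv (chainU (-4 * b₁ ^ 2) o x (j + 1)) t = g' at *
  generalize deriv (chainU (-4 * b₁ ^ 2) o x (j + 2)) t = k' at *
  generalize chainU (-4 * b₁ ^ 2) o x j t = f at *
  generalize chainU (-4 * b₁ ^ 2) o x (j + 1) t = g at *
  generalize chainU (-4 * b₁ ^ 2) o x (j + 2) t = k at *
  have key : g ^ 2 * (Q' * (f * k * g)) =
      g ^ 2 * (Q * (f' * k * g + f * k' * g - 2 * g' * f * k)) := by
    push_cast at hD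
    linear_combination (-(f * k * g)) * hD + g * (f' * k + f * k') * hE
  have key2 := mul_left_cancel₀ (pow_ne_zero 2 hg) key
  field_simp
  linear_combination t * (t - 1) * key2

lemma backlundPair_chainH (hΩ : IsOpen Ω) (hx : DifferentiableOn ℂ x Ω)
    (hexp : ∀ t ∈ Ω, Complex.exp (2 * x t) = t / (t - 1)) (b₁ : ℂ) (o J j : ℕ) (hj : j ≤ J) :
    ∀ t ∈ goodSet Ω x (-4 * b₁ ^ 2) o J,
      BacklundPair (b₁ ^ 2) ((o : ℂ) ^ 2) ((j : ℂ) - 1 / 2) (chainH b₁ o x j)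
        (fun y => chainH b₁ o x (j + 1) y - chainH b₁ o x j y) t := by
  induction j with
  | zero =>
    intro t ht
    have h := backlundPair_zero hΩ hx hexp b₁ o ht.1 (ht.2 0 (by omega))
    have e : (fun y => chainH b₁ o x (0 + 1) y - chainH b₁ o x 0 y) = fun _ => 0 := by
      ext y
      rw [chainH_zero_eq_one, sub_self]
    rw [e]
    convert h using 1
    norm_num
  | succ j ih =>
    intro t ht
    have hG := isOpen_goodSet hΩ hx (-4 * b₁ ^ 2) o J
    have hd := fun i hi => differentiableOn_chainH hΩ hx hexp b₁ o J i hi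
    have e : (fun y => chainH b₁ o x j y + (chainH b₁ o x (j + 1) y - chainH b₁ o x j y)) =
        chainH b₁ o x (j + 1) := by
      ext y
      ring
    have eβ : (j : ℂ) - 1 / 2 + 1 = j + 1 / 2 := by ring
    have hs := BacklundPair.step hG (hd j (by omega))
      ((hd (j + 1) (by omega)).fun_sub (hd j (by omega)))
      ((hd (j + 2) (by omega)).fun_sub (hd (j + 1) (by omega))) (ih (by omega))
      (fun t ht => by
        rw [e, eβ]
        exact (chainH_toda hΩ hx hexp b₁ o J j (by omega) ht).1)
      (fun t ht => by
        rw [e, eβ, (chainH_toda hΩ hx hexp b₁ o J j (by omega) ht).2]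
        ring) ht
    rw [e] at hs
    convert hs using 1
    push_cast
    ring

/-- Descent by `BacklundPair.second_deriv_eq_zero` to the seed, whose second derivative is
proportional to `(b₁² - o²) z w`. -/
lemma not_deriv_deriv_chainH_eq_zero (hΩ : IsOpen Ω) (hx : DifferentiableOn ℂ x Ω)
    (hexp : ∀ t ∈ Ω, Complex.exp (2 * x t) = t / (t - 1)) (b₁ : ℂ) (o J : ℕ)
    (hb : b₁ ^ 2 ≠ (o : ℂ) ^ 2) {V : Set ℂ} (hV : IsOpen V)
    (hVG : V ⊆ goodSet Ω x (-4 * b₁ ^ 2) o J) (hne : V.Nonempty) (j : ℕ) (hj : j ≤ J) :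
    ¬ ∀ t ∈ V, deriv (deriv (chainH b₁ o x j)) t = 0 := by
  induction j with
  | zero =>
    intro h
    obtain ⟨t, ht⟩ := hne
    have h1 := deriv_deriv_chainH_zero hΩ hx hexp b₁ o (hVG ht).1 ((hVG ht).2 0 (by omega))
    obtain ⟨hz, hw⟩ := zOf_wOf_ne_zero hexp (hVG ht).1
    rw [h t ht, mul_zero] at h1
    have h2 : (b₁ ^ 2 - (o : ℂ) ^ 2) * (zOf (x t) * wOf (x t)) = 0 := by
      linear_combination (-2 : ℂ) * -h1
    exact mul_ne_zero (sub_ne_zero.mpr hb) (mul_ne_zero hz hw) h2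
  | succ j ih =>
    intro h
    refine ih (by omega) ?_
    have hd := fun i hi => (differentiableOn_chainH hΩ hx hexp b₁ o J i hi).mono hVG
    have e : (fun y => chainH b₁ o x j y + (chainH b₁ o x (j + 1) y - chainH b₁ o x j y)) =
        chainH b₁ o x (j + 1) := by
      ext y
      ring
    have eβ : (j : ℂ) - 1 / 2 + 1 = j + 1 / 2 := by ring
    refine BacklundPair.second_deriv_eq_zero hV (hd j (by omega))
      ((hd (j + 1) (by omega)).fun_sub (hd j (by omega)))
      (fun t ht => backlundPair_chainH hΩ hx hexp b₁ o J j (by omega) t (hVG ht))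
      (fun t ht => by
        rw [e, eβ]
        exact (chainH_toda hΩ hx hexp b₁ o J j (by omega) (hVG ht)).1)
      (fun t ht => by rw [e]; exact h t ht)

end Chain

end Umemura

namespace Umemura

open Filter Topology

/-! ### From the Painlevé–Okamoto equation with `b_2 = 0` to the Hamiltonian system -/

section Okamoto

variable (b₁ b₃ b₄ : ℂ) (h : ℂ → ℂ)

/-- The product `(h' + b_3^2) (h' + b_4^2)`. -/
noncomputable def okamotoA (t : ℂ) : ℂ := (deriv h t + b₃ ^ 2) * (deriv h t + b₄ ^ 2)

/-- The combination `h - t h' + e_2 / 2`. -/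
noncomputable def okamotoL (t : ℂ) : ℂ :=
  h t - t * deriv h t + (b₁ * b₃ + b₁ * b₄ + b₃ * b₄) / 2

/-- The combination `e_1 h' - e_3`. -/
noncomputable def okamotoK (t : ℂ) : ℂ := (b₁ + b₃ + b₄) * deriv h t - b₁ * b₃ * b₄

/-- The coordinate `q` recovered from a solution `h` of `E_VI`. -/
noncomputable def okamotoQ (t : ℂ) : ℂ :=
  (2 * (b₃ * b₄ - deriv h t) * okamotoL b₁ b₃ b₄ h t +
    (b₃ + b₄) * (t * (t - 1) * deriv (deriv h) t + okamotoK b₁ b₃ b₄ h t)) /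
      (2 * okamotoA b₃ b₄ h t)

/-- The combination `X = q (q - 1) p` recovered from a solution `h` of `E_VI`. -/
noncomputable def okamotoX (t : ℂ) : ℂ :=
  ((b₁ * b₃ + b₁ * b₄ + b₃ * b₄ - deriv h t) *
      (t * (t - 1) * deriv (deriv h) t + okamotoK b₁ b₃ b₄ h t) -
    2 * okamotoK b₁ b₃ b₄ h t * okamotoL b₁ b₃ b₄ h t) / (2 * okamotoA b₃ b₄ h t)

/-- The momentum `p` recovered from a solution `h` of `E_VI`. -/
noncomputable def okamotoP (t : ℂ) : ℂ :=
  okamotoX b₁ b₃ b₄ h t / (okamotoQ b₁ b₃ b₄ h t * (okamotoQ b₁ b₃ b₄ h t - 1))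

/-- The generic points for the passage from `E_VI` to the Hamiltonian system. -/
structure IsOkamotoPoint (t : ℂ) : Prop where
  analyticAt : AnalyticAt ℂ h t
  ne_zero : t ≠ 0
  ne_one : t ≠ 1
  second_deriv_ne_zero : deriv (deriv h) t ≠ 0
  okamotoA_ne_zero : okamotoA b₃ b₄ h t ≠ 0
  okamoto : (t * (t - 1) * deriv (deriv h) t) ^ 2 + deriv h t * okamotoN h t ^ 2 =
    (deriv h t + b₁ ^ 2) * okamotoA b₃ b₄ h t

variable {b₁ b₃ b₄ h} {t : ℂ}

/-- `okamotoQ` and `okamotoX` are the Cramer solution of this relation together with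
`second_deriv_eq`; the determinant of the system is `okamotoA`. -/
lemma okamotoL_eq (hA : okamotoA b₃ b₄ h t ≠ 0) :
    okamotoL b₁ b₃ b₄ h t =
      (b₁ * b₃ + b₁ * b₄ + b₃ * b₄ - deriv h t) * okamotoQ b₁ b₃ b₄ h t -
        (b₃ + b₄) * okamotoX b₁ b₃ b₄ h t := by
  rw [okamotoQ, okamotoX]
  field_simp
  rw [okamotoA, okamotoK]
  ring

lemma second_deriv_eq (hA : okamotoA b₃ b₄ h t ≠ 0) :
    t * (t - 1) * deriv (deriv h) t =
      okamotoK b₁ b₃ b₄ h t * (2 * okamotoQ b₁ b₃ b₄ h t - 1) +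
        2 * (b₃ * b₄ - deriv h t) * okamotoX b₁ b₃ b₄ h t := by
  rw [okamotoQ, okamotoX]
  field_simp
  rw [okamotoA, okamotoK]
  ring

/-- Inserting the two linear relations turns the Okamoto equation into `4 okamotoA` times this
quadric. With `X = q (q - 1) p` it expresses `h'` through `q` and `p`. -/
lemma IsOkamotoPoint.quadric (H : IsOkamotoPoint b₁ b₃ b₄ h t) :
    okamotoX b₁ b₃ b₄ h t ^ 2 -
      b₁ * (2 * okamotoQ b₁ b₃ b₄ h t - 1) * okamotoX b₁ b₃ b₄ h t +
      (deriv h t + b₁ ^ 2) * (okamotoQ b₁ b₃ b₄ h t * (okamotoQ b₁ b₃ b₄ h t - 1)) = 0 := by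
  have hA := H.okamotoA_ne_zero
  have h1 := okamotoL_eq (b₁ := b₁) hA
  have h2 := second_deriv_eq (b₁ := b₁) hA
  have h3 := H.okamoto
  have hN : okamotoN h t = 2 * okamotoL b₁ b₃ b₄ h t + deriv h t -
      (b₁ * b₃ + b₁ * b₄ + b₃ * b₄) := by
    rw [okamotoN, okamotoL]
    ring
  rw [hN, h1, h2] at h3
  apply mul_left_cancel₀ hA
  rw [mul_zero]
  rw [okamotoK] at h3
  generalize okamotoQ b₁ b₃ b₄ h t = q at *
  generalize okamotoX b₁ b₃ b₄ h t = X at *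
  rw [okamotoA] at *
  linear_combination h3 / 4

lemma IsOkamotoPoint.analyticAt_okamotoQ (H : IsOkamotoPoint b₁ b₃ b₄ h t) :
    AnalyticAt ℂ (okamotoQ b₁ b₃ b₄ h) t := by
  have h0 := H.analyticAt
  have h1 := h0.deriv
  have h2 := h1.deriv
  have hA : 2 * okamotoA b₃ b₄ h t ≠ 0 := mul_ne_zero two_ne_zero H.okamotoA_ne_zero
  unfold okamotoQ okamotoL okamotoK
  refine AnalyticAt.fun_div (by fun_prop) ?_ hA
  unfold okamotoA
  fun_prop

lemma IsOkamotoPoint.analyticAt_okamotoX (H : IsOkamotoPoint b₁ b₃ b₄ h t) :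
    AnalyticAt ℂ (okamotoX b₁ b₃ b₄ h) t := by
  have h0 := H.analyticAt
  have h1 := h0.deriv
  have h2 := h1.deriv
  have hA : 2 * okamotoA b₃ b₄ h t ≠ 0 := mul_ne_zero two_ne_zero H.okamotoA_ne_zero
  unfold okamotoX okamotoL okamotoK
  refine AnalyticAt.fun_div (by fun_prop) ?_ hA
  unfold okamotoA
  fun_prop

/-- The derivative of the linear relation between `q` and `X`. -/
lemma deriv_okamotoX (H : ∀ᶠ s in 𝓝 t, IsOkamotoPoint b₁ b₃ b₄ h s) :
    (b₃ + b₄) * deriv (okamotoX b₁ b₃ b₄ h) t =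
      (b₁ * b₃ + b₁ * b₄ + b₃ * b₄ - deriv h t) * deriv (okamotoQ b₁ b₃ b₄ h) t -
        (okamotoQ b₁ b₃ b₄ h t - t) * deriv (deriv h) t := by
  have H0 := H.self_of_nhds
  have hq := H0.analyticAt_okamotoQ.differentiableAt.hasDerivAt
  have hX := H0.analyticAt_okamotoX.differentiableAt.hasDerivAt
  have hh := H0.analyticAt.differentiableAt.hasDerivAt
  have hy := H0.analyticAt.deriv.differentiableAt.hasDerivAt
  have hl := (hh.fun_sub ((hasDerivAt_id t).fun_mul hy)).add_const
    ((b₁ * b₃ + b₁ * b₄ + b₃ * b₄) / 2)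
  have hr := ((hy.const_sub (b₁ * b₃ + b₁ * b₄ + b₃ * b₄)).fun_mul hq).fun_sub
    (hX.const_mul (b₃ + b₄))
  have heq := hl.unique (hr.congr_of_eventuallyEq (by
    filter_upwards [H] with s hs
    exact okamotoL_eq hs.okamotoA_ne_zero))
  simp only [id] at heq
  linear_combination heq

/-- The first Hamiltonian equation. -/
lemma deriv_okamotoQ (H : ∀ᶠ s in 𝓝 t, IsOkamotoPoint b₁ b₃ b₄ h s) :
    t * (t - 1) * deriv (okamotoQ b₁ b₃ b₄ h) t =
      (okamotoQ b₁ b₃ b₄ h t - t) *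
        (2 * okamotoX b₁ b₃ b₄ h t - b₁ * (2 * okamotoQ b₁ b₃ b₄ h t - 1)) -
        (b₃ + b₄) * (okamotoQ b₁ b₃ b₄ h t * (okamotoQ b₁ b₃ b₄ h t - 1)) := by
  have H0 := H.self_of_nhds
  have hq := H0.analyticAt_okamotoQ.differentiableAt.hasDerivAt
  have hX := H0.analyticAt_okamotoX.differentiableAt.hasDerivAt
  have hy := H0.analyticAt.deriv.differentiableAt.hasDerivAt
  have hl := ((hX.fun_pow 2).fun_sub ((((hq.const_mul 2).sub_const 1).const_mul b₁).fun_mul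
    hX)).fun_add ((hy.add_const (b₁ ^ 2)).fun_mul (hq.fun_mul (hq.sub_const 1)))
  have heq := hl.unique ((hasDerivAt_const t (0 : ℂ)).congr_of_eventuallyEq (by
    filter_upwards [H] with s hs
    exact hs.quadric))
  have h1 := deriv_okamotoX H
  have h3 := second_deriv_eq (b₁ := b₁) H0.okamotoA_ne_zero
  rw [okamotoK] at h3
  -- Eliminating `X'` between the differentiated quadric and the differentiated linear relation
  -- leaves `h''` times the claim.
  apply mul_left_cancel₀ H0.second_deriv_ne_zero
  generalize deriv (okamotoX b₁ b₃ b₄ h) t = X' at *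
  generalize deriv (okamotoQ b₁ b₃ b₄ h) t = q' at *
  generalize deriv (deriv h) t = y' at *
  generalize okamotoX b₁ b₃ b₄ h t = X at *
  generalize okamotoQ b₁ b₃ b₄ h t = q at *
  push_cast at heq
  linear_combination q' * h3 + (b₃ + b₄) * heq - (2 * X - b₁ * (2 * q - 1)) * h1

/-- If `q = 0` near `t`, the first Hamiltonian equation forces `X = -b₁ / 2`. Then both are constant
and the differentiated linear relation reads `t h'' = 0`. -/
lemma okamotoQ_not_eventually_zero
    (H : ∀ᶠ s in 𝓝 t, IsOkamotoPoint b₁ b₃ b₄ h s) :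
    ¬ ∀ᶠ s in 𝓝 t, okamotoQ b₁ b₃ b₄ h s = 0 := by
  intro h0
  have hq : ∀ᶠ s in 𝓝 t, deriv (okamotoQ b₁ b₃ b₄ h) s = 0 := by
    filter_upwards [h0.eventually_nhds] with s hs
    rw [EventuallyEq.deriv_eq (f := fun _ => 0) hs, deriv_const]
  have hX : ∀ᶠ s in 𝓝 t, okamotoX b₁ b₃ b₄ h s = -b₁ / 2 := by
    filter_upwards [h0, hq, H.eventually_nhds] with s hs hs' Hs
    have h1 := deriv_okamotoQ Hs
    rw [hs, hs'] at h1
    apply mul_left_cancel₀ Hs.self_of_nhds.ne_zero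
    linear_combination h1 / 2
  have hX' : deriv (okamotoX b₁ b₃ b₄ h) t = 0 := by
    rw [EventuallyEq.deriv_eq (f := fun _ => -b₁ / 2) hX, deriv_const]
  have h1 := deriv_okamotoX H
  rw [hX', hq.self_of_nhds, h0.self_of_nhds] at h1
  have H0 := H.self_of_nhds
  exact mul_ne_zero H0.ne_zero H0.second_deriv_ne_zero (by linear_combination -h1)

lemma okamotoQ_not_eventually_one
    (H : ∀ᶠ s in 𝓝 t, IsOkamotoPoint b₁ b₃ b₄ h s) :
    ¬ ∀ᶠ s in 𝓝 t, okamotoQ b₁ b₃ b₄ h s = 1 := by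
  intro h0
  have hq : ∀ᶠ s in 𝓝 t, deriv (okamotoQ b₁ b₃ b₄ h) s = 0 := by
    filter_upwards [h0.eventually_nhds] with s hs
    rw [EventuallyEq.deriv_eq (f := fun _ => 1) hs, deriv_const]
  have hX : ∀ᶠ s in 𝓝 t, okamotoX b₁ b₃ b₄ h s = b₁ / 2 := by
    filter_upwards [h0, hq, H.eventually_nhds] with s hs hs' Hs
    have h1 := deriv_okamotoQ Hs
    rw [hs, hs'] at h1
    apply mul_left_cancel₀ (sub_ne_zero.mpr Hs.self_of_nhds.ne_one)
    linear_combination h1 / 2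
  have hX' : deriv (okamotoX b₁ b₃ b₄ h) t = 0 := by
    rw [EventuallyEq.deriv_eq (f := fun _ => b₁ / 2) hX, deriv_const]
  have h1 := deriv_okamotoX H
  rw [hX', hq.self_of_nhds, h0.self_of_nhds] at h1
  have H0 := H.self_of_nhds
  exact mul_ne_zero (sub_ne_zero.mpr H0.ne_one) H0.second_deriv_ne_zero (by linear_combination -h1)

/-- For `q = t` the first Hamiltonian equation reduces to `1 = -(b₃ + b₄)`. -/
lemma okamotoQ_not_eventually_self (hσ' : b₃ + b₄ ≠ -1)
    (H : ∀ᶠ s in 𝓝 t, IsOkamotoPoint b₁ b₃ b₄ h s) :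
    ¬ ∀ᶠ s in 𝓝 t, okamotoQ b₁ b₃ b₄ h s = s := by
  intro h0
  have hq : deriv (okamotoQ b₁ b₃ b₄ h) t = 1 := by
    rw [EventuallyEq.deriv_eq (f := fun s => s) h0, deriv_id'']
  have h1 := deriv_okamotoQ H
  rw [hq, h0.self_of_nhds] at h1
  have H0 := H.self_of_nhds
  apply hσ'
  apply mul_left_cancel₀ (mul_ne_zero H0.ne_zero (sub_ne_zero.mpr H0.ne_one))
  linear_combination h1

lemma okamotoX_eq (h0 : okamotoQ b₁ b₃ b₄ h t ≠ 0) (h1 : okamotoQ b₁ b₃ b₄ h t ≠ 1) :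
    okamotoX b₁ b₃ b₄ h t = okamotoQ b₁ b₃ b₄ h t * (okamotoQ b₁ b₃ b₄ h t - 1) *
      okamotoP b₁ b₃ b₄ h t := by
  have h1' := sub_ne_zero.mpr h1
  rw [okamotoP]
  field_simp

lemma IsOkamotoPoint.deriv_eq (H : IsOkamotoPoint b₁ b₃ b₄ h t)
    (h0 : okamotoQ b₁ b₃ b₄ h t ≠ 0) (h1 : okamotoQ b₁ b₃ b₄ h t ≠ 1) :
    deriv h t = -(okamotoQ b₁ b₃ b₄ h t * (okamotoQ b₁ b₃ b₄ h t - 1)) *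
      okamotoP b₁ b₃ b₄ h t ^ 2 + b₁ * (2 * okamotoQ b₁ b₃ b₄ h t - 1) * okamotoP b₁ b₃ b₄ h t -
      b₁ ^ 2 := by
  have h2 := H.quadric
  rw [okamotoX_eq h0 h1] at h2
  apply mul_left_cancel₀ (mul_ne_zero h0 (sub_ne_zero.mpr h1))
  linear_combination h2

lemma IsOkamotoPoint.analyticAt_okamotoP (H : IsOkamotoPoint b₁ b₃ b₄ h t)
    (h0 : okamotoQ b₁ b₃ b₄ h t ≠ 0) (h1 : okamotoQ b₁ b₃ b₄ h t ≠ 1) :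
    AnalyticAt ℂ (okamotoP b₁ b₃ b₄ h) t := by
  have hq := H.analyticAt_okamotoQ
  have hX := H.analyticAt_okamotoX
  exact hX.fun_div (by fun_prop) (mul_ne_zero h0 (sub_ne_zero.mpr h1))

lemma hasDerivAt_okamotoQ (H : ∀ᶠ s in 𝓝 t, IsOkamotoPoint b₁ b₃ b₄ h s)
    (h0 : okamotoQ b₁ b₃ b₄ h t ≠ 0) (h1 : okamotoQ b₁ b₃ b₄ h t ≠ 1) :
    HasDerivAt (okamotoQ b₁ b₃ b₄ h)
      (((okamotoQ b₁ b₃ b₄ h t - t) * (2 * (okamotoQ b₁ b₃ b₄ h t *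
        (okamotoQ b₁ b₃ b₄ h t - 1)) * okamotoP b₁ b₃ b₄ h t -
          b₁ * (2 * okamotoQ b₁ b₃ b₄ h t - 1)) -
        (b₃ + b₄) * (okamotoQ b₁ b₃ b₄ h t * (okamotoQ b₁ b₃ b₄ h t - 1))) / (t * (t - 1))) t := by
  have H0 := H.self_of_nhds
  refine H0.analyticAt_okamotoQ.differentiableAt.hasDerivAt.congr_deriv ?_
  rw [eq_div_iff (mul_ne_zero H0.ne_zero (sub_ne_zero.mpr H0.ne_one))]
  have h2 := deriv_okamotoQ H
  rw [okamotoX_eq h0 h1] at h2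
  linear_combination h2

/-- The second Hamiltonian equation. -/
lemma hasDerivAt_okamotoP (hσ : b₃ + b₄ ≠ 0) (H : ∀ᶠ s in 𝓝 t, IsOkamotoPoint b₁ b₃ b₄ h s)
    (h0 : okamotoQ b₁ b₃ b₄ h t ≠ 0) (h1 : okamotoQ b₁ b₃ b₄ h t ≠ 1) :
    HasDerivAt (okamotoP b₁ b₃ b₄ h)
      (-((3 * okamotoQ b₁ b₃ b₄ h t ^ 2 - 2 * (1 + t) * okamotoQ b₁ b₃ b₄ h t + t) *
          okamotoP b₁ b₃ b₄ h t ^ 2 -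
        (b₁ * (4 * okamotoQ b₁ b₃ b₄ h t - 2 * t - 1) +
          (b₃ + b₄) * (2 * okamotoQ b₁ b₃ b₄ h t - 1)) * okamotoP b₁ b₃ b₄ h t +
        (b₁ + b₃) * (b₁ + b₄)) / (t * (t - 1))) t := by
  have H0 := H.self_of_nhds
  have hp := (H0.analyticAt_okamotoP h0 h1).differentiableAt.hasDerivAt
  refine hp.congr_deriv ?_
  have hT := mul_ne_zero H0.ne_zero (sub_ne_zero.mpr H0.ne_one)
  rw [eq_div_iff hT]
  have hq := H0.analyticAt_okamotoQ.differentiableAt.hasDerivAt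
  have hX := H0.analyticAt_okamotoX.differentiableAt.hasDerivAt
  have hcq := H0.analyticAt_okamotoQ.continuousAt
  have heq := hX.unique (((hq.fun_mul (hq.sub_const 1)).fun_mul hp).congr_of_eventuallyEq (by
    filter_upwards [hcq.eventually_ne h0, hcq.eventually_ne h1] with s hs0 hs1
    exact okamotoX_eq hs0 hs1))
  have h2 := deriv_okamotoQ H
  have h3 := deriv_okamotoX H
  have h4 := second_deriv_eq (b₁ := b₁) H0.okamotoA_ne_zero
  have h5 := H0.deriv_eq h0 h1
  rw [okamotoX_eq h0 h1] at h2 h4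
  rw [okamotoK] at h4
  rw [heq] at h3
  have h1' := sub_ne_zero.mpr h1
  -- The momentum derivative enters only through `(b₃ + b₄) X'` in the differentiated linear
  -- relation.
  apply mul_left_cancel₀ (mul_ne_zero hσ (mul_ne_zero h0 h1'))
  generalize deriv (okamotoP b₁ b₃ b₄ h) t = p' at *
  generalize deriv (okamotoQ b₁ b₃ b₄ h) t = q' at *
  generalize deriv (deriv h) t = y' at *
  generalize okamotoP b₁ b₃ b₄ h t = p at *
  generalize okamotoQ b₁ b₃ b₄ h t = q at *
  generalize deriv h t = y at *
  subst h5
  linear_combination t * (t - 1) * h3 - (q - t) * h4 +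
    ((b₁ * b₃ + b₁ * b₄ + b₃ * b₄) -
      (-(q * (q - 1)) * p ^ 2 + b₁ * (2 * q - 1) * p - b₁ ^ 2) -
        (b₃ + b₄) * (2 * q - 1) * p) * h2

end Okamoto

end Umemura

/-! ### Painlevé VI and the meromorphic Hamiltonian solution attached to `h` -/

namespace Umemura

open Filter Topology

lemma eventually_codiscreteWithin_of_nhdsNE {Ω : Set ℂ} {P : ℂ → Prop}
    (h : ∀ t ∈ Ω, ∀ᶠ s in 𝓝[≠] t, P s) : ∀ᶠ t in codiscreteWithin Ω, P t := by
  refine mem_codiscreteWithin_iff_forall_mem_nhdsNE.mpr fun t ht => ?_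
  filter_upwards [h t ht] with s hs using Or.inl hs

lemma eventually_nhdsNE_eventually_nhds {t : ℂ} {P : ℂ → Prop} (h : ∀ᶠ s in 𝓝[≠] t, P s) :
    ∀ᶠ s in 𝓝[≠] t, ∀ᶠ r in 𝓝 s, P r := by
  filter_upwards [eventually_eventually_nhdsWithin.mpr h, self_mem_nhdsWithin] with s hs hst
  rwa [isOpen_compl_singleton.nhdsWithin_eq hst] at hs

lemma deriv_HVI_momentum (b : Fin 4 → ℂ) (t q p : ℂ) :
    deriv (fun y => HVI b t q y) p = 1 / (t * (t - 1)) *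
      (2 * (q * (q - 1) * (q - t)) * p - ((b 0 + b 1) * (q - 1) * (q - t) +
        (b 0 - b 1) * q * (q - t) + (b 2 + b 3) * q * (q - 1))) := by
  have hid := hasDerivAt_id p
  have h1 := ((((hid.fun_pow 2).const_mul (q * (q - 1) * (q - t))).fun_sub
    (hid.const_mul ((b 0 + b 1) * (q - 1) * (q - t) + (b 0 - b 1) * q * (q - t)
          + (b 2 + b 3) * q * (q - 1)))).add_const
    ((b 0 + b 2) * (b 0 + b 3) * (q - t))).const_mul (1 / (t * (t - 1)))
  refine Eq.trans (HasDerivAt.deriv h1) ?_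
  simp only [id]
  push_cast
  ring

lemma deriv_HVI_coordinate (b : Fin 4 → ℂ) (t q p : ℂ) :
    deriv (fun y => HVI b t y p) q = 1 / (t * (t - 1)) *
      ((3 * q ^ 2 - 2 * (1 + t) * q + t) * p ^ 2 - ((b 0 + b 1) * (2 * q - t - 1) +
        (b 0 - b 1) * (2 * q - t) + (b 2 + b 3) * (2 * q - 1)) * p +
        (b 0 + b 2) * (b 0 + b 3)) := by
  have hid := hasDerivAt_id q
  have hq1 := hid.sub_const 1
  have hqt := hid.sub_const t
  have h1 := (((((hid.fun_mul hq1).fun_mul hqt).mul_const (p ^ 2)).fun_sub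
    ((((((hq1.const_mul (b 0 + b 1)).fun_mul hqt)).fun_add
      ((hid.const_mul (b 0 - b 1)).fun_mul hqt)).fun_add
      ((hid.const_mul (b 2 + b 3)).fun_mul hq1)).mul_const p)).fun_add
    (hqt.const_mul ((b 0 + b 2) * (b 0 + b 3)))).const_mul (1 / (t * (t - 1)))
  refine Eq.trans (HasDerivAt.deriv h1) ?_
  simp only [id]
  ring

section Okamoto

variable {b₁ b₃ b₄ : ℂ} {h : ℂ → ℂ} {t : ℂ}

/-- Both sides become rational functions of `t, q, p`: `q'` by the first Hamiltonian equation, `q''`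
by differentiating it and inserting both equations. -/
lemma painleve_okamotoQ (hσ : b₃ + b₄ ≠ 0) (H : ∀ᶠ s in 𝓝 t, IsOkamotoPoint b₁ b₃ b₄ h s)
    (h0 : okamotoQ b₁ b₃ b₄ h t ≠ 0) (h1 : okamotoQ b₁ b₃ b₄ h t ≠ 1)
    (ht : okamotoQ b₁ b₃ b₄ h t ≠ t) :
    deriv (deriv (okamotoQ b₁ b₃ b₄ h)) t =
      1 / 2 * (1 / okamotoQ b₁ b₃ b₄ h t + 1 / (okamotoQ b₁ b₃ b₄ h t - 1) +
        1 / (okamotoQ b₁ b₃ b₄ h t - t)) * deriv (okamotoQ b₁ b₃ b₄ h) t ^ 2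
      - (1 / t + 1 / (t - 1) + 1 / (okamotoQ b₁ b₃ b₄ h t - t)) * deriv (okamotoQ b₁ b₃ b₄ h) t
      + okamotoQ b₁ b₃ b₄ h t * (okamotoQ b₁ b₃ b₄ h t - 1) * (okamotoQ b₁ b₃ b₄ h t - t) /
          (t ^ 2 * (t - 1) ^ 2) *
        ((b₃ - b₄) ^ 2 / 2 + -b₁ ^ 2 / 2 * (t / okamotoQ b₁ b₃ b₄ h t ^ 2)
          + b₁ ^ 2 / 2 * ((t - 1) / (okamotoQ b₁ b₃ b₄ h t - 1) ^ 2)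
          + -(b₃ + b₄) * (b₃ + b₄ + 2) / 2 * (t * (t - 1) / (okamotoQ b₁ b₃ b₄ h t - t) ^ 2)) := by
  have H0 := H.self_of_nhds
  have ht0 := H0.ne_zero
  have ht1 := sub_ne_zero.mpr H0.ne_one
  have hcq := H0.analyticAt_okamotoQ.continuousAt
  have hq := hasDerivAt_okamotoQ H h0 h1
  have hp := hasDerivAt_okamotoP hσ H h0 h1
  have hid := hasDerivAt_id t
  have hq1 := hq.sub_const 1
  have hD := ((((hq.fun_sub hid).fun_mul ((((hq.fun_mul hq1).const_mul 2).fun_mul hp).fun_sub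
    (((hq.const_mul 2).sub_const 1).const_mul b₁))).fun_sub
    ((hq.fun_mul hq1).const_mul (b₃ + b₄))).fun_div (hid.fun_mul (hid.sub_const 1))
    (mul_ne_zero ht0 ht1)).congr_of_eventuallyEq (f₁ := deriv (okamotoQ b₁ b₃ b₄ h)) (by
      filter_upwards [H.eventually_nhds, hcq.eventually_ne h0, hcq.eventually_ne h1]
        with s hs hs0 hs1
      exact (hasDerivAt_okamotoQ hs hs0 hs1).deriv)
  rw [hD.deriv, hq.deriv]
  have h1' := sub_ne_zero.mpr h1
  have ht' := sub_ne_zero.mpr ht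
  simp only [id]
  generalize okamotoP b₁ b₃ b₄ h t = p at *
  generalize okamotoQ b₁ b₃ b₄ h t = q at *
  field_simp
  ring

/-- The linear relation for `okamotoL`, with `h'` replaced by its expression in `q` and `p`, is the
formula for `t (t - 1) H_VI`. -/
lemma auxiliary_eq_HVI (H : IsOkamotoPoint b₁ b₃ b₄ h t)
    (h0 : okamotoQ b₁ b₃ b₄ h t ≠ 0) (h1 : okamotoQ b₁ b₃ b₄ h t ≠ 1) :
    h t = t * (t - 1) * HVI ![b₁, 0, b₃, b₄] t (okamotoQ b₁ b₃ b₄ h t) (okamotoP b₁ b₃ b₄ h t)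
      + e2three ![b₁, 0, b₃, b₄] * t - 1 / 2 * e2four ![b₁, 0, b₃, b₄] := by
  have hL := okamotoL_eq (b₁ := b₁) H.okamotoA_ne_zero
  have hy := H.deriv_eq h0 h1
  rw [okamotoL, okamotoX_eq h0 h1, hy] at hL
  have ht0 := H.ne_zero
  have ht1 := sub_ne_zero.mpr H.ne_one
  rw [HVI, e2three, e2four, ← mul_assoc, mul_one_div_cancel (mul_ne_zero ht0 ht1), one_mul]
  simp only [Matrix.cons_val]
  linear_combination hL

variable {Ω : Set ℂ}

lemma eventually_okamotoQ_ne (hσ : b₃ + b₄ ≠ -1) (hh : MeromorphicAt h t)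
    (H : ∀ᶠ s in 𝓝[≠] t, IsOkamotoPoint b₁ b₃ b₄ h s) :
    MeromorphicAt (okamotoQ b₁ b₃ b₄ h) t ∧ MeromorphicAt (okamotoP b₁ b₃ b₄ h) t ∧
    ∀ᶠ s in 𝓝[≠] t, (∀ᶠ r in 𝓝 s, IsOkamotoPoint b₁ b₃ b₄ h r) ∧
      okamotoQ b₁ b₃ b₄ h s ≠ 0 ∧ okamotoQ b₁ b₃ b₄ h s ≠ 1 ∧ okamotoQ b₁ b₃ b₄ h s ≠ s := by
  have hy := hh.deriv
  have hy' := hy.deriv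
  have hq : MeromorphicAt (okamotoQ b₁ b₃ b₄ h) t := by
    unfold okamotoQ okamotoL okamotoK okamotoA
    fun_prop
  have hX : MeromorphicAt (okamotoX b₁ b₃ b₄ h) t := by
    unfold okamotoX okamotoL okamotoK okamotoA
    fun_prop
  have hp : MeromorphicAt (okamotoP b₁ b₃ b₄ h) t := by
    unfold okamotoP
    fun_prop
  refine ⟨hq, hp, ?_⟩
  have HN := eventually_nhdsNE_eventually_nhds H
  -- A meromorphic germ is either identically zero or nonzero in a punctured neighbourhood; the
  -- first case would hold near some generic point.
  have key : ∀ f : ℂ → ℂ, MeromorphicAt f t →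
      (∀ s, (∀ᶠ r in 𝓝 s, IsOkamotoPoint b₁ b₃ b₄ h r) → ¬ ∀ᶠ r in 𝓝 s, f r = 0) →
      ∀ᶠ s in 𝓝[≠] t, f s ≠ 0 := by
    intro f hf hns
    refine hf.eventually_eq_zero_or_eventually_ne_zero.resolve_left fun h0 => ?_
    obtain ⟨s, hs1, hs2⟩ := (HN.and (eventually_nhdsNE_eventually_nhds h0)).exists
    exact hns s hs1 hs2
  filter_upwards [HN, key _ hq fun s hs => okamotoQ_not_eventually_zero hs,
    key (fun s => okamotoQ b₁ b₃ b₄ h s - 1) (by fun_prop) fun s hs => by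
      simpa only [sub_eq_zero] using okamotoQ_not_eventually_one hs,
    key (fun s => okamotoQ b₁ b₃ b₄ h s - s) (by fun_prop) fun s hs => by
      simpa only [sub_eq_zero] using okamotoQ_not_eventually_self hσ hs] with s hs h0 h1 hst
  exact ⟨hs, h0, sub_ne_zero.mp h1, sub_ne_zero.mp hst⟩

/-- A generic solution of `E_VI` with `b_2 = 0` comes from a solution of the Hamiltonian system
and of the sixth Painlevé equation. -/
theorem okamoto_hamiltonian (hσ0 : b₃ + b₄ ≠ 0) (hσ : b₃ + b₄ ≠ -1) (hh : MeromorphicOn h Ω)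
    (H : ∀ t ∈ Ω, ∀ᶠ s in 𝓝[≠] t, IsOkamotoPoint b₁ b₃ b₄ h s) :
    IsHamiltonianSolution ![b₁, 0, b₃, b₄] Ω (okamotoQ b₁ b₃ b₄ h) (okamotoP b₁ b₃ b₄ h) ∧
    (∀ t ∈ Ω, ∀ᶠ s in 𝓝[≠] t, h s = s * (s - 1) *
      HVI ![b₁, 0, b₃, b₄] s (okamotoQ b₁ b₃ b₄ h s) (okamotoP b₁ b₃ b₄ h s)
      + e2three ![b₁, 0, b₃, b₄] * s - 1 / 2 * e2four ![b₁, 0, b₃, b₄]) ∧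
    IsPVISolution ((b₃ - b₄) ^ 2 / 2) (-b₁ ^ 2 / 2) (b₁ ^ 2 / 2)
      (-(b₃ + b₄) * (b₃ + b₄ + 2) / 2) Ω (okamotoQ b₁ b₃ b₄ h) := by
  have hE := fun t ht => eventually_okamotoQ_ne hσ (hh t ht) (H t ht)
  refine ⟨⟨fun t ht => (hE t ht).1, fun t ht => (hE t ht).2.1, ?_⟩, fun t ht => ?_,
    fun t ht => (hE t ht).1, ?_⟩
  · refine eventually_codiscreteWithin_of_nhdsNE fun t ht => ?_
    filter_upwards [(hE t ht).2.2] with s hs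
    obtain ⟨hs, h0, h1, -⟩ := hs
    rw [deriv_HVI_momentum, deriv_HVI_coordinate]
    simp only [Matrix.cons_val]
    refine ⟨(hasDerivAt_okamotoQ hs h0 h1).congr_deriv ?_,
      (hasDerivAt_okamotoP hσ0 hs h0 h1).congr_deriv ?_⟩ <;> ring
  · filter_upwards [(hE t ht).2.2] with s hs
    exact auxiliary_eq_HVI hs.1.self_of_nhds hs.2.1 hs.2.2.1
  · refine eventually_codiscreteWithin_of_nhdsNE fun t ht => ?_
    filter_upwards [(hE t ht).2.2] with s hs
    obtain ⟨hs, h0, h1, hst⟩ := hs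
    exact ⟨h0, h1, hst, painleve_okamotoQ hσ0 hs h0 h1 hst⟩

end Okamoto

end Umemura

/-! ### Genericity along the chain and assembly of the corollary -/

namespace Umemura

open Filter Topology

/-- If `U_{n,m}(z,w;a,0)` is not the zero polynomial, no odd index is lost. -/
lemma aseq_ne_zero_of_U_ne_zero {n m : ℕ} {a z w : ℂ} (hU : U n m 0 a 0 z w ≠ 0) {i : ℕ}
    (hi : i ∈ idx n m) (hodd : i % 2 = 1) : aseq a i ≠ 0 := by
  intro h0
  refine hU (Finset.sum_eq_zero fun I _ => ?_)
  by_cases hI : i ∈ I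
  · rw [Finset.prod_eq_zero (i := i) (by simpa using hI) h0]
    simp
  · rw [Finset.prod_eq_zero (s := idx n m \ I) (i := i) (Finset.mem_sdiff.mpr ⟨hi, hI⟩)
      (aseq_zero_of_odd i hodd)]
    simp

lemma mem_idx {n m i : ℕ} :
    i ∈ idx n m ↔ (1 ≤ i ∧ i ≤ n) ∨ ∃ j, (1 ≤ j ∧ j ≤ m) ∧ n + 2 * j = i := by
  simp [idx]

lemma aseq_odd_ne_zero_of_U_ne_zero {n m o e : ℕ} {a z w : ℂ}
    (hoe : (n = 2 * o ∧ e = o + m) ∨ (n = 2 * e + 1 ∧ o = e + 1 + m))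
    (hU : U n m 0 a 0 z w ≠ 0) (k : ℕ) (hk : k < o) : aseq a (2 * k + 1) ≠ 0 := by
  refine aseq_ne_zero_of_U_ne_zero hU (mem_idx.mpr ?_) (by omega)
  by_cases h : 2 * k + 1 ≤ n
  · exact Or.inl ⟨by omega, h⟩
  · exact Or.inr ⟨k - e, by omega, by omega⟩

section Chain

variable {Ω : Set ℂ} {x : ℂ → ℂ}

lemma analyticAt_chainH (hΩ : IsOpen Ω) (hx : DifferentiableOn ℂ x Ω)
    (hexp : ∀ t ∈ Ω, Complex.exp (2 * x t) = t / (t - 1)) (b₁ : ℂ) (o j : ℕ) {t : ℂ}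
    (ht : t ∈ Ω) (hu : chainU (-4 * b₁ ^ 2) o x j t ≠ 0) :
    AnalyticAt ℂ (chainH b₁ o x j) t := by
  rw [Complex.analyticAt_iff_eventually_differentiableAt]
  have h2 := ((differentiableOn_chainU hx (-4 * b₁ ^ 2) o j).differentiableAt
    (hΩ.mem_nhds ht)).continuousAt.eventually_ne hu
  filter_upwards [hΩ.mem_nhds ht, h2] with s hs hs2
  exact (hasDerivAt_chainH hΩ hx hexp b₁ o j hs hs2).differentiableAt

lemma meromorphicOn_chainH (hΩ : IsOpen Ω) (hx : DifferentiableOn ℂ x Ω) (b₁ : ℂ) (o j : ℕ) :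
    MeromorphicOn (chainH b₁ o x j) Ω := by
  intro t ht
  have hxa : AnalyticAt ℂ x t := hx.analyticAt (hΩ.mem_nhds ht)
  have hu : MeromorphicAt (chainU (-4 * b₁ ^ 2) o x j) t :=
    ((differentiableOn_chainU hx (-4 * b₁ ^ 2) o j).analyticAt (hΩ.mem_nhds ht)).meromorphicAt
  have hu' := hu.deriv
  have hz : MeromorphicAt (fun s => zOf (x s)) t :=
    AnalyticAt.meromorphicAt (AnalyticAt.fun_comp (g := zOf)
      (Differentiable.analyticAt (fun y => (hasDerivAt_zOf y).differentiableAt) _) hxa)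
  have hw : MeromorphicAt (fun s => wOf (x s)) t :=
    AnalyticAt.meromorphicAt (AnalyticAt.fun_comp (g := wOf)
      (Differentiable.analyticAt (fun y => (hasDerivAt_wOf y).differentiableAt) _) hxa)
  unfold chainH auxHam h0
  simp only [logDeriv_apply]
  fun_prop

/-- The Bäcklund relations require all earlier members of the chain to be nonzero. The resulting
equation involves only `h`, so continuity extends it to every point where the last member is
nonzero. -/
lemma chainH_okamoto (hΩ : IsOpen Ω) (hx : DifferentiableOn ℂ x Ω)
    (hexp : ∀ t ∈ Ω, Complex.exp (2 * x t) = t / (t - 1)) (b₁ : ℂ) (o e : ℕ)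
    (ha : ∀ k < o, aseq (-4 * b₁ ^ 2) (2 * k + 1) ≠ 0) {t : ℂ}
    (ht : t ∈ Ω) (hu : chainU (-4 * b₁ ^ 2) o x (e + 1) t ≠ 0) :
    (t * (t - 1) * deriv (deriv (chainH b₁ o x (e + 1))) t) ^ 2 +
      deriv (chainH b₁ o x (e + 1)) t * okamotoN (chainH b₁ o x (e + 1)) t ^ 2 =
      (deriv (chainH b₁ o x (e + 1)) t + b₁ ^ 2) *
        ((deriv (chainH b₁ o x (e + 1)) t + (o : ℂ) ^ 2) *
          (deriv (chainH b₁ o x (e + 1)) t + ((e : ℂ) + 1 / 2) ^ 2)) := by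
  have h0 := analyticAt_chainH hΩ hx hexp b₁ o (e + 1) ht hu
  have c0 := h0.continuousAt
  have c1 := h0.deriv.continuousAt
  have c2 := h0.deriv.deriv.continuousAt
  have hev : ∀ᶠ s in 𝓝[≠] t,
      (s * (s - 1) * deriv (deriv (chainH b₁ o x (e + 1))) s) ^ 2 +
      deriv (chainH b₁ o x (e + 1)) s * okamotoN (chainH b₁ o x (e + 1)) s ^ 2 =
      (deriv (chainH b₁ o x (e + 1)) s + b₁ ^ 2) *
        ((deriv (chainH b₁ o x (e + 1)) s + (o : ℂ) ^ 2) *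
          (deriv (chainH b₁ o x (e + 1)) s + ((e : ℂ) + 1 / 2) ^ 2)) := by
    filter_upwards [eventually_mem_goodSet hΩ hx hexp _ o (e + 1) ha ht] with s hs
    rw [(backlundPair_chainH hΩ hx hexp b₁ o (e + 1) (e + 1) le_rfl s hs).okamoto]
    push_cast
    ring
  unfold okamotoN at hev ⊢
  exact ((ContinuousAt.eventuallyEq_nhds_iff_eventuallyEq_nhdsNE (by fun_prop)
    (by fun_prop)).mp hev).self_of_nhds

lemma eventually_second_deriv_chainH_ne_zero (hΩ : IsOpen Ω) (hx : DifferentiableOn ℂ x Ω)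
    (hexp : ∀ t ∈ Ω, Complex.exp (2 * x t) = t / (t - 1)) (b₁ : ℂ) (o e : ℕ)
    (ha : ∀ k < o, aseq (-4 * b₁ ^ 2) (2 * k + 1) ≠ 0) (hb : b₁ ^ 2 ≠ (o : ℂ) ^ 2) {t : ℂ}
    (ht : t ∈ Ω) : ∀ᶠ s in 𝓝[≠] t, deriv (deriv (chainH b₁ o x (e + 1))) s ≠ 0 := by
  refine (meromorphicOn_chainH hΩ hx b₁ o (e + 1) t ht).deriv.deriv
    |>.eventually_eq_zero_or_eventually_ne_zero.resolve_left fun h0 => ?_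
  obtain ⟨s, hs⟩ := (eventually_nhdsNE_eventually_nhds
    (h0.and (eventually_mem_goodSet hΩ hx hexp _ o (e + 1) ha ht))).exists
  obtain ⟨V, hV, hVo, hsV⟩ := eventually_nhds_iff.mp hs
  exact not_deriv_deriv_chainH_eq_zero hΩ hx hexp b₁ o (e + 1) hb hVo (fun r hr => (hV r hr).2)
    ⟨s, hsV⟩ (e + 1) le_rfl fun r hr => (hV r hr).1

lemma eventually_isOkamotoPoint_chainH (hΩ : IsOpen Ω) (hx : DifferentiableOn ℂ x Ω)
    (hexp : ∀ t ∈ Ω, Complex.exp (2 * x t) = t / (t - 1)) {b₁ b₃ b₄ : ℂ} (o e : ℕ)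
    (hb34 : ∀ y, (y + b₃ ^ 2) * (y + b₄ ^ 2) = (y + (o : ℂ) ^ 2) * (y + ((e : ℂ) + 1 / 2) ^ 2))
    (ha : ∀ k < o, aseq (-4 * b₁ ^ 2) (2 * k + 1) ≠ 0) (hb : b₁ ^ 2 ≠ (o : ℂ) ^ 2) {t : ℂ}
    (ht : t ∈ Ω) : ∀ᶠ s in 𝓝[≠] t, IsOkamotoPoint b₁ b₃ b₄ (chainH b₁ o x (e + 1)) s := by
  have h2 := eventually_second_deriv_chainH_ne_zero hΩ hx hexp b₁ o e ha hb ht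
  -- If `h' + c` vanished near a point, so would `h''`.
  have hne : ∀ c : ℂ, ∀ᶠ s in 𝓝[≠] t, deriv (chainH b₁ o x (e + 1)) s + c ≠ 0 := by
    intro c
    have hm := (meromorphicOn_chainH hΩ hx b₁ o (e + 1) t ht).deriv
    refine MeromorphicAt.eventually_eq_zero_or_eventually_ne_zero
      (f := fun s => deriv (chainH b₁ o x (e + 1)) s + c) (by fun_prop) |>.resolve_left
        fun h0 => ?_
    obtain ⟨s, hs, hs2⟩ := ((eventually_nhdsNE_eventually_nhds h0).and h2).exists
    refine hs2 ?_
    have : deriv (chainH b₁ o x (e + 1)) =ᶠ[𝓝 s] fun _ => -c := by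
      filter_upwards [hs] with r hr using eq_neg_of_add_eq_zero_left hr
    rw [this.deriv_eq, deriv_const]
  filter_upwards [eventually_mem_goodSet hΩ hx hexp _ o (e + 1) ha ht, h2, hne (b₃ ^ 2),
    hne (b₄ ^ 2)] with s hs hs2 hs3 hs4
  obtain ⟨hs0, hs1⟩ := ne_zero_and_ne_one_of_exp (hexp s hs.1)
  have hu := hs.2 (e + 1) (by omega)
  refine ⟨analyticAt_chainH hΩ hx hexp b₁ o (e + 1) hs.1 hu, hs0, hs1, hs2,
    mul_ne_zero hs3 hs4, ?_⟩
  rw [chainH_okamoto hΩ hx hexp b₁ o e ha hs.1 hu, okamotoA, hb34]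

end Chain

lemma auxHam_const_mul {s : ℂ} (hs : s ≠ 0) (f h₀ : ℂ → ℂ) :
    auxHam (fun t => s * f t) h₀ = auxHam f h₀ := by
  ext t
  rw [auxHam, auxHam, logDeriv_const_mul t s hs]

lemma exists_odd_even_split (n m : ℕ) : ∃ o e : ℕ,
    ((n = 2 * o ∧ e = o + m) ∨ (n = 2 * e + 1 ∧ o = e + 1 + m)) ∧ kappa n m = 2 * o := by
  rcases Nat.even_or_odd' n with ⟨k, rfl | rfl⟩
  · exact ⟨k, k + m, Or.inl ⟨rfl, rfl⟩, by simp [kappa]⟩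
  · exact ⟨k + 1 + m, k, Or.inr ⟨rfl, rfl⟩, by
      rw [kappa, if_neg (by simp)]
      ring⟩

/-- If `h = t (t-1) (log u)' - h₀` is the auxiliary Hamiltonian of `(q, p)`, multiplying `u` by the
gauge factor `G` gives a `τ`-function. -/
lemma isTauFunction_of_auxHam {b : Fin 4 → ℂ} {V : Set ℂ} {q p u G h₀ : ℂ → ℂ} (hV : IsOpen V)
    (hT : ∀ t ∈ V, t * (t - 1) ≠ 0) (hu : DifferentiableOn ℂ u V)
    (hu0 : ∀ t ∈ V, ∀ᶠ s in 𝓝[≠] t, u s ≠ 0)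
    (hH : ∀ t ∈ V, ∀ᶠ s in 𝓝[≠] t, auxHam u h₀ s = s * (s - 1) * HVI b s (q s) (p s) +
      e2three b * s - 1 / 2 * e2four b)
    (hG : ∀ t ∈ V, G t ≠ 0 ∧ HasDerivAt G (-(h₀ t + e2three b * t - 1 / 2 * e2four b) /
      (t * (t - 1)) * G t) t) :
    IsTauFunction b V q p (fun t => u t * G t) := by
  refine ⟨hu.fun_mul fun t ht => (hG t ht).2.differentiableAt.differentiableWithinAt,
    eventually_codiscreteWithin_of_nhdsNE fun t ht => ?_⟩
  filter_upwards [hu0 t ht, hH t ht, mem_nhdsWithin_of_mem_nhds (hV.mem_nhds ht)] with s hs hsH hsV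
  obtain ⟨hG0, hGd⟩ := hG s hsV
  refine ⟨mul_ne_zero hs hG0, ?_⟩
  rw [logDeriv_mul s hs hG0 (hu.differentiableAt (hV.mem_nhds hsV)) hGd.differentiableAt,
    logDeriv_apply G, hGd.deriv, mul_div_cancel_right₀ _ hG0]
  apply mul_left_cancel₀ (hT s hsV)
  rw [mul_add, mul_div_cancel₀ _ (hT s hsV)]
  rw [auxHam] at hsH
  linear_combination hsH

end Umemura

theorem corollary1 (n m : ℕ) (a : ℂ) :
    -- for `b = 0` the unwanted term vanishes and the recurrence relation holds without it
    (∀ x : ℂ, Umemura.unwantedTerm n m a 0 x = 0) ∧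
    (0 < m → ∀ x : ℂ,
      Umemura.Ux n (m - 1) 0 a 0 x * Umemura.Ux n (m + 1) 0 a 0 x =
        (-Umemura.abar a (n + 2 * m + 2) * Umemura.zOf x ^ 2
            + Umemura.abar 0 (n + 2 * m + 2) * Umemura.wOf x ^ 2) * Umemura.Ux n m 0 a 0 x ^ 2
        + 8 * Umemura.zOf x ^ 2 * Umemura.wOf x ^ 2 *
            Umemura.hirota (Umemura.Ux n m 0 a 0) (Umemura.Ux n m 0 a 0) x) ∧
    -- if `U_{n,m}(z,w;a,0)` is not the zero polynomial, it defines a solution of Painlevé VI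
    ((∃ z w : ℂ, Umemura.U n m 0 a 0 z w ≠ 0) →
      ∀ b₁ : ℂ, a = -4 * b₁ ^ 2 →
      ∀ b : Fin 4 → ℂ, b = ![b₁, 0, (n : ℂ) / 2, ((n : ℂ) + 2 * m + 1) / 2] →
      ∀ Ω : Set ℂ, IsOpen Ω →
      ∀ x : ℂ → ℂ, DifferentiableOn ℂ x Ω →
        (∀ t ∈ Ω, Complex.exp (2 * x t) = t / (t - 1)) →
      ∀ u : ℂ → ℂ, u = (fun t => Umemura.Ux n m 0 a 0 (x t)) →
      ∀ h : ℂ → ℂ, h = Umemura.auxHam u (Umemura.h0 b₁ 0 x) →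
        (∀ᶠ t in Filter.codiscreteWithin Ω, u t ≠ 0) ∧
        (∀ t ∈ Ω, u t ≠ 0 → Umemura.SatisfiesEVI b h t) ∧
        (a ≠ -(Umemura.kappa n m : ℂ) ^ 2 →
          (∀ᶠ t in Filter.codiscreteWithin Ω, deriv (deriv h) t ≠ 0) ∧
          ∃ q p : ℂ → ℂ,
            Umemura.IsHamiltonianSolution b Ω q p ∧
            (∀ᶠ t in Filter.codiscreteWithin Ω,
              h t = t * (t - 1) * Umemura.HVI b t (q t) (p t)
                + Umemura.e2three b * t - 1 / 2 * Umemura.e2four b) ∧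
            (∀ V : Set ℂ, IsOpen V → V ⊆ Ω → ∀ G : ℂ → ℂ,
              (∀ t ∈ V, G t ≠ 0 ∧
                HasDerivAt G (-(Umemura.h0 b₁ 0 x t + Umemura.e2three b * t
                  - 1 / 2 * Umemura.e2four b) / (t * (t - 1)) * G t) t) →
              Umemura.IsTauFunction b V q p (fun t => u t * G t)) ∧
            Umemura.IsPVISolution ((b 2 - b 3) ^ 2 / 2) (-(b 0 + b 1) ^ 2 / 2)
              ((b 0 - b 1) ^ 2 / 2) (-(b 2 + b 3) * (b 2 + b 3 + 2) / 2) Ω q)) := by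
  refine ⟨fun x => by simp [Umemura.unwantedTerm], fun hm x => ?_, ?_⟩
  -- With `c = n + 2m + 1`, the relation `w² = z² + 1` gives `-(a + c²) z² + c² w² = c² - a z²`, the
  -- form in `Umemura.Ux_recurrence`.
  · obtain ⟨k, rfl⟩ : ∃ k, m = k + 1 := ⟨m - 1, by omega⟩
    have h := Umemura.Ux_recurrence n k a x
    have hw := Umemura.wOf_sq x
    simp only [Nat.add_sub_cancel, Umemura.abar]
    rw [h, hw]
    push_cast
    ring
  · rintro ⟨z, w, hU⟩ b₁ rfl b rfl Ω hΩ x hx hexp u hu h hh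
    obtain ⟨o, e, hoe, hκ⟩ := Umemura.exists_odd_even_split n m
    have ha := Umemura.aseq_odd_ne_zero_of_U_ne_zero hoe hU
    obtain ⟨s, hs, hUs⟩ := Umemura.exists_Ux_eq_mul_rowDet n m o e (-4 * b₁ ^ 2) hoe
    have hu' : u = fun t => s * Umemura.chainU (-4 * b₁ ^ 2) o x (e + 1) t := by
      rw [hu]
      exact funext fun t => hUs (x t)
    have hh' : h = Umemura.chainH b₁ o x (e + 1) := by
      rw [hh, hu', Umemura.auxHam_const_mul hs]
      rfl
    have hu0 : ∀ t ∈ Ω, ∀ᶠ r in nhdsWithin t {t}ᶜ, u r ≠ 0 := fun t ht => by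
      filter_upwards [Umemura.eventually_mem_goodSet hΩ hx hexp _ o e ha ht] with r hr
      rw [hu']
      exact mul_ne_zero hs (hr.2 (e + 1) le_rfl)
    have hT : ∀ t ∈ Ω, t * (t - 1) ≠ 0 := fun t ht => by
      obtain ⟨h0, h1⟩ := Umemura.ne_zero_and_ne_one_of_exp (hexp t ht)
      exact mul_ne_zero h0 (sub_ne_zero.mpr h1)
    -- `b_3, b_4` are `o, e + 1/2` for even `n` and `e + 1/2, o` for odd `n`; only the symmetric
    -- product matters.
    have hb34 : ∀ y : ℂ, (y + ((n : ℂ) / 2) ^ 2) * (y + (((n : ℂ) + 2 * m + 1) / 2) ^ 2) =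
        (y + (o : ℂ) ^ 2) * (y + ((e : ℂ) + 1 / 2) ^ 2) := by
      intro y
      rcases hoe with ⟨rfl, rfl⟩ | ⟨rfl, rfl⟩ <;> push_cast <;> ring
    refine ⟨Umemura.eventually_codiscreteWithin_of_nhdsNE hu0, fun t ht hut => ?_, fun hκa => ?_⟩
    · have hE := Umemura.chainH_okamoto hΩ hx hexp b₁ o e ha ht (by
        rw [hu'] at hut
        exact right_ne_zero_of_mul hut)
      rw [← hh', ← hb34, Umemura.okamotoN] at hE
      rw [Umemura.SatisfiesEVI, Fin.prod_univ_four]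
      simp only [Matrix.cons_val]
      -- For `b_2 = 0` the equation `E_VI` is `h'` times the relation obtained from the chain.
      linear_combination deriv h t * hE
    · have hb : b₁ ^ 2 ≠ (o : ℂ) ^ 2 := by
        rintro hb
        apply hκa
        rw [hb, hκ]
        push_cast
        ring
      -- `b_3 + b_4` is half of a positive odd integer, hence neither `0` nor `-1`.
      have hσ : (n : ℂ) / 2 + ((n : ℂ) + 2 * m + 1) / 2 = ((2 * n + 2 * m + 1 : ℕ) : ℂ) / 2 := by
        push_cast
        ring
      have hσ0 : (n : ℂ) / 2 + ((n : ℂ) + 2 * m + 1) / 2 ≠ 0 := by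
        rw [hσ]
        exact div_ne_zero (Nat.cast_ne_zero.mpr (by omega)) two_ne_zero
      have hσ1 : (n : ℂ) / 2 + ((n : ℂ) + 2 * m + 1) / 2 ≠ -1 := by
        rw [hσ, ne_eq, div_eq_iff two_ne_zero]
        intro h1
        have h2 : ((2 * n + 2 * m + 1 + 2 : ℕ) : ℂ) = 0 := by
          push_cast at h1 ⊢
          linear_combination h1
        exact absurd (Nat.cast_eq_zero.mp h2) (by omega)
      obtain ⟨hHam, hrel, hPVI⟩ := Umemura.okamoto_hamiltonian hσ0 hσ1
        (Umemura.meromorphicOn_chainH hΩ hx b₁ o (e + 1))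
        fun t ht => Umemura.eventually_isOkamotoPoint_chainH hΩ hx hexp o e hb34 ha hb ht
      rw [← hh'] at hHam hrel hPVI
      refine ⟨Umemura.eventually_codiscreteWithin_of_nhdsNE fun t ht => ?_, _, _, hHam,
        Umemura.eventually_codiscreteWithin_of_nhdsNE hrel, fun V hV hVΩ G hG => ?_, ?_⟩
      · rw [hh']
        exact Umemura.eventually_second_deriv_chainH_ne_zero hΩ hx hexp b₁ o e ha hb ht
      · refine Umemura.isTauFunction_of_auxHam hV (fun t ht => hT t (hVΩ ht)) ?_
          (fun t ht => hu0 t (hVΩ ht)) (fun t ht => ?_) hG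
        · rw [hu']
          exact ((Umemura.differentiableOn_chainU hx _ o (e + 1)).mono hVΩ).const_mul s
        · rw [← hh]
          exact hrel t (hVΩ ht)
      · simpa only [Matrix.cons_val, add_zero, sub_zero] using hPVI
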